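/- Let $k$ be a field of characteristic zero and let $\delta,\varepsilon\in\{1,-1\}$ be signs. **Brauer-type categories.** $\mathsf{FB}$ is the category of finite sets and bijections, and $\mathbf n=\{1,\dots,n\}$. A bijection $A\amalg(\mathbf 2\times\mathbf t)\cong B$ of finite sets is the same as an injection $A\hookrightarrow B$ together with an ordered list of $t$ directed pairs that partition the complement of its image. These are the morphisms $A\to B$ of a category (in a composite $A\to B\to C$, the pairs of the first morphism, transported to $C$, come first, followed by those of the second). Let $k\overrightarrow{\mathsf{ub}}_{\varepsilon}$ be the quotient of its $k$-linearization in which exchanging two adjacent pairs of the list multiplies a morphism by $\varepsilon$, and $k\mathsf{ub}_{(\delta;\varepsilon)}$ the quotient in which, moreover, reversing the direction of one pair multiplies a morphism by $\delta$. Similarly, let $k\mathsf{uwb}_\varepsilon$ be the $k$-linear category whose objects are pairs of finite sets and whose morphisms $(A_1,A_2)\to(B_1,B_2)$ are spanned by pairs of bijections $A_1\amalg\mathbf n\cong B_1$, $A_2\amalg\mathbf n\cong B_2$, that is, by pairs of injections $A_i\hookrightarrow B_i$ with an ordered list of $n$ walled pairs (elements of $B_1\times B_2$) exhausting the two complements,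 where exchanging two adjacent walled pairs multiplies a morphism by $\varepsilon$. Modules over $k\mathsf{db}_{(\delta;\varepsilon)}$, $k\overrightarrow{\mathsf{db}}_\varepsilon$ and $k\mathsf{dwb}_\varepsilon$ are the contravariant $k$-linear functors from $k\mathsf{ub}_{(\delta;\varepsilon)}$, $k\overrightarrow{\mathsf{ub}}_\varepsilon$ and $k\mathsf{uwb}_\varepsilon$ to $k$-vector spaces. **The functor $\mathsf d\mathcal J_{(\delta;\varepsilon)}$.** It takes $k\mathsf{dwb}_\varepsilon$-modules to $k\mathsf{db}_{(\delta;\varepsilon)}$-modules and is the composite of two functors. The first, $(\mathsf d\Upsilon_\varepsilon)_*$, sends $F$ to the $k\overrightarrow{\mathsf{db}}_\varepsilon$-module $X\mapsto\bigoplus_{X=X_1\amalg X_2}F(X_1,X_2)$; a morphism $f:A\to B$ acts on the summand $F(B_1,B_2)$ through the corresponding walled morphism $(f^{-1}B_1,f^{-1}B_2)\to(B_1,B_2)$ if all its pairs go from $B_1$ to $B_2$, and by zero otherwise. The second is restriction along the transfer $k\mathsf{ub}_{(\delta;\varepsilon)}\to k\overrightarrow{\mathsf{ub}}_\varepsilon$,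 which sends a morphism with list of pairs $p_1,\dots,p_t$ to $\sum_{S\subseteq\mathbf t}\delta^{|S|}$ times the morphism with the pairs $p_s$, $s\in S$, reversed. **Second Koszul complexes.** Write $V^\sharp$ for the dual of a vector space $V$. For a $k\mathsf{db}_{(\delta;\varepsilon)}$-module $M$, the complex of $k\mathsf{FB}$-modules $(k\mathsf{ub})_{(\delta;-\varepsilon)}^\sharp\otimes_{k\mathsf{FB}}M$ has degree $N$ part $U\mapsto k\mathsf{ub}_{(\delta;-\varepsilon)}(U,\mathbf N)^\sharp\otimes_{k\mathfrak S_N}M(\mathbf N)$ and differential from degree $N+2$ to degree $N$ $$g\otimes m\mapsto\sum_{1\le i<j\le N+2}g[\alpha_{ij}]\otimes[\alpha_{ij}^{\mathrm{op}}]m,$$ where $\alpha_{ij}:\mathbf N\to\mathbf{N+2}$ consists of the order preserving injection with image $\mathbf{N+2}\setminus\{i,j\}$ and the pair $(i,j)$. For a $k\mathsf{dwb}_\varepsilon$-module $F$, the complex of $k(\mathsf{FB}\times\mathsf{FB})$-modules $(k\mathsf{uwb})_{-\varepsilon}^\sharp\otimes_{k(\mathsf{FB}\times\mathsf{FB})}F$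 has degree $N$ part $(X,Y)\mapsto\bigoplus_{m+n=N}k\mathsf{uwb}_{-\varepsilon}((X,Y),(\mathbf m,\mathbf n))^\sharp\otimes_{k(\mathfrak S_m\times\mathfrak S_n)}F(\mathbf m,\mathbf n)$ and differential from degree $N+2$ to degree $N$ with components $$g\otimes f\mapsto\sum_{i\in\mathbf{m+1},\,j\in\mathbf{n+1}}g[\beta_{ij}]\otimes[\beta_{ij}^{\mathrm{op}}]f$$ from the summand $(m+1,n+1)$ to the summand $(m,n)$, where $\beta_{ij}$ consists of the order preserving injections omitting $i$ and $j$ and the walled pair $(i,j)$; the differential is zero on the summands $(m,0)$ and $(0,n)$. **The functor $\Phi$.** Let $\amalg_*^{\mathrm{op}}(k\mathsf{ub})_{(\delta;-\varepsilon)}^{\otimes2}$ be the bimodule $$(U,(X,Y))\mapsto\bigoplus_{U=U_1\amalg U_2}k\mathsf{ub}_{(\delta;-\varepsilon)}(U_1,X)\otimes k\mathsf{ub}_{(\delta;-\varepsilon)}(U_2,Y),$$ contravariant in $U\in\mathsf{FB}$ and covariant in $(X,Y)\in\mathsf{FB}\times\mathsf{FB}$, and let $$\Phi=\big(\amalg_*^{\mathrm{op}}(k\mathsf{ub})_{(\delta;-\varepsilon)}^{\otimes2}\big)^\sharp\otimes_{k(\mathsf{FB}\times\mathsf{FB})}-\,,$$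 a functor from $k(\mathsf{FB}\times\mathsf{FB})$-modules to $k\mathsf{FB}$-modules. **Theorem.** 1. There is an isomorphism of complexes of $k\mathsf{FB}$-modules, natural in the $k\mathsf{dwb}_\varepsilon$-module $F$, $$(k\mathsf{ub})_{(\delta;-\varepsilon)}^\sharp\otimes_{k\mathsf{FB}}\mathsf d\mathcal J_{(\delta;\varepsilon)}F\;\cong\;\Phi\big((k\mathsf{uwb})_{-\varepsilon}^\sharp\otimes_{k(\mathsf{FB}\times\mathsf{FB})}F\big).$$ 2. The functor $\Phi$ is exact. 3. Consequently, for every $N\ge0$ there is an isomorphism of $k\mathsf{FB}$-modules, natural in $F$, $$H_N\big((k\mathsf{ub})_{(\delta;-\varepsilon)}^\sharp\otimes_{k\mathsf{FB}}\mathsf d\mathcal J_{(\delta;\varepsilon)}F\big)\;\cong\;\Phi\big(H_N\big((k\mathsf{uwb})_{-\varepsilon}^\sharp\otimes_{k(\mathsf{FB}\times\mathsf{FB})}F\big)\big).$$ -/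

import Mathlib

open CategoryTheory Opposite
open scoped TensorProduct DirectSum

universe u w

namespace BrauerKoszul

noncomputable section

/-! ### Twisted linearizations of a category -/

/-- Relations `f = c • g` between parallel morphisms of a category, stable under composition. -/
structure TwistRel (k : Type u) (C : Type w) [Category.{0} C] where
  rel : ∀ {X Y : C}, (X ⟶ Y) → (X ⟶ Y) → k → Prop
  precomp : ∀ {W X Y : C} (h : W ⟶ X) {f g : X ⟶ Y} {c : k}, rel f g c → rel (h ≫ f) (h ≫ g) c
  postcomp : ∀ {X Y Z : C} {f g : X ⟶ Y} (h : Y ⟶ Z) {c : k}, rel f g c → rel (f ≫ h) (g ≫ h) c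

section Twisted

variable {k : Type u} [Field k] {C : Type w} [Category.{0} C]

/-- The submodule of `k[C(X, Y)]` spanned by the elements `[f] - c [g]` given by the relations. -/
def TwistRel.span (T : TwistRel k C) (X Y : C) : Submodule k ((X ⟶ Y) →₀ k) :=
  Submodule.span k {x | ∃ (f g : X ⟶ Y) (c : k), T.rel f g c ∧
    x = Finsupp.single f 1 - Finsupp.single g c}

/-- The quotient of the `k`-linearization of `C` by the relations `T`; it has the objects of
`C`. -/
structure Twisted (T : TwistRel k C) : Type w where
  obj : C

namespace Twisted

variable (T : TwistRel k C)

/-- Morphisms: the quotient of the free module on the morphisms of `C`. -/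
abbrev Hom (X Y : C) : Type u := ((X ⟶ Y) →₀ k) ⧸ T.span X Y

variable {T}

/-- The class of a morphism of `C`. -/
def cls {X Y : C} (f : X ⟶ Y) : Hom T X Y := (T.span X Y).mkQ (Finsupp.single f 1)

theorem cls_rel {X Y : C} {f g : X ⟶ Y} {c : k} (h : T.rel f g c) :
    (cls f : Hom T X Y) = c • cls g := by
  unfold cls
  rw [← map_smul, ← sub_eq_zero, ← map_sub, Submodule.mkQ_apply, Submodule.Quotient.mk_eq_zero]
  exact Submodule.subset_span ⟨f, g, c, h, by simp⟩

theorem hom_induction {X Y : C} {p : Hom T X Y → Prop} (a : Hom T X Y)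
    (h : ∀ f, p (cls f)) (h0 : p 0) (ha : ∀ a b, p a → p b → p (a + b))
    (hs : ∀ (c : k) a, p a → p (c • a)) : p a := by
  obtain ⟨a, rfl⟩ := Submodule.mkQ_surjective _ a
  induction a using Finsupp.induction_linear with
  | zero => simpa using h0
  | add a b h1 h2 => rw [map_add]; exact ha _ _ h1 h2
  | single f c =>
    have : Finsupp.single f c = c • Finsupp.single f (1 : k) := by simp
    rw [this, map_smul]
    exact hs _ _ (h f)

theorem hom_ext {X Y : C} {M : Type*} [AddCommGroup M] [Module k M] {a b : Hom T X Y →ₗ[k] M}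
    (h : ∀ f : X ⟶ Y, a (cls f) = b (cls f)) : a = b := by
  apply Submodule.linearMap_qext
  ext f
  exact h f

/-- Linear maps out of a morphism space are given by functions on the morphisms of `C` that
respect the relations. -/
def desc {X Y : C} {M : Type*} [AddCommGroup M] [Module k M] (φ : (X ⟶ Y) → M)
    (h : ∀ f g c, T.rel f g c → φ f = c • φ g) : Hom T X Y →ₗ[k] M :=
  (T.span X Y).liftQ (Finsupp.linearCombination k φ) (by
    rw [TwistRel.span, Submodule.span_le]
    rintro _ ⟨f, g, c, hr, rfl⟩
    simp [h f g c hr])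

@[simp] theorem desc_cls {X Y : C} {M : Type*} [AddCommGroup M] [Module k M] (φ : (X ⟶ Y) → M)
    (h : ∀ f g c, T.rel f g c → φ f = c • φ g) (f : X ⟶ Y) :
    desc (T := T) φ h (cls f) = φ f := by
  simp [desc, cls]

/-- The bilinear composition. -/
def compL (X Y Z : C) : Hom T X Y →ₗ[k] Hom T Y Z →ₗ[k] Hom T X Z :=
  desc (fun f => desc (fun g => cls (f ≫ g)) (fun _ _ _ h => cls_rel (T.precomp f h)))
    (fun _ _ _ h => hom_ext fun g => by simp [cls_rel (T.postcomp g h)])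

@[simp] theorem compL_cls {X Y Z : C} (f : X ⟶ Y) (g : Y ⟶ Z) :
    compL (T := T) X Y Z (cls f) (cls g) = cls (f ≫ g) := by simp [compL]

variable (T)

instance : Category.{u} (Twisted T) where
  Hom X Y := Hom T X.obj Y.obj
  id X := cls (𝟙 X.obj)
  comp {X Y Z} f g := compL X.obj Y.obj Z.obj f g
  id_comp {X Y} f := by
    induction f using hom_induction with
    | h f => simp
    | h0 => simp
    | ha a b h1 h2 => simp_all
    | hs c a h => simp_all
  comp_id {X Y} f := by
    induction f using hom_induction with
    | h f => simp
    | h0 => simp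
    | ha a b h1 h2 => simp_all
    | hs c a h => simp_all
  assoc {W X Y Z} f g h := by
    induction f using hom_induction with
    | h0 => simp
    | ha a b h1 h2 => simp_all
    | hs c a h => simp_all
    | h f =>
      induction g using hom_induction with
      | h0 => simp
      | ha a b h1 h2 => simp_all
      | hs c a h => simp_all
      | h g =>
        induction h using hom_induction with
        | h0 => simp
        | ha a b h1 h2 => simp_all
        | hs c a h => simp_all
        | h h => simp

instance : Preadditive (Twisted T) where
  homGroup X Y := inferInstanceAs (AddCommGroup (Hom T X.obj Y.obj))
  add_comp X Y Z f f' g := LinearMap.map_add₂ (compL X.obj Y.obj Z.obj) f f' g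
  comp_add X Y Z f (g : Hom T Y.obj Z.obj) (g' : Hom T Y.obj Z.obj) := map_add (compL X.obj Y.obj Z.obj f) g g'

instance : Linear k (Twisted T) where
  homModule X Y := inferInstanceAs (Module k (Hom T X.obj Y.obj))
  smul_comp X Y Z r f g := LinearMap.map_smul₂ (compL X.obj Y.obj Z.obj) r f g
  comp_smul X Y Z f r (g : Hom T Y.obj Z.obj) := map_smul (compL X.obj Y.obj Z.obj f) r g

/-- The canonical functor from `C`. -/
@[simps] def quot : C ⥤ Twisted T where
  obj X := ⟨X⟩
  map f := (cls f : Hom T _ _)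
  map_comp f g := (compL_cls f g).symm

variable {T}

/-- The linear functor to a linear category induced by a functor on `C` that respects the
relations. -/
@[simps obj] def lift {D : Type*} [Category D] [Preadditive D] [Linear k D] (F : C ⥤ D)
    (hF : ∀ {X Y : C} (f g : X ⟶ Y) (c : k), T.rel f g c → F.map f = c • F.map g) :
    Twisted T ⥤ D where
  obj X := F.obj X.obj
  map {X Y} a := desc (T := T) (fun f => F.map f) hF a
  map_id X := by
    change desc (T := T) _ _ (cls (𝟙 X.obj)) = _
    simp
  map_comp {X Y Z} a b := by
    change desc (T := T) _ _ (compL _ _ _ a b) = _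
    induction a using hom_induction with
    | h0 => simp
    | ha a b h1 h2 => simp_all
    | hs c a h => simp_all
    | h f =>
      induction b using hom_induction with
      | h0 => simp
      | ha a b h1 h2 => simp_all
      | hs c a h => simp_all
      | h g => simp

/-- The contravariant linear functor induced by a contravariant functor on `C` that respects the
relations. -/
@[simps obj] def liftOp {D : Type*} [Category D] [Preadditive D] [Linear k D] (F : Cᵒᵖ ⥤ D)
    (hF : ∀ {X Y : C} (f g : X ⟶ Y) (c : k), T.rel f g c → F.map f.op = c • F.map g.op) :
    (Twisted T)ᵒᵖ ⥤ D where
  obj X := F.obj (op X.unop.obj)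
  map {X Y} a := desc (T := T) (fun f => F.map f.op) hF a.unop
  map_id X := by
    change desc (T := T) _ _ (cls (𝟙 X.unop.obj)) = _
    simp
  map_comp {X Y Z} a b := by
    change desc (T := T) _ _ (compL _ _ _ b.unop a.unop) =
      desc (T := T) _ _ a.unop ≫ desc (T := T) _ _ b.unop
    generalize a.unop = a
    generalize b.unop = b
    induction a using hom_induction with
    | h0 => simp
    | ha a b h1 h2 => simp_all
    | hs c a h => simp_all
    | h f =>
      induction b using hom_induction with
      | h0 => simp
      | ha a b h1 h2 => simp_all
      | hs c a h => simp_all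
      | h g => simp

theorem liftOp_map_cls {D : Type*} [Category D] [Preadditive D] [Linear k D] (F : Cᵒᵖ ⥤ D)
    (hF : ∀ {X Y : C} (f g : X ⟶ Y) (c : k), T.rel f g c → F.map f.op = c • F.map g.op)
    {X Y : C} (f : X ⟶ Y) :
    (liftOp F hF).map ((quot T).map f).op = F.map f.op :=
  desc_cls _ hF f

/-- A natural transformation between functors on `C` induces one on the linear extensions. -/
@[simps] def liftOpMap {D : Type*} [Category D] [Preadditive D] [Linear k D] {F G : Cᵒᵖ ⥤ D}
    (hF : ∀ {X Y : C} (f g : X ⟶ Y) (c : k), T.rel f g c → F.map f.op = c • F.map g.op)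
    (hG : ∀ {X Y : C} (f g : X ⟶ Y) (c : k), T.rel f g c → G.map f.op = c • G.map g.op)
    (θ : F ⟶ G) : liftOp F hF ⟶ liftOp G hG where
  app X := θ.app (op X.unop.obj)
  naturality {X Y} a := by
    have H : Linear.rightComp k (F.obj (op X.unop.obj)) (θ.app (op Y.unop.obj)) ∘ₗ
        desc (T := T) (fun f : Y.unop.obj ⟶ X.unop.obj => F.map f.op) hF =
        Linear.leftComp k (G.obj (op Y.unop.obj)) (θ.app (op X.unop.obj)) ∘ₗ
          desc (T := T) (fun f : Y.unop.obj ⟶ X.unop.obj => G.map f.op) hG :=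
      hom_ext fun f => by simp
    exact LinearMap.congr_fun H a.unop

end Twisted
end Twisted

/-! ### Finite sets and the ordered upward Brauer categories -/

/-- Finite sets; the morphisms are the bijections. -/
structure FB : Type 1 where
  carrier : Type
  [finite : Finite carrier]

attribute [instance] FB.finite

instance : CoeSort FB Type := ⟨FB.carrier⟩

/-- The finite set `{0, …, n - 1}`. -/
abbrev FB.fin (n : ℕ) : FB := ⟨Fin n⟩

instance : Groupoid.{0} FB where
  Hom A B := A ≃ B
  id A := Equiv.refl A
  comp f g := Equiv.trans f g
  inv f := Equiv.symm f
  inv_comp f := Equiv.symm_trans_self f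
  comp_inv f := Equiv.self_trans_symm f

/-- The underlying equivalence of a morphism of `FB`. -/
def FB.equiv {A B : FB} (σ : A ⟶ B) : A ≃ B := σ

/-- The list of the points occurring in a list of pairs. -/
def points {α : Type} (l : List (α × α)) : List α := l.flatMap fun p => [p.1, p.2]

theorem points_append {α : Type} (l m : List (α × α)) :
    points (l ++ m) = points l ++ points m := List.flatMap_append

theorem points_map {α β : Type} (f : α → β) (l : List (α × α)) :
    points (l.map (Prod.map f f)) = (points l).map f := by
  simp [points, List.flatMap_map, List.map_flatMap]

/-- A bijection from `A ⊔ (𝟐 × 𝐭)` to `B`, for some `t`: an injection of `A` into `B` together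
with a list (of length `t`) of directed pairs of elements of `B` in which every element of the
complement of the image of `A` occurs exactly once, and no other element occurs. -/
@[ext] structure UbHom (A B : FB) where
  map : A → B
  pairs : List (B × B)
  inj : Function.Injective map
  nodup : (points pairs).Nodup
  compl : ∀ b, b ∈ Set.range map ↔ b ∉ points pairs

/-- The ordered directed upward Brauer category: in a composite `f ≫ g`, the pairs of `f`
(transported along `g`) come first, followed by those of `g`. -/
structure UbOrd : Type 1 where
  set : FB

instance : Category.{0} UbOrd where
  Hom A B := UbHom A.set B.set
  id A :=
    { map := id
      pairs := []
      inj := Function.injective_id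
      nodup := by simp [points]
      compl := by simp [points] }
  comp {A B C} f g :=
    { map := g.map ∘ f.map
      pairs := f.pairs.map (Prod.map g.map g.map) ++ g.pairs
      inj := g.inj.comp f.inj
      nodup := by
        rw [points_append, points_map, List.nodup_append']
        refine ⟨f.nodup.map g.inj, g.nodup, ?_⟩
        intro x hx hx'
        obtain ⟨y, -, rfl⟩ := List.mem_map.1 hx
        exact (g.compl _).1 ⟨y, rfl⟩ hx'
      compl := by
        intro c
        rw [points_append, points_map, List.mem_append, not_or, ← g.compl]
        constructor
        · rintro ⟨a, rfl⟩
          refine ⟨?_, ⟨_, rfl⟩⟩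
          rw [Function.comp_apply, List.mem_map_of_injective g.inj, ← f.compl]
          exact ⟨a, rfl⟩
        · rintro ⟨h, b, rfl⟩
          rw [List.mem_map_of_injective g.inj, ← f.compl] at h
          obtain ⟨a, rfl⟩ := h
          exact ⟨a, rfl⟩ }
  id_comp f := UbHom.ext rfl rfl
  comp_id f := UbHom.ext rfl (by simp)
  assoc f g h := UbHom.ext rfl (by simp [Function.comp_def, Prod.map])

/-- Bijections as morphisms without pairs. -/
def FB.toUbOrd : FB ⥤ UbOrd where
  obj A := ⟨A⟩
  map {A B} σ :=
    { map := FB.equiv σ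
      pairs := []
      inj := (FB.equiv σ).injective
      nodup := by simp [points]
      compl := fun b => by simp [points] }
  map_id _ := rfl
  map_comp f g := rfl

/-- Pairs of finite sets, the objects of the ordered upward walled Brauer category. -/
structure UwbOrd : Type 1 where
  fst : FB
  snd : FB

/-- A pair of bijections `X₁ ⊔ 𝐧 ≃ Y₁`, `X₂ ⊔ 𝐧 ≃ Y₂`, for some `n`: a pair of injections
together with a list (of length `n`) of walled pairs in which every element of the complement of
either image occurs exactly once, and no other element occurs. -/
@[ext] structure UwbHom (X Y : UwbOrd) where
  map₁ : X.fst → Y.fst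
  map₂ : X.snd → Y.snd
  pairs : List (Y.fst × Y.snd)
  inj₁ : Function.Injective map₁
  inj₂ : Function.Injective map₂
  nodup₁ : (pairs.map Prod.fst).Nodup
  nodup₂ : (pairs.map Prod.snd).Nodup
  compl₁ : ∀ y, y ∈ Set.range map₁ ↔ y ∉ pairs.map Prod.fst
  compl₂ : ∀ y, y ∈ Set.range map₂ ↔ y ∉ pairs.map Prod.snd

theorem nodup_comp {B C : Type} {g : B → C} (hg : Function.Injective g) {l : List B} {m : List C}
    (hl : l.Nodup) (hm : m.Nodup) (h : ∀ c, c ∈ Set.range g ↔ c ∉ m) :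
    (l.map g ++ m).Nodup := by
  rw [List.nodup_append']
  refine ⟨hl.map hg, hm, ?_⟩
  intro x hx hx'
  obtain ⟨y, -, rfl⟩ := List.mem_map.1 hx
  exact (h _).1 ⟨y, rfl⟩ hx'

theorem compl_comp {A B C : Type} {f : A → B} {g : B → C} (hg : Function.Injective g) {l : List B}
    {m : List C} (hf : ∀ b, b ∈ Set.range f ↔ b ∉ l) (h : ∀ c, c ∈ Set.range g ↔ c ∉ m) (c : C) :
    c ∈ Set.range (g ∘ f) ↔ c ∉ l.map g ++ m := by
  rw [List.mem_append, not_or, ← h]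
  constructor
  · rintro ⟨a, rfl⟩
    refine ⟨?_, ⟨_, rfl⟩⟩
    rw [Function.comp_apply, List.mem_map_of_injective hg, ← hf]
    exact ⟨a, rfl⟩
  · rintro ⟨h, b, rfl⟩
    rw [List.mem_map_of_injective hg, ← hf] at h
    obtain ⟨a, rfl⟩ := h
    exact ⟨a, rfl⟩

/-- The ordered upward walled Brauer category. -/
instance : Category.{0} UwbOrd where
  Hom X Y := UwbHom X Y
  id X :=
    { map₁ := id
      map₂ := id
      pairs := []
      inj₁ := Function.injective_id
      inj₂ := Function.injective_id
      nodup₁ := by simp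
      nodup₂ := by simp
      compl₁ := by simp
      compl₂ := by simp }
  comp {X Y Z} f g :=
    { map₁ := g.map₁ ∘ f.map₁
      map₂ := g.map₂ ∘ f.map₂
      pairs := f.pairs.map (Prod.map g.map₁ g.map₂) ++ g.pairs
      inj₁ := g.inj₁.comp f.inj₁
      inj₂ := g.inj₂.comp f.inj₂
      nodup₁ := by
        have := nodup_comp g.inj₁ f.nodup₁ g.nodup₁ g.compl₁
        simpa [Function.comp_def] using this
      nodup₂ := by
        have := nodup_comp g.inj₂ f.nodup₂ g.nodup₂ g.compl₂
        simpa [Function.comp_def] using this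
      compl₁ := by
        have := compl_comp g.inj₁ f.compl₁ g.compl₁
        simpa [Function.comp_def] using this
      compl₂ := by
        have := compl_comp g.inj₂ f.compl₂ g.compl₂
        simpa [Function.comp_def] using this }
  id_comp f := UwbHom.ext rfl rfl rfl
  comp_id f := UwbHom.ext rfl rfl (by simp)
  assoc f g h := UwbHom.ext rfl rfl (by simp [Function.comp_def, Prod.map])

/-- Pairs of bijections as morphisms without pairs. -/
def FB.toUwbOrd : FB × FB ⥤ UwbOrd where
  obj X := ⟨X.1, X.2⟩
  map {X Y} σ :=
    { map₁ := FB.equiv σ.1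
      map₂ := FB.equiv σ.2
      pairs := []
      inj₁ := (FB.equiv σ.1).injective
      inj₂ := (FB.equiv σ.2).injective
      nodup₁ := by simp
      nodup₂ := by simp
      compl₁ := fun b => by simp
      compl₂ := fun b => by simp }
  map_id _ := rfl
  map_comp f g := rfl

/-! ### The twisted linear Brauer categories -/

section Brauer

variable (k : Type u) [Field k]

/-- A sign as an element of the field. -/
def sgn (ε : ℤˣ) : k := ((ε : ℤ) : k)

/-- The relations for the action of the symmetric group `𝔖_t` on the list of pairs through the
trivial (`ε = 1`) or the sign (`ε = -1`) representation; they are imposed for the generating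
adjacent transpositions. -/
inductive DirTwist (ε : ℤˣ) {A B : FB} (f g : UbHom A B) : k → Prop
  | swap (l₁ l₂ : List (B × B)) (p q : B × B) : f.map = g.map →
      f.pairs = l₁ ++ p :: q :: l₂ → g.pairs = l₁ ++ q :: p :: l₂ → DirTwist ε f g (sgn k ε)

/-- The relations for the action of the wreath product `𝔖_2 ≀ 𝔖_t` through the representation
`(k^δ; k^ε)`; they are imposed for the generating adjacent transpositions in `𝔖_t` and for the
transpositions in each factor of `𝔖_2 ^ t`. -/
inductive UbTwist (δ ε : ℤˣ) {A B : FB} (f g : UbHom A B) : k → Prop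
  | swap (l₁ l₂ : List (B × B)) (p q : B × B) : f.map = g.map →
      f.pairs = l₁ ++ p :: q :: l₂ → g.pairs = l₁ ++ q :: p :: l₂ → UbTwist δ ε f g (sgn k ε)
  | flip (l₁ l₂ : List (B × B)) (p : B × B) : f.map = g.map →
      f.pairs = l₁ ++ p :: l₂ → g.pairs = l₁ ++ p.swap :: l₂ → UbTwist δ ε f g (sgn k δ)

/-- The relations for the diagonal action of `𝔖_n` through the trivial or the sign
representation, in the walled case. -/
inductive UwbTwist (ε : ℤˣ) {X Y : UwbOrd} (f g : UwbHom X Y) : k → Prop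
  | swap (l₁ l₂ : List (Y.fst × Y.snd)) (p q : Y.fst × Y.snd) : f.map₁ = g.map₁ →
      f.map₂ = g.map₂ → f.pairs = l₁ ++ p :: q :: l₂ → g.pairs = l₁ ++ q :: p :: l₂ →
      UwbTwist ε f g (sgn k ε)

def dirTwistRel (ε : ℤˣ) : TwistRel k UbOrd where
  rel {X Y} f g c := DirTwist k ε f g c
  precomp := by
    rintro W X Y h f g _ ⟨l₁, l₂, p, q, h1, h2, h3⟩
    refine .swap (h.pairs.map (Prod.map f.map f.map) ++ l₁) l₂ p q ?_ ?_ ?_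
    · exact congrArg (· ∘ h.map) h1
    · change _ ++ f.pairs = _
      simp [h2]
    · change _ ++ g.pairs = _
      simp [h3, h1]
  postcomp := by
    rintro X Y Z f g h _ ⟨l₁, l₂, p, q, h1, h2, h3⟩
    refine .swap (l₁.map (Prod.map h.map h.map)) (l₂.map (Prod.map h.map h.map) ++ h.pairs)
      (Prod.map h.map h.map p) (Prod.map h.map h.map q) ?_ ?_ ?_
    · exact congrArg (h.map ∘ ·) h1
    · change f.pairs.map _ ++ h.pairs = _
      simp [h2]
    · change g.pairs.map _ ++ h.pairs = _
      simp [h3]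

def ubTwistRel (δ ε : ℤˣ) : TwistRel k UbOrd where
  rel {X Y} f g c := UbTwist k δ ε f g c
  precomp := by
    rintro W X Y h f g _ (⟨l₁, l₂, p, q, h1, h2, h3⟩ | ⟨l₁, l₂, p, h1, h2, h3⟩)
    · refine .swap (h.pairs.map (Prod.map f.map f.map) ++ l₁) l₂ p q ?_ ?_ ?_
      · exact congrArg (· ∘ h.map) h1
      · change _ ++ f.pairs = _
        simp [h2]
      · change _ ++ g.pairs = _
        simp [h3, h1]
    · refine .flip (h.pairs.map (Prod.map f.map f.map) ++ l₁) l₂ p ?_ ?_ ?_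
      · exact congrArg (· ∘ h.map) h1
      · change _ ++ f.pairs = _
        simp [h2]
      · change _ ++ g.pairs = _
        simp [h3, h1]
  postcomp := by
    rintro X Y Z f g h _ (⟨l₁, l₂, p, q, h1, h2, h3⟩ | ⟨l₁, l₂, p, h1, h2, h3⟩)
    · refine .swap (l₁.map (Prod.map h.map h.map)) (l₂.map (Prod.map h.map h.map) ++ h.pairs)
        (Prod.map h.map h.map p) (Prod.map h.map h.map q) ?_ ?_ ?_
      · exact congrArg (h.map ∘ ·) h1
      · change f.pairs.map _ ++ h.pairs = _
        simp [h2]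
      · change g.pairs.map _ ++ h.pairs = _
        simp [h3]
    · refine .flip (l₁.map (Prod.map h.map h.map)) (l₂.map (Prod.map h.map h.map) ++ h.pairs)
        (Prod.map h.map h.map p) ?_ ?_ ?_
      · exact congrArg (h.map ∘ ·) h1
      · change f.pairs.map _ ++ h.pairs = _
        simp [h2]
      · change g.pairs.map _ ++ h.pairs = _
        simp [h3]
        rfl

def uwbTwistRel (ε : ℤˣ) : TwistRel k UwbOrd where
  rel {X Y} f g c := UwbTwist k ε f g c
  precomp := by
    rintro W X Y h f g _ ⟨l₁, l₂, p, q, h1, h1', h2, h3⟩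
    refine .swap (h.pairs.map (Prod.map f.map₁ f.map₂) ++ l₁) l₂ p q ?_ ?_ ?_ ?_
    · exact congrArg (· ∘ h.map₁) h1
    · exact congrArg (· ∘ h.map₂) h1'
    · change _ ++ f.pairs = _
      simp [h2]
    · change _ ++ g.pairs = _
      simp [h3, h1, h1']
  postcomp := by
    rintro X Y Z f g h _ ⟨l₁, l₂, p, q, h1, h1', h2, h3⟩
    refine .swap (l₁.map (Prod.map h.map₁ h.map₂)) (l₂.map (Prod.map h.map₁ h.map₂) ++ h.pairs)
      (Prod.map h.map₁ h.map₂ p) (Prod.map h.map₁ h.map₂ q) ?_ ?_ ?_ ?_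
    · exact congrArg (h.map₁ ∘ ·) h1
    · exact congrArg (h.map₂ ∘ ·) h1'
    · change f.pairs.map _ ++ h.pairs = _
      simp [h2]
    · change g.pairs.map _ ++ h.pairs = _
      simp [h3]

/-- The twisted linearization `(k ub→)_ε` of the directed upward Brauer category. -/
abbrev KDub (ε : ℤˣ) := Twisted (dirTwistRel k ε)

/-- The twisted linearization `(k ub)_(δ; ε)` of the upward Brauer category. -/
abbrev KUb (δ ε : ℤˣ) := Twisted (ubTwistRel k δ ε)

/-- The twisted linearization `(k uwb)_ε` of the upward walled Brauer category. -/
abbrev KUwb (ε : ℤˣ) := Twisted (uwbTwistRel k ε)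

/-- The inclusion of `FB` in `(k ub)_(δ; ε)`. -/
abbrev FB.toKUb (δ ε : ℤˣ) : FB ⥤ KUb k δ ε := FB.toUbOrd ⋙ Twisted.quot _

/-- The inclusion of `FB × FB` in `(k uwb)_ε`. -/
abbrev FB.toKUwb (ε : ℤˣ) : FB × FB ⥤ KUwb k ε := FB.toUwbOrd ⋙ Twisted.quot _

end Brauer


/-! ### Modules -/

section Modules

variable (k : Type u) [Field k]

/-- `k`-linear functors from the opposite of a `k`-linear category to `k`-vector spaces. -/
def isLinear (A : Type w) [Category.{u} A] [Preadditive A] [Linear k A] :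
    ObjectProperty (Aᵒᵖ ⥤ ModuleCat.{u} k) := fun F =>
  (∀ (X Y : A) (f g : X ⟶ Y), F.map (f + g).op = F.map f.op + F.map g.op) ∧
    ∀ (X Y : A) (r : k) (f : X ⟶ Y), F.map (r • f).op = r • F.map f.op

/-- The category of modules over the opposite of a `k`-linear category `A` (equivalently, of
right `A`-modules). The modules over a downward Brauer category are obtained by taking for `A` the
corresponding upward Brauer category. -/
abbrev OpMod (A : Type w) [Category.{u} A] [Preadditive A] [Linear k A] : Type _ :=
  (isLinear k A).FullSubcategory

variable {k}

theorem Twisted.isLinear_liftOp {C : Type w} [Category.{0} C] {T : TwistRel k C}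
    (F : Cᵒᵖ ⥤ ModuleCat.{u} k)
    (hF : ∀ {X Y : C} (f g : X ⟶ Y) (c : k), T.rel f g c → F.map f.op = c • F.map g.op) :
    isLinear k (Twisted T) (Twisted.liftOp F hF) :=
  ⟨fun X Y f g => map_add (Twisted.desc (T := T) (X := X.obj) (Y := Y.obj) _ hF) f g,
    fun X Y r f => map_smul (Twisted.desc (T := T) (X := X.obj) (Y := Y.obj) _ hF) r f⟩

/-- The restriction of a module to the untwisted category. -/
abbrev Twisted.restr {C : Type w} [Category.{0} C] {T : TwistRel k C}
    (F : (Twisted T)ᵒᵖ ⥤ ModuleCat.{u} k) : Cᵒᵖ ⥤ ModuleCat.{u} k := (Twisted.quot T).op ⋙ F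

theorem Twisted.restr_rel {C : Type w} [Category.{0} C] {T : TwistRel k C}
    {F : (Twisted T)ᵒᵖ ⥤ ModuleCat.{u} k} (hF : isLinear k (Twisted T) F) {X Y : C} {f g : X ⟶ Y}
    {c : k} (h : T.rel f g c) : (restr F).map f.op = c • (restr F).map g.op := by
  change F.map (Quiver.Hom.op ((Twisted.quot T).map f)) = _
  have : (Twisted.quot T).map f = c • (Twisted.quot T).map g := Twisted.cls_rel h
  rw [this, hF.2]
  rfl

end Modules

/-! ### The functor from walled to directed modules -/

/-- Decompositions `X = X₁ ⊔ X₂` of a finite set, coded by the function with value `true` on `X₁`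
and `false` on `X₂`. -/
abbrev Splitting (X : FB) : Type := X → Bool

instance (X : FB) : DecidableEq (Splitting X) := Classical.decEq _

/-- The inverse image of a decomposition under a map. -/
abbrev Splitting.pull {X Y : FB} (c : Splitting Y) (f : X → Y) : Splitting X := fun x => c (f x)

/-- The two parts of a decomposition. -/
abbrev Splitting.part {X : FB} (c : Splitting X) (b : Bool) : FB := ⟨{x : X // c x = b}⟩

/-- The pair `(X₁, X₂)`. -/
abbrev Splitting.parts {X : FB} (c : Splitting X) : UwbOrd :=
  ⟨c.part true, c.part false⟩

theorem fst_sublist {α : Type} (l : List (α × α)) : (l.map Prod.fst).Sublist (points l) := by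
  induction l with
  | nil => simp [points]
  | cons p l ih => simpa [points] using ih.trans (List.sublist_cons_self _ _)

theorem snd_sublist {α : Type} (l : List (α × α)) : (l.map Prod.snd).Sublist (points l) := by
  induction l with
  | nil => simp [points]
  | cons p l ih =>
    simp only [points, List.flatMap_cons, List.map_cons]
    exact (ih.cons_cons _).trans (List.sublist_cons_self _ _)

theorem mem_points {α : Type} {l : List (α × α)} {a : α} :
    a ∈ points l ↔ ∃ p ∈ l, a = p.1 ∨ a = p.2 := by
  simp [points]

/-- All pairs of `f` go from the first to the second part of the decomposition. -/
abbrev UbHom.IsWalled {A B : FB} (f : UbHom A B) (c : Splitting B) : Prop :=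
  ∀ p ∈ f.pairs, c p.1 = true ∧ c p.2 = false

/-- The morphism of the walled category given by a decomposition of the target all of whose pairs
are walled. -/
def UbHom.wall {A B : FB} (f : UbHom A B) (c : Splitting B) (h : f.IsWalled c) :
    UwbHom (c.pull f.map).parts c.parts where
  map₁ a := ⟨f.map a.1, a.2⟩
  map₂ a := ⟨f.map a.1, a.2⟩
  pairs := f.pairs.pmap (fun p hp => (⟨p.1, hp.1⟩, ⟨p.2, hp.2⟩)) h
  inj₁ a b hab := Subtype.ext (f.inj (congrArg Subtype.val hab))
  inj₂ a b hab := Subtype.ext (f.inj (congrArg Subtype.val hab))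
  nodup₁ := by
    refine List.Nodup.of_map Subtype.val ?_
    rw [List.map_pmap, List.map_pmap, List.pmap_eq_map]
    exact f.nodup.sublist (fst_sublist _)
  nodup₂ := by
    refine List.Nodup.of_map Subtype.val ?_
    rw [List.map_pmap, List.map_pmap, List.pmap_eq_map]
    exact f.nodup.sublist (snd_sublist _)
  compl₁ := by
    rintro ⟨y, hy⟩
    have h1 : (⟨y, hy⟩ : c.part true) ∈ Set.range
        (fun a : (c.pull f.map).part true => (⟨f.map a.1, a.2⟩ : c.part true)) ↔
        y ∈ Set.range f.map := by
      constructor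
      · rintro ⟨a, ha⟩
        exact ⟨a.1, congrArg Subtype.val ha⟩
      · rintro ⟨a, rfl⟩
        exact ⟨⟨a, hy⟩, rfl⟩
    refine h1.trans ((f.compl y).trans (not_congr ?_))
    rw [mem_points, List.map_pmap, List.mem_pmap]
    constructor
    · rintro ⟨p, hp, rfl | rfl⟩
      · exact ⟨p, hp, rfl⟩
      · exact absurd hy (by simp [(h p hp).2])
    · rintro ⟨p, hp, h⟩
      exact ⟨p, hp, Or.inl (congrArg Subtype.val h).symm⟩
  compl₂ := by
    rintro ⟨y, hy⟩
    have h1 : (⟨y, hy⟩ : c.part false) ∈ Set.range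
        (fun a : (c.pull f.map).part false => (⟨f.map a.1, a.2⟩ : c.part false)) ↔
        y ∈ Set.range f.map := by
      constructor
      · rintro ⟨a, ha⟩
        exact ⟨a.1, congrArg Subtype.val ha⟩
      · rintro ⟨a, rfl⟩
        exact ⟨⟨a, hy⟩, rfl⟩
    refine h1.trans ((f.compl y).trans (not_congr ?_))
    rw [mem_points, List.map_pmap, List.mem_pmap]
    constructor
    · rintro ⟨p, hp, rfl | rfl⟩
      · exact absurd hy (by simp [(h p hp).1])
      · exact ⟨p, hp, rfl⟩
    · rintro ⟨p, hp, h⟩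
      exact ⟨p, hp, Or.inr (congrArg Subtype.val h).symm⟩

theorem UbOrd.isWalled_comp {A B C : UbOrd} (f : A ⟶ B) (g : B ⟶ C) (c : Splitting C.set) :
    UbHom.IsWalled (f ≫ g : A ⟶ C) c ↔ UbHom.IsWalled g c ∧ UbHom.IsWalled f (c.pull g.map) := by
  change (∀ p ∈ f.pairs.map (Prod.map g.map g.map) ++ g.pairs, _) ↔ _
  simp only [List.mem_append, or_imp, forall_and, List.mem_map, forall_exists_index, and_imp,
    forall_apply_eq_imp_iff₂, UbHom.IsWalled, Splitting.pull, Prod.map_fst, Prod.map_snd]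
  tauto

theorem UbOrd.wall_comp {A B C : UbOrd} (f : A ⟶ B) (g : B ⟶ C) (c : Splitting C.set)
    (h : UbHom.IsWalled (f ≫ g : A ⟶ C) c) (hg : UbHom.IsWalled g c)
    (hf : UbHom.IsWalled f (c.pull g.map)) :
    UbHom.wall (f ≫ g : A ⟶ C) c h =
      ((UbHom.wall f (c.pull g.map) hf : UwbHom _ _) ≫ (UbHom.wall g c hg : UwbHom _ _) :
        (Splitting.parts _ : UwbOrd) ⟶ (c.parts : UwbOrd)) := by
  refine UwbHom.ext rfl rfl ?_
  change List.pmap _ (f.pairs.map (Prod.map g.map g.map) ++ g.pairs) _ =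
    (List.pmap _ f.pairs _).map _ ++ List.pmap _ g.pairs _
  rw [List.pmap_append, List.pmap_map, List.map_pmap]
  rfl

section Upsilon

variable {k : Type u} [Field k]

/-- The `k`-vector space `⨁_{X = X₁ ⊔ X₂} F(X₁, X₂)`. -/
abbrev WallSum (F : UwbOrdᵒᵖ ⥤ ModuleCat.{u} k) (X : FB) : Type u :=
  ⨁ c : Splitting X, F.obj (op c.parts)

open Classical in
/-- The action of a morphism of the directed category on `⨁_{X = X₁ ⊔ X₂} F(X₁, X₂)`. -/
def WallSum.map (F : UwbOrdᵒᵖ ⥤ ModuleCat.{u} k) {A B : UbOrd} (f : A ⟶ B) :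
    WallSum F B.set →ₗ[k] WallSum F A.set :=
  DirectSum.toModule k _ _ fun c =>
    if h : UbHom.IsWalled f c then
      DirectSum.lof k (Splitting A.set) (fun c => F.obj (op c.parts)) (c.pull f.map) ∘ₗ
        (F.map (Quiver.Hom.op (X := (c.pull f.map).parts) (Y := c.parts)
          (UbHom.wall f c h))).hom
    else 0

theorem WallSum.map_lof (F : UwbOrdᵒᵖ ⥤ ModuleCat.{u} k) {A B : UbOrd} (f : A ⟶ B)
    (c : Splitting B.set) (h : UbHom.IsWalled f c) (x : F.obj (op c.parts)) :
    WallSum.map F f (DirectSum.lof k (Splitting B.set) (fun c => F.obj (op c.parts)) c x) =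
      DirectSum.lof k (Splitting A.set) (fun c => F.obj (op c.parts)) (c.pull f.map)
        ((F.map (Quiver.Hom.op (X := (c.pull f.map).parts) (Y := c.parts)
          (UbHom.wall f c h))).hom x) := by
  rw [WallSum.map, DirectSum.toModule_lof, dif_pos h]
  rfl

theorem WallSum.map_lof_of_not (F : UwbOrdᵒᵖ ⥤ ModuleCat.{u} k) {A B : UbOrd} (f : A ⟶ B)
    (c : Splitting B.set) (h : ¬ UbHom.IsWalled f c) (x : F.obj (op c.parts)) :
    WallSum.map F f (DirectSum.lof k (Splitting B.set) (fun c => F.obj (op c.parts)) c x) = 0 := by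
  rw [WallSum.map, DirectSum.toModule_lof, dif_neg h]
  rfl

/-- The functor `X ↦ ⨁_{X = X₁ ⊔ X₂} F(X₁, X₂)` on the ordered directed category. -/
def WallSum.functor (F : UwbOrdᵒᵖ ⥤ ModuleCat.{u} k) : UbOrdᵒᵖ ⥤ ModuleCat.{u} k where
  obj X := ModuleCat.of k (WallSum F X.unop.set)
  map f := ModuleCat.ofHom (WallSum.map F f.unop)
  map_id A := by
    ext : 1
    apply DirectSum.linearMap_ext
    intro c
    refine LinearMap.ext fun x => ?_
    have h : UbHom.IsWalled (𝟙 A.unop : A.unop ⟶ A.unop) c := fun p hp => absurd hp (by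
      change p ∉ ([] : List _); simp)
    have := WallSum.map_lof F (𝟙 A.unop) c h x
    refine this.trans ?_
    exact congrArg _ (congrArg (fun φ => φ.hom x) (F.map_id (op c.parts)))
  map_comp {C B A} g f := by
    ext : 1
    apply DirectSum.linearMap_ext
    intro c
    refine LinearMap.ext fun x => ?_
    change WallSum.map F (f.unop ≫ g.unop) (DirectSum.lof k _ _ c x) =
      WallSum.map F f.unop (WallSum.map F g.unop (DirectSum.lof k _ _ c x))
    by_cases hg : UbHom.IsWalled g.unop c
    · rw [WallSum.map_lof F g.unop c hg]
      by_cases hf : UbHom.IsWalled f.unop (c.pull g.unop.map)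
      · rw [WallSum.map_lof F f.unop _ hf,
          WallSum.map_lof F _ c ((UbOrd.isWalled_comp _ _ c).2 ⟨hg, hf⟩),
          UbOrd.wall_comp _ _ c _ hg hf]
        erw [op_comp, F.map_comp]
        rfl
      · rw [WallSum.map_lof_of_not F f.unop _ hf,
          WallSum.map_lof_of_not F _ c fun h => hf ((UbOrd.isWalled_comp _ _ c).1 h).2]
    · rw [WallSum.map_lof_of_not F g.unop _ hg, map_zero,
        WallSum.map_lof_of_not F _ c fun h => hg ((UbOrd.isWalled_comp _ _ c).1 h).1]

theorem WallSum.map_twist {ε : ℤˣ} {F : (KUwb k ε)ᵒᵖ ⥤ ModuleCat.{u} k} (hF : isLinear k _ F)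
    {A B : UbOrd} (f g : A ⟶ B) (h : DirTwist k ε f g (sgn k ε)) :
    WallSum.map (Twisted.restr F) f = sgn k ε • WallSum.map (Twisted.restr F) g := by
  obtain ⟨l₁, l₂, p, q, h1, h2, h3⟩ := h
  obtain ⟨m, l, i, n, co⟩ := f
  obtain ⟨m', l', i', n', co'⟩ := g
  obtain rfl : m = m' := h1
  obtain rfl : l = _ := h2
  obtain rfl : l' = _ := h3
  apply DirectSum.linearMap_ext
  intro c
  refine LinearMap.ext fun x => ?_
  rw [LinearMap.comp_apply, LinearMap.comp_apply, LinearMap.smul_apply]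
  by_cases hw : UbHom.IsWalled ⟨m, l₁ ++ p :: q :: l₂, i, n, co⟩ c
  · have hw' : UbHom.IsWalled ⟨m, l₁ ++ q :: p :: l₂, i', n', co'⟩ c := by
      intro r hr
      exact hw r (by simp only [List.mem_append, List.mem_cons] at hr ⊢; tauto)
    rw [WallSum.map_lof _ _ c hw, WallSum.map_lof _ _ c hw', ← map_smul]
    refine congrArg _ ?_
    have key : (uwbTwistRel k ε).rel (X := (c.pull m).parts) (Y := c.parts)
        (UbHom.wall _ c hw) (UbHom.wall _ c hw') (sgn k ε) := by
      refine .swap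
        (List.pmap (fun p hp => (⟨p.1, hp.1⟩, ⟨p.2, hp.2⟩)) l₁ (fun r hr => hw r (by simp [hr])))
        (List.pmap (fun p hp => (⟨p.1, hp.1⟩, ⟨p.2, hp.2⟩)) l₂ (fun r hr => hw r (by simp [hr])))
        (⟨p.1, (hw p (by simp)).1⟩, ⟨p.2, (hw p (by simp)).2⟩)
        (⟨q.1, (hw q (by simp)).1⟩, ⟨q.2, (hw q (by simp)).2⟩) rfl rfl ?_ ?_
      · simp only [UbHom.wall, List.pmap_append, List.pmap_cons]
      · simp only [UbHom.wall, List.pmap_append, List.pmap_cons]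
    exact congrArg (fun φ => φ.hom x) (Twisted.restr_rel hF key)
  · have hw' : ¬ UbHom.IsWalled ⟨m, l₁ ++ q :: p :: l₂, i', n', co'⟩ c := by
      intro h
      refine hw fun r hr => h r (by simp only [List.mem_append, List.mem_cons] at hr ⊢; tauto)
    rw [WallSum.map_lof_of_not _ _ c hw, WallSum.map_lof_of_not _ _ c hw', smul_zero]

theorem WallSum.map_rel {ε : ℤˣ} {F : (KUwb k ε)ᵒᵖ ⥤ ModuleCat.{u} k} (hF : isLinear k _ F)
    {A B : UbOrd} (f g : A ⟶ B) (a : k) (h : (dirTwistRel k ε).rel f g a) :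
    (WallSum.functor (Twisted.restr F)).map f.op =
      a • (WallSum.functor (Twisted.restr F)).map g.op := by
  have ha : a = sgn k ε := by cases h; rfl
  subst ha
  ext : 1
  exact WallSum.map_twist hF f g h

theorem WallSum.lmap_map {F G : UwbOrdᵒᵖ ⥤ ModuleCat.{u} k} (θ : F ⟶ G) {A B : UbOrd}
    (f : A ⟶ B) :
    (DirectSum.lmap fun c : Splitting A.set => (θ.app (op c.parts)).hom) ∘ₗ WallSum.map F f =
      WallSum.map G f ∘ₗ DirectSum.lmap fun c : Splitting B.set => (θ.app (op c.parts)).hom := by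
  apply DirectSum.linearMap_ext
  intro c
  refine LinearMap.ext fun x => ?_
  simp only [LinearMap.comp_apply, DirectSum.lmap_lof]
  by_cases h : UbHom.IsWalled f c
  · rw [WallSum.map_lof _ _ c h, WallSum.map_lof _ _ c h, DirectSum.lmap_lof]
    exact congrArg _ (congrArg (fun φ => φ.hom x) (θ.naturality (Quiver.Hom.op
      (X := (c.pull f.map).parts) (Y := c.parts) (UbHom.wall f c h))))
  · rw [WallSum.map_lof_of_not _ _ c h, WallSum.map_lof_of_not _ _ c h, map_zero]

/-- The natural transformation induced by a natural transformation. -/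
def WallSum.functorMap {F G : UwbOrdᵒᵖ ⥤ ModuleCat.{u} k} (θ : F ⟶ G) :
    WallSum.functor F ⟶ WallSum.functor G where
  app X := ModuleCat.ofHom
    (DirectSum.lmap fun c : Splitting X.unop.set => (θ.app (op c.parts)).hom)
  naturality X Y f := by
    ext : 1
    exact WallSum.lmap_map θ f.unop

theorem WallSum.functorMap_id (F : UwbOrdᵒᵖ ⥤ ModuleCat.{u} k) :
    WallSum.functorMap (𝟙 F) = 𝟙 _ := by
  ext X : 3
  exact DirectSum.lmap_id

theorem WallSum.functorMap_comp {F G H : UwbOrdᵒᵖ ⥤ ModuleCat.{u} k} (θ : F ⟶ G) (η : G ⟶ H) :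
    WallSum.functorMap (θ ≫ η) = WallSum.functorMap θ ≫ WallSum.functorMap η := by
  ext X : 3
  exact DirectSum.lmap_comp _ _

variable (k) in
/-- The functor `(dΥ_ε)_*` from modules over `(k dwb)_ε` to modules over `(k db→)_ε`, in the
explicit form `X ↦ ⨁_{X = X₁ ⊔ X₂} F(X₁, X₂)` of the right adjoint to restriction along
`(X₁, X₂) ↦ X₁ ⊔ X₂`: a morphism acts on the summand of a decomposition through the corresponding
walled morphism if all its pairs are walled (that is, go from the first to the second part), and
by zero otherwise. -/
def upsilonPush (ε : ℤˣ) : OpMod k (KUwb k ε) ⥤ OpMod k (KDub k ε) where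
  obj F := ⟨Twisted.liftOp (WallSum.functor (Twisted.restr F.obj)) (WallSum.map_rel F.property),
    Twisted.isLinear_liftOp _ _⟩
  map {F G} θ := ObjectProperty.homMk (Twisted.liftOpMap
    (WallSum.map_rel F.property) (WallSum.map_rel G.property)
    (WallSum.functorMap (Functor.whiskerLeft (Twisted.quot _).op θ.hom)))
  map_id F := by
    ext X : 3
    exact congrArg (fun φ => φ.app (op X.unop.obj)) (WallSum.functorMap_id (Twisted.restr F.obj))
  map_comp θ η := by
    ext X : 3
    exact congrArg (fun φ => φ.app (op X.unop.obj)) (WallSum.functorMap_comp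
      (Functor.whiskerLeft (Twisted.quot (uwbTwistRel k ε)).op θ.hom)
      (Functor.whiskerLeft (Twisted.quot (uwbTwistRel k ε)).op η.hom))

end Upsilon

/-! ### The transfer -/

section Transfer

variable {k : Type u} [Field k]

/-- The sum of the values `d ^ r • φ l'` over all lists `l'` obtained from `l` by reversing the
direction of some of its pairs, where `r` is the number of reversed pairs. -/
def flipSum {α V : Type*} [AddCommGroup V] [Module k V] (d : k) :
    List (α × α) → (List (α × α) → V) → V
  | [], φ => φ []
  | p :: l, φ =>
    flipSum d l (fun l' => φ (p :: l')) + d • flipSum d l (fun l' => φ (p.swap :: l'))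

section

variable {α β : Type} {V W : Type*} [AddCommGroup V] [Module k V] [AddCommGroup W] [Module k W]
  (d : k)

theorem flipSum_append (l m : List (α × α)) (φ : List (α × α) → V) :
    flipSum d (l ++ m) φ = flipSum d l fun l' => flipSum d m fun m' => φ (l' ++ m') := by
  induction l generalizing φ with
  | nil => rfl
  | cons p l ih => simp [flipSum, ih]

theorem flipSum_map (g : α → β) (l : List (α × α)) (φ : List (β × β) → V) :
    flipSum d (l.map (Prod.map g g)) φ = flipSum d l fun l' => φ (l'.map (Prod.map g g)) := by
  induction l generalizing φ with
  | nil => rfl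
  | cons p l ih =>
    simp only [List.map_cons, flipSum, ih]
    rfl

theorem map_flipSum (L : V →ₗ[k] W) (l : List (α × α)) (φ : List (α × α) → V) :
    L (flipSum d l φ) = flipSum d l fun l' => L (φ l') := by
  induction l generalizing φ with
  | nil => rfl
  | cons p l ih => simp [flipSum, ih]

theorem smul_flipSum (c : k) (l : List (α × α)) (φ : List (α × α) → V) :
    c • flipSum d l φ = flipSum d l fun l' => c • φ l' :=
  map_flipSum d (c • LinearMap.id : V →ₗ[k] V) l φ

theorem flipSum_congr (l : List (α × α)) (φ ψ : List (α × α) → V)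
    (h : ∀ l', (points l').Perm (points l) → φ l' = ψ l') : flipSum d l φ = flipSum d l ψ := by
  induction l generalizing φ ψ with
  | nil => exact h _ (List.Perm.refl _)
  | cons p l ih =>
    simp only [flipSum]
    refine congrArg₂ (fun a b => a + d • b) ?_ ?_
    · refine ih _ _ fun l' hl' => h _ ?_
      change (p.1 :: p.2 :: points l').Perm (p.1 :: p.2 :: points l)
      exact (hl'.cons _).cons _
    · refine ih _ _ fun l' hl' => h _ ?_
      change (p.2 :: p.1 :: points l').Perm (p.1 :: p.2 :: points l)
      exact (List.Perm.swap _ _ _).trans ((hl'.cons _).cons _)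

end

open Classical in
/-- The class of the morphism with given underlying map and list of pairs (`0` if there is no such
morphism). -/
def clsOf (ε : ℤˣ) {A B : UbOrd} (m : A.set → B.set) (l : List (B.set × B.set)) :
    Twisted.Hom (dirTwistRel k ε) A B :=
  if h : ∃ f : A ⟶ B, f.map = m ∧ f.pairs = l then Twisted.cls h.choose else 0

theorem clsOf_eq (ε : ℤˣ) {A B : UbOrd} (f : A ⟶ B) :
    clsOf (k := k) ε f.map f.pairs = Twisted.cls f := by
  have h : ∃ g : A ⟶ B, g.map = f.map ∧ g.pairs = f.pairs := ⟨f, rfl, rfl⟩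
  rw [clsOf, dif_pos h]
  congr 1
  exact UbHom.ext h.choose_spec.1 h.choose_spec.2

/-- Morphisms with a rearranged set of pairs. -/
def UbHom.rearrange {A B : FB} (f : UbHom A B) (l : List (B × B))
    (h : (points l).Perm (points f.pairs)) : UbHom A B where
  map := f.map
  pairs := l
  inj := f.inj
  nodup := h.nodup_iff.2 f.nodup
  compl b := (f.compl b).trans (not_congr h.mem_iff.symm)

theorem points_perm {α : Type} {l m : List (α × α)} (h : l.Perm m) :
    (points l).Perm (points m) := h.flatMap_right _

theorem clsOf_swap (ε : ℤˣ) {A B : UbOrd} (m : A.set → B.set) (l₁ l₂ : List (B.set × B.set))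
    (p q : B.set × B.set) :
    clsOf (k := k) ε m (l₁ ++ p :: q :: l₂) = sgn k ε • clsOf ε m (l₁ ++ q :: p :: l₂) := by
  have hp : (l₁ ++ q :: p :: l₂).Perm (l₁ ++ p :: q :: l₂) :=
    (List.Perm.swap _ _ _).append_left _
  by_cases h : ∃ f : A ⟶ B, f.map = m ∧ f.pairs = l₁ ++ p :: q :: l₂
  · obtain ⟨f, rfl, hf⟩ := h
    have e1 := clsOf_eq (k := k) ε f
    have e2 := clsOf_eq (k := k) ε (A := A) (B := B)
      (UbHom.rearrange f (l₁ ++ q :: p :: l₂) (points_perm (hf ▸ hp)))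
    rw [hf] at e1
    rw [e1]
    refine Eq.trans ?_ (congrArg _ e2.symm)
    exact Twisted.cls_rel (T := dirTwistRel k ε) (.swap _ _ _ _ rfl hf rfl)
  · have h' : ¬ ∃ f : A ⟶ B, f.map = m ∧ f.pairs = l₁ ++ q :: p :: l₂ := by
      rintro ⟨f, rfl, hf⟩
      exact h ⟨UbHom.rearrange f (l₁ ++ p :: q :: l₂) (points_perm (hf ▸ hp.symm)), rfl, rfl⟩
    rw [clsOf, clsOf, dif_neg h, dif_neg h', smul_zero]

theorem sgn_mul_self (δ : ℤˣ) : sgn k δ * sgn k δ = 1 := by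
  rcases Int.units_eq_one_or δ with rfl | rfl <;> simp [sgn]

variable (k) in
/-- The transfer on the ordered category: a morphism is sent to the sum, over all ways of
reversing the direction of some of its pairs, of the resulting morphisms, each reversal
contributing the sign `δ`. -/
def transferOrd (δ ε : ℤˣ) : UbOrd ⥤ KDub k ε where
  obj A := ⟨A⟩
  map {A B} f := (flipSum (sgn k δ) f.pairs (clsOf ε f.map) : Twisted.Hom (dirTwistRel k ε) A B)
  map_id A := clsOf_eq (k := k) ε (𝟙 A)
  map_comp {A B C} f g := by
    change flipSum _ (f.pairs.map (Prod.map g.map g.map) ++ g.pairs) _ =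
      Twisted.compL A B C (flipSum _ f.pairs _) (flipSum _ g.pairs _)
    rw [flipSum_append, flipSum_map, ← LinearMap.flip_apply, map_flipSum]
    refine flipSum_congr _ _ _ _ fun l hl => ?_
    rw [LinearMap.flip_apply, map_flipSum]
    refine flipSum_congr _ _ _ _ fun m hm => ?_
    have e1 := clsOf_eq (k := k) ε (A := A) (B := B) (UbHom.rearrange f l hl)
    have e2 := clsOf_eq (k := k) ε (A := B) (B := C) (UbHom.rearrange g m hm)
    have e3 := clsOf_eq (k := k) ε ((UbHom.rearrange f l hl : UbHom A.set B.set) ≫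
      (UbHom.rearrange g m hm : UbHom B.set C.set) : A ⟶ C)
    refine e3.trans ((Twisted.compL_cls _ _).symm.trans ?_)
    rw [← e1, ← e2]
    rfl

theorem flipSum_rel (δ ε : ℤˣ) {A B : UbOrd} (f g : A ⟶ B) (a : k)
    (h : (ubTwistRel k δ ε).rel f g a) :
    (flipSum (sgn k δ) f.pairs (clsOf ε f.map) : Twisted.Hom (dirTwistRel k ε) A B) =
      a • flipSum (sgn k δ) g.pairs (clsOf ε g.map) := by
  obtain (⟨l₁, l₂, p, q, h1, h2, h3⟩ | ⟨l₁, l₂, p, h1, h2, h3⟩) := h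
  · rw [h1, h2, h3, flipSum_append, flipSum_append, smul_flipSum]
    congr 1
    funext l
    simp only [flipSum]
    have key : ∀ p q : B.set × B.set,
        flipSum (sgn k δ) l₂ (fun m => clsOf (k := k) ε g.map (l ++ p :: q :: m)) =
        sgn k ε • flipSum (sgn k δ) l₂ (fun m => clsOf (k := k) ε g.map (l ++ q :: p :: m)) := by
      intro p q
      rw [smul_flipSum]
      congr 1
      funext m
      exact clsOf_swap ε g.map l m p q
    rw [key p q, key p q.swap, key p.swap q, key p.swap q.swap]
    module
  · rw [h1, h2, h3, flipSum_append, flipSum_append, smul_flipSum]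
    congr 1
    funext l
    simp only [flipSum, Prod.swap_swap, smul_add, smul_smul, sgn_mul_self, one_smul]
    rw [add_comm]

theorem transferOrd_rel (δ ε : ℤˣ) {A B : UbOrd} (f g : A ⟶ B) (a : k)
    (h : (ubTwistRel k δ ε).rel f g a) :
    (transferOrd k δ ε).map f = a • (transferOrd k δ ε).map g :=
  flipSum_rel δ ε f g a h

variable (k) in
/-- The transfer functor `Tr_(δ; ε) : (k ub)_(δ; ε) ⥤ (k ub→)_ε`. -/
def transfer (δ ε : ℤˣ) : KUb k δ ε ⥤ KDub k ε :=
  Twisted.lift (transferOrd k δ ε) (transferOrd_rel δ ε)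

variable (k) in
/-- Restriction along (the opposite of) the transfer. -/
def transferPull (δ ε : ℤˣ) : OpMod k (KDub k ε) ⥤ OpMod k (KUb k δ ε) where
  obj F := ⟨(transfer k δ ε).op ⋙ F.obj, by
    refine ⟨fun X Y f g => ?_, fun X Y r f => ?_⟩
    · have : (transfer k δ ε).map (f + g) = (transfer k δ ε).map f + (transfer k δ ε).map g :=
        map_add (Twisted.desc (T := ubTwistRel k δ ε) (X := X.obj) (Y := Y.obj) _
          (transferOrd_rel δ ε)) f g
      change F.obj.map ((transfer k δ ε).map (f + g)).op = _
      rw [this, F.property.1]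
      rfl
    · have : (transfer k δ ε).map (r • f) = r • (transfer k δ ε).map f :=
        map_smul (Twisted.desc (T := ubTwistRel k δ ε) (X := X.obj) (Y := Y.obj) _
          (transferOrd_rel δ ε)) r f
      change F.obj.map ((transfer k δ ε).map (r • f)).op = _
      rw [this, F.property.2]
      rfl⟩
  map θ := ObjectProperty.homMk (Functor.whiskerLeft (transfer k δ ε).op θ.hom)

variable (k) in
/-- The functor `dJ_(δ; ε)` from `(k dwb)_ε`-modules to `(k db)_(δ; ε)`-modules. -/
def dJ (δ ε : ℤˣ) : OpMod k (KUwb k ε) ⥤ OpMod k (KUb k δ ε) :=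
  upsilonPush k ε ⋙ transferPull k δ ε

end Transfer

/-! ### Tensor products over a groupoid -/

section Tens

variable {k : Type u} [Field k] {G : Type*} [Category G]

/-- The submodule of `P(x) ⊗ Q(x)` spanned by the elements `pσ ⊗ q - p ⊗ σq`. -/
def Tens.rel (P : Gᵒᵖ ⥤ ModuleCat.{u} k) (Q : G ⥤ ModuleCat.{u} k) (x : G) :
    Submodule k (P.obj (op x) ⊗[k] Q.obj x) :=
  Submodule.span k {z | ∃ (σ : x ⟶ x) (p : P.obj (op x)) (q : Q.obj x),
    z = (P.map σ.op).hom p ⊗ₜ q - p ⊗ₜ (Q.map σ).hom q}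

/-- The tensor product of `P(x)` and `Q(x)` over the group algebra of the automorphism group of
the object `x` of a groupoid. -/
abbrev Tens (P : Gᵒᵖ ⥤ ModuleCat.{u} k) (Q : G ⥤ ModuleCat.{u} k) (x : G) : Type u :=
  (P.obj (op x) ⊗[k] Q.obj x) ⧸ Tens.rel P Q x

/-- The canonical projection. -/
def Tens.mk (P : Gᵒᵖ ⥤ ModuleCat.{u} k) (Q : G ⥤ ModuleCat.{u} k) (x : G) :
    P.obj (op x) ⊗[k] Q.obj x →ₗ[k] Tens P Q x := (Tens.rel P Q x).mkQ

theorem Tens.mk_act (P : Gᵒᵖ ⥤ ModuleCat.{u} k) (Q : G ⥤ ModuleCat.{u} k) (x : G) (σ : x ⟶ x)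
    (p : P.obj (op x)) (q : Q.obj x) :
    Tens.mk P Q x ((P.map σ.op).hom p ⊗ₜ q) = Tens.mk P Q x (p ⊗ₜ (Q.map σ).hom q) := by
  rw [← sub_eq_zero, ← map_sub]
  exact (Submodule.Quotient.mk_eq_zero _).2 (Submodule.subset_span ⟨σ, p, q, rfl⟩)

/-- Linear maps out of the tensor product. -/
def Tens.desc {P : Gᵒᵖ ⥤ ModuleCat.{u} k} {Q : G ⥤ ModuleCat.{u} k} {x : G} {V : Type*}
    [AddCommGroup V] [Module k V] (f : P.obj (op x) ⊗[k] Q.obj x →ₗ[k] V)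
    (h : ∀ (σ : x ⟶ x) (p : P.obj (op x)) (q : Q.obj x),
      f ((P.map σ.op).hom p ⊗ₜ q) = f (p ⊗ₜ (Q.map σ).hom q)) : Tens P Q x →ₗ[k] V :=
  (Tens.rel P Q x).liftQ f (by
    rw [Tens.rel, Submodule.span_le]
    rintro _ ⟨σ, p, q, rfl⟩
    simp [h σ p q])

theorem Tens.desc_mk {P : Gᵒᵖ ⥤ ModuleCat.{u} k} {Q : G ⥤ ModuleCat.{u} k} {x : G} {V : Type*}
    [AddCommGroup V] [Module k V] (f : P.obj (op x) ⊗[k] Q.obj x →ₗ[k] V)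
    (h : ∀ (σ : x ⟶ x) (p : P.obj (op x)) (q : Q.obj x),
      f ((P.map σ.op).hom p ⊗ₜ q) = f (p ⊗ₜ (Q.map σ).hom q)) (z) :
    Tens.desc f h (Tens.mk P Q x z) = f z :=
  Submodule.liftQ_apply _ _ _

theorem Tens.ext {P : Gᵒᵖ ⥤ ModuleCat.{u} k} {Q : G ⥤ ModuleCat.{u} k} {x : G} {V : Type*}
    [AddCommGroup V] [Module k V] {f g : Tens P Q x →ₗ[k] V}
    (h : ∀ p q, f (Tens.mk P Q x (p ⊗ₜ q)) = g (Tens.mk P Q x (p ⊗ₜ q))) : f = g := by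
  apply Submodule.linearMap_qext
  apply TensorProduct.ext'
  exact h

/-- Functoriality of the tensor product. -/
def Tens.map {P P' : Gᵒᵖ ⥤ ModuleCat.{u} k} {Q Q' : G ⥤ ModuleCat.{u} k} (a : P ⟶ P')
    (b : Q ⟶ Q') (x : G) : Tens P Q x →ₗ[k] Tens P' Q' x :=
  Tens.desc (Tens.mk P' Q' x ∘ₗ TensorProduct.map (a.app (op x)).hom (b.app x).hom) (by
    intro σ p q
    have h1 := congrArg (fun φ => φ.hom p) (a.naturality σ.op)
    have h2 := congrArg (fun φ => φ.hom q) (b.naturality σ)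
    simp only [ModuleCat.hom_comp, LinearMap.comp_apply] at h1 h2
    simp only [LinearMap.comp_apply, TensorProduct.map_tmul]
    rw [h1, h2, Tens.mk_act])

theorem Tens.map_mk {P P' : Gᵒᵖ ⥤ ModuleCat.{u} k} {Q Q' : G ⥤ ModuleCat.{u} k} (a : P ⟶ P')
    (b : Q ⟶ Q') (x : G) (p : P.obj (op x)) (q : Q.obj x) :
    Tens.map a b x (Tens.mk P Q x (p ⊗ₜ q)) =
      Tens.mk P' Q' x ((a.app (op x)).hom p ⊗ₜ (b.app x).hom q) :=
  Tens.desc_mk _ _ _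

theorem Tens.map_id (P : Gᵒᵖ ⥤ ModuleCat.{u} k) (Q : G ⥤ ModuleCat.{u} k) (x : G) :
    Tens.map (𝟙 P) (𝟙 Q) x = LinearMap.id :=
  Tens.ext fun _ _ => Tens.map_mk _ _ _ _ _

theorem Tens.map_comp {P P' P'' : Gᵒᵖ ⥤ ModuleCat.{u} k} {Q Q' Q'' : G ⥤ ModuleCat.{u} k}
    (a : P ⟶ P') (a' : P' ⟶ P'') (b : Q ⟶ Q') (b' : Q' ⟶ Q'') (x : G) :
    Tens.map (a ≫ a') (b ≫ b') x = Tens.map a' b' x ∘ₗ Tens.map a b x :=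
  Tens.ext fun p q => by
    rw [LinearMap.comp_apply, Tens.map_mk, Tens.map_mk, Tens.map_mk]
    rfl

theorem Tens.map_add_right {P P' : Gᵒᵖ ⥤ ModuleCat.{u} k} {Q Q' : G ⥤ ModuleCat.{u} k}
    (a : P ⟶ P') (b b' : Q ⟶ Q') (x : G) :
    Tens.map a (b + b') x = Tens.map a b x + Tens.map a b' x :=
  Tens.ext fun p q => by
    rw [LinearMap.add_apply, Tens.map_mk, Tens.map_mk, Tens.map_mk, ← map_add,
      ← TensorProduct.tmul_add]
    rfl

theorem Tens.lmap_id {I : Type} (x : I → G) (P : Gᵒᵖ ⥤ ModuleCat.{u} k)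
    (Q : G ⥤ ModuleCat.{u} k) :
    DirectSum.lmap (fun i => Tens.map (𝟙 P) (𝟙 Q) (x i)) = LinearMap.id := by
  rw [funext fun i => Tens.map_id P Q (x i)]
  exact DirectSum.lmap_id

theorem Tens.lmap_comp {I : Type} (x : I → G) {P P' P'' : Gᵒᵖ ⥤ ModuleCat.{u} k}
    {Q Q' Q'' : G ⥤ ModuleCat.{u} k} (a : P ⟶ P') (a' : P' ⟶ P'') (b : Q ⟶ Q') (b' : Q' ⟶ Q'') :
    DirectSum.lmap (fun i => Tens.map (a ≫ a') (b ≫ b') (x i)) =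
      DirectSum.lmap (fun i => Tens.map a' b' (x i)) ∘ₗ
        DirectSum.lmap (fun i => Tens.map a b (x i)) := by
  rw [funext fun i => Tens.map_comp a a' b b' (x i)]
  exact DirectSum.lmap_comp _ _

end Tens

/-! ### Duality -/

section Dual

variable (k : Type u) [Field k]

/-- The duality functor on vector spaces. -/
@[simps] def dualFunctor : (ModuleCat.{u} k)ᵒᵖ ⥤ ModuleCat.{u} k where
  obj V := ModuleCat.of k (Module.Dual k V.unop)
  map f := ModuleCat.ofHom f.unop.hom.dualMap

variable {k}

/-- The dual `B^♯` of a bimodule: the values are the dual vector spaces and the variances are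
exchanged. -/
@[simps] def sharp {D E : Type*} [Category D] [Category E] (B : Dᵒᵖ ⥤ E ⥤ ModuleCat.{u} k) :
    D ⥤ Eᵒᵖ ⥤ ModuleCat.{u} k where
  obj d := (B.obj (op d)).op ⋙ dualFunctor k
  map f := Functor.whiskerRight (NatTrans.op (B.map f.op)) (dualFunctor k)

variable (k)

/-- The bimodule `A^♯` dual to the morphism spaces `A(X, Y)` of a linear category: a covariant
functor of `X` whose values are right `A`-modules. -/
def homSharp (A : Type w) [Category.{u} A] [Preadditive A] [Linear k A] : A ⥤ OpMod k A :=
  ObjectProperty.lift _ (sharp (linearCoyoneda k A)) fun X => by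
    refine ⟨fun Y Z f g => ?_, fun Y Z r f => ?_⟩
    · refine ModuleCat.hom_ext (LinearMap.ext fun (φ : Module.Dual k (X ⟶ Z)) =>
        LinearMap.ext fun (a : X ⟶ Y) => ?_)
      change φ (a ≫ (f + g)) = φ (a ≫ f) + φ (a ≫ g)
      rw [Preadditive.comp_add, map_add]
    · refine ModuleCat.hom_ext (LinearMap.ext fun (φ : Module.Dual k (X ⟶ Z)) =>
        LinearMap.ext fun (a : X ⟶ Y) => ?_)
      change φ (a ≫ (r • f)) = r • φ (a ≫ f)
      rw [Linear.comp_smul, map_smul]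

end Dual

/-! ### Koszul complexes -/

/-- The functor from a groupoid to its opposite given by the inverse. -/
abbrev invFunctor (G : Type*) [Groupoid G] : G ⥤ Gᵒᵖ where
  obj x := op x
  map σ := (Groupoid.inv σ).op
  map_id x := by simp
  map_comp σ τ := by simp

section InnerMul

variable {k : Type u} [Field k] {G : Type*} [Groupoid G] {C : Type*} [Category C] (ι : G ⥤ C)

/-- The right action of a groupoid on a contravariant functor. -/
abbrev resRight (P : Cᵒᵖ ⥤ ModuleCat.{u} k) : Gᵒᵖ ⥤ ModuleCat.{u} k := ι.op ⋙ P

/-- The left action of a groupoid on a contravariant functor: `σ` acts by `σ⁻¹`. -/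
abbrev resLeft (Q : Cᵒᵖ ⥤ ModuleCat.{u} k) : G ⥤ ModuleCat.{u} k :=
  invFunctor G ⋙ ι.op ⋙ Q

/-- The inner multiplication `p ⊗ q ↦ p φ ⊗ φ^op q` by a morphism `φ`. -/
def innerMul (P Q : Cᵒᵖ ⥤ ModuleCat.{u} k) {x : G} {Y : C} (φ : ι.obj x ⟶ Y) :
    P.obj (op Y) ⊗[k] Q.obj (op Y) →ₗ[k] Tens (resRight ι P) (resLeft ι Q) x :=
  Tens.mk (resRight ι P) (resLeft ι Q) x ∘ₗ
    TensorProduct.map (P.map φ.op).hom (Q.map φ.op).hom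

variable {ι} {P Q P' Q' : Cᵒᵖ ⥤ ModuleCat.{u} k}

theorem innerMul_tmul {x : G} {Y : C} (φ : ι.obj x ⟶ Y) (p : P.obj (op Y)) (q : Q.obj (op Y)) :
    innerMul ι P Q φ (p ⊗ₜ q) = Tens.mk (resRight ι P) (resLeft ι Q) x
      ((P.map φ.op).hom p ⊗ₜ (Q.map φ.op).hom q) := rfl

theorem innerMul_precomp {x : G} {Y : C} (φ : ι.obj x ⟶ Y) (σ : x ⟶ x) :
    innerMul ι P Q (ι.map σ ≫ φ) = innerMul ι P Q φ := by
  refine TensorProduct.ext' fun p q => ?_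
  rw [innerMul_tmul, innerMul_tmul, op_comp, P.map_comp, Q.map_comp]
  refine (Tens.mk_act (resRight ι P) (resLeft ι Q) x σ _ _).trans ?_
  refine congrArg _ (congrArg _ ?_)
  change (Q.map (ι.map (Groupoid.inv σ)).op).hom ((Q.map (ι.map σ).op).hom _) = _
  rw [← LinearMap.comp_apply, ← ModuleCat.hom_comp, ← Q.map_comp, ← op_comp, ← ι.map_comp,
    Groupoid.inv_comp, ι.map_id, op_id, Q.map_id]
  rfl

theorem innerMul_comp {x : G} {Y Z : C} (φ : ι.obj x ⟶ Y) (ψ : Y ⟶ Z) (p : P.obj (op Z))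
    (q : Q.obj (op Z)) :
    innerMul ι P Q φ ((P.map ψ.op).hom p ⊗ₜ (Q.map ψ.op).hom q) =
      innerMul ι P Q (φ ≫ ψ) (p ⊗ₜ q) := by
  rw [innerMul_tmul, innerMul_tmul, op_comp, P.map_comp, Q.map_comp]
  rfl

theorem innerMul_rel {x : G} {Y : C} {f g : ι.obj x ⟶ Y} {a b : k}
    (hP : P.map f.op = a • P.map g.op) (hQ : Q.map f.op = b • Q.map g.op) :
    innerMul ι P Q f = (a * b) • innerMul ι P Q g := by
  refine TensorProduct.ext' fun p q => ?_
  rw [LinearMap.smul_apply, innerMul_tmul, innerMul_tmul, hP, hQ, ← map_smul, mul_smul,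
    ← TensorProduct.tmul_smul, TensorProduct.smul_tmul']
  rfl

variable (ι) in
/-- The morphism of tensor products induced by natural transformations. -/
def resMap (a : P ⟶ P') (b : Q ⟶ Q') (x : G) :
    Tens (resRight ι P) (resLeft ι Q) x →ₗ[k] Tens (resRight ι P') (resLeft ι Q') x :=
  Tens.map (Functor.whiskerLeft ι.op a) (Functor.whiskerLeft (invFunctor G ⋙ ι.op) b) x

theorem resMap_mk (a : P ⟶ P') (b : Q ⟶ Q') (x : G) (p : P.obj (op (ι.obj x)))
    (q : Q.obj (op (ι.obj x))) :
    resMap ι a b x (Tens.mk (resRight ι P) (resLeft ι Q) x (p ⊗ₜ q)) =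
      Tens.mk (resRight ι P') (resLeft ι Q') x
        ((a.app (op (ι.obj x))).hom p ⊗ₜ (b.app (op (ι.obj x))).hom q) :=
  Tens.map_mk _ _ _ _ _

variable {E : Type} [Fintype E]

/-- The map of tensor products induced by the inner multiplication by the sum of a family of
morphisms. -/
def koszulMap {x y : G} (φ : E → (ι.obj x ⟶ ι.obj y))
    (h : ∀ σ : y ⟶ y, ∑ e, innerMul ι P Q (φ e ≫ ι.map σ) = ∑ e, innerMul ι P Q (φ e)) :
    Tens (resRight ι P) (resLeft ι Q) y →ₗ[k] Tens (resRight ι P) (resLeft ι Q) x :=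
  Tens.desc (∑ e, innerMul ι P Q (φ e)) (by
    intro σ p q
    have hq : q = (Q.map (ι.map σ).op).hom ((Q.map (ι.map (Groupoid.inv σ)).op).hom q) := by
      rw [← LinearMap.comp_apply, ← ModuleCat.hom_comp, ← Q.map_comp, ← op_comp, ← ι.map_comp,
        Groupoid.comp_inv, ι.map_id, op_id, Q.map_id]
      rfl
    conv_lhs => rw [hq]
    have h2 := LinearMap.congr_fun (h σ) (p ⊗ₜ (Q.map (ι.map (Groupoid.inv σ)).op).hom q)
    refine Eq.trans ?_ h2
    rw [LinearMap.sum_apply, LinearMap.sum_apply]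
    exact Finset.sum_congr rfl fun e _ => innerMul_comp _ _ _ _)

theorem koszulMap_mk {x y : G} (φ : E → (ι.obj x ⟶ ι.obj y))
    (h : ∀ σ : y ⟶ y, ∑ e, innerMul ι P Q (φ e ≫ ι.map σ) = ∑ e, innerMul ι P Q (φ e))
    (p : P.obj (op (ι.obj y))) (q : Q.obj (op (ι.obj y))) :
    koszulMap φ h (Tens.mk (resRight ι P) (resLeft ι Q) y (p ⊗ₜ q)) =
      ∑ e, innerMul ι P Q (φ e) (p ⊗ₜ q) := by
  refine (Tens.desc_mk _ _ _).trans ?_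
  rw [LinearMap.sum_apply]

theorem koszulMap_naturality {x y : G} (φ : E → (ι.obj x ⟶ ι.obj y))
    (h : ∀ σ : y ⟶ y, ∑ e, innerMul ι P Q (φ e ≫ ι.map σ) = ∑ e, innerMul ι P Q (φ e))
    (h' : ∀ σ : y ⟶ y, ∑ e, innerMul ι P' Q' (φ e ≫ ι.map σ) = ∑ e, innerMul ι P' Q' (φ e))
    (a : P ⟶ P') (b : Q ⟶ Q') :
    resMap ι a b x ∘ₗ koszulMap φ h = koszulMap φ h' ∘ₗ resMap ι a b y := by
  refine Tens.ext fun p q => ?_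
  rw [LinearMap.comp_apply, LinearMap.comp_apply, koszulMap_mk, resMap_mk, map_sum, koszulMap_mk]
  refine Finset.sum_congr rfl fun e _ => ?_
  rw [innerMul_tmul, innerMul_tmul, resMap_mk]
  have h1 := congrArg (fun φ => φ.hom p) (a.naturality (φ e).op)
  have h2 := congrArg (fun φ => φ.hom q) (b.naturality (φ e).op)
  exact congrArg _ (congrArg₂ _ h1 h2)

theorem koszulMap_comp_koszulMap {E' : Type} [Fintype E'] {x y z : G}
    (φ : E → (ι.obj x ⟶ ι.obj y)) (ψ : E' → (ι.obj y ⟶ ι.obj z))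
    (h : ∀ σ : y ⟶ y, ∑ e, innerMul ι P Q (φ e ≫ ι.map σ) = ∑ e, innerMul ι P Q (φ e))
    (h' : ∀ σ : z ⟶ z, ∑ e, innerMul ι P Q (ψ e ≫ ι.map σ) = ∑ e, innerMul ι P Q (ψ e))
    (h0 : ∑ e : E' × E, innerMul ι P Q (φ e.2 ≫ ψ e.1) = 0) :
    koszulMap φ h ∘ₗ koszulMap ψ h' = 0 := by
  refine Tens.ext fun p q => ?_
  rw [LinearMap.comp_apply, koszulMap_mk, map_sum, LinearMap.zero_apply]
  refine Eq.trans ?_ (LinearMap.congr_fun h0 (p ⊗ₜ q))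
  rw [LinearMap.sum_apply, Fintype.sum_prod_type]
  refine Finset.sum_congr rfl fun e _ => ?_
  rw [innerMul_tmul, koszulMap_mk]
  exact Finset.sum_congr rfl fun e _ => innerMul_comp _ _ _ _

end InnerMul

theorem two_sum_lt {V : Type*} [AddCommGroup V] {n : ℕ} (g : Fin n → Fin n → V)
    (hs : ∀ i j, g i j = g j i) (h0 : ∀ i, g i i = 0) :
    (∑ e : {e : Fin n × Fin n // e.1 < e.2}, g e.1.1 e.1.2) +
      (∑ e : {e : Fin n × Fin n // e.1 < e.2}, g e.1.1 e.1.2) = ∑ e : Fin n × Fin n, g e.1 e.2 := by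
  have h1 : (∑ e : {e : Fin n × Fin n // e.1 < e.2}, g e.1.1 e.1.2) =
      ∑ e : Fin n × Fin n, if e.1 < e.2 then g e.1 e.2 else 0 := by
    rw [← Finset.sum_filter]
    exact (Finset.sum_subtype _ (by simp) fun e : Fin n × Fin n => g e.1 e.2).symm
  have h2 : (∑ e : {e : Fin n × Fin n // e.1 < e.2}, g e.1.1 e.1.2) =
      ∑ e : Fin n × Fin n, if e.2 < e.1 then g e.1 e.2 else 0 := by
    rw [h1]
    refine Fintype.sum_equiv (Equiv.prodComm _ _) _ _ fun e => ?_
    simp only [Equiv.prodComm_apply, Prod.fst_swap, Prod.snd_swap, hs e.1 e.2]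
    congr
  conv_lhs => rw [h2]
  rw [← h2]
  nth_rw 1 [h1]
  rw [h2, ← Finset.sum_add_distrib]
  refine Finset.sum_congr rfl fun e _ => ?_
  obtain ⟨i, j⟩ := e
  rcases lt_trichotomy i j with h | h | h
  · simp [h, h.not_gt]
  · subst h; simp [h0]
  · simp [h, h.not_gt]

section Unwalled

variable {k : Type u} [Field k]

/-- The order preserving injection `𝐧 → 𝐧 + 𝟐` whose image is the complement of a given pair
`i < j`, together with the pair `(i, j)`. -/
def alpha (n : ℕ) (e : {e : Fin (n + 2) × Fin (n + 2) // e.1 < e.2}) :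
    FB.toUbOrd.obj (FB.fin n) ⟶ FB.toUbOrd.obj (FB.fin (n + 2)) :=
  show UbHom (FB.fin n) (FB.fin (n + 2)) from
  { map := ({e.1.1, e.1.2}ᶜ : Finset (Fin (n + 2))).orderEmbOfFin (by
      rw [Finset.card_compl, Finset.card_pair e.2.ne, Fintype.card_fin, Nat.add_sub_cancel])
    pairs := [e.1]
    inj := RelEmbedding.injective _
    nodup := by simpa [points] using e.2.ne
    compl := fun b => by
      rw [Finset.range_orderEmbOfFin]
      simp [points, and_comm] }

theorem alpha_pairs (n : ℕ) (e) : UbHom.pairs (alpha n e) = [e.1] := rfl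

theorem alpha_strictMono (n : ℕ) (e : {e : Fin (n + 2) × Fin (n + 2) // e.1 < e.2}) :
    StrictMono (α := Fin n) (β := Fin (n + 2)) (UbHom.map (alpha n e)) :=
  OrderEmbedding.strictMono _

theorem exists_equiv_comp {α β : Type} {f g : α → β} (hf : Function.Injective f)
    (hg : Function.Injective g) (h : Set.range f = Set.range g) : ∃ σ : α ≃ α, f ∘ σ = g := by
  refine ⟨(Equiv.ofInjective g hg).trans ((Equiv.setCongr h.symm).trans
    (Equiv.ofInjective f hf).symm), ?_⟩
  funext a
  simp only [Function.comp_apply, Equiv.trans_apply]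
  exact Equiv.apply_ofInjective_symm hf _

end Unwalled

section TermOf

variable {k : Type u} [Field k] {G : Type*} [Groupoid G] {C : Type*} [Category C] {ι : G ⥤ C}
  {P Q : Cᵒᵖ ⥤ ModuleCat.{u} k} {x : G} {Y : C} {L : Type*}

variable (P Q) in
open Classical in
/-- The inner multiplication by a morphism with a given label (`0` if there is none). -/
def termOf (pr : (ι.obj x ⟶ Y) → L) (l : L) :
    P.obj (op Y) ⊗[k] Q.obj (op Y) →ₗ[k] Tens (resRight ι P) (resLeft ι Q) x :=
  if h : ∃ φ, pr φ = l then innerMul ι P Q h.choose else 0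

theorem termOf_eq (pr : (ι.obj x ⟶ Y) → L)
    (H : ∀ φ φ', pr φ = pr φ' → ∃ σ : x ⟶ x, φ' = ι.map σ ≫ φ) (φ : ι.obj x ⟶ Y) :
    innerMul ι P Q φ = termOf P Q pr (pr φ) := by
  have h : ∃ ψ, pr ψ = pr φ := ⟨φ, rfl⟩
  rw [termOf, dif_pos h]
  obtain ⟨σ, hσ⟩ := H _ _ h.choose_spec
  conv_lhs => rw [hσ, innerMul_precomp]

theorem termOf_of_not (pr : (ι.obj x ⟶ Y) → L) (l : L) (h : ¬ ∃ φ, pr φ = l) :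
    termOf P Q pr l = 0 := dif_neg h

theorem termOf_rel (pr : (ι.obj x ⟶ Y) → L)
    (H : ∀ φ φ', pr φ = pr φ' → ∃ σ : x ⟶ x, φ' = ι.map σ ≫ φ) (l l' : L) (c : k)
    (h1 : ∀ φ, pr φ = l → ∃ φ', pr φ' = l' ∧ innerMul ι P Q φ = c • innerMul ι P Q φ')
    (h2 : ∀ φ', pr φ' = l' → ∃ φ, pr φ = l) :
    termOf P Q pr l = c • termOf P Q pr l' := by
  by_cases h : ∃ φ, pr φ = l
  · obtain ⟨φ, rfl⟩ := h
    obtain ⟨φ', rfl, h'⟩ := h1 φ rfl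
    rw [← termOf_eq pr H, ← termOf_eq pr H, h']
  · rw [termOf_of_not _ _ h, termOf_of_not, smul_zero]
    rintro ⟨φ', h'⟩
    exact h (h2 φ' h')

end TermOf

section Unwalled

variable {k : Type u} [Field k]

/-- The list of pairs of a morphism. -/
def prUb (x : FB) (Y : UbOrd) (φ : FB.toUbOrd.obj x ⟶ Y) : List (Y.set × Y.set) :=
  UbHom.pairs φ

theorem prUb_eq (x : FB) (Y : UbOrd) (φ φ' : FB.toUbOrd.obj x ⟶ Y)
    (h : prUb x Y φ = prUb x Y φ') : ∃ σ : x ⟶ x, φ' = FB.toUbOrd.map σ ≫ φ := by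
  obtain ⟨σ, hσ⟩ := exists_equiv_comp (UbHom.inj φ) (UbHom.inj φ') (by
    ext b
    rw [UbHom.compl, UbHom.compl]
    exact not_congr (by rw [show UbHom.pairs φ = UbHom.pairs φ' from h]))
  exact ⟨σ, UbHom.ext hσ.symm h.symm⟩

theorem prUb_exists {x : FB} {Y : UbOrd} (φ : FB.toUbOrd.obj x ⟶ Y) (l : List (Y.set × Y.set))
    (h : (points l).Perm (points (prUb x Y φ))) :
    ∃ φ' : FB.toUbOrd.obj x ⟶ Y, prUb x Y φ' = l ∧ UbHom.map φ' = UbHom.map φ :=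
  ⟨UbHom.rearrange φ l h, rfl, rfl⟩

variable {δ ε : ℤˣ} (P : OpMod k (KUb k δ (-ε))) (Q : OpMod k (KUb k δ ε))

/-- The component `P(𝐧) ⊗_{𝔖_n} Q(𝐧)` of the Koszul complex. -/
abbrev UbTens (n : ℕ) : Type u :=
  Tens (resRight FB.toUbOrd (Twisted.restr P.obj)) (resLeft FB.toUbOrd (Twisted.restr Q.obj))
    (FB.fin n)

/-- The inner multiplications by the morphisms with a given list of pairs. -/
abbrev ubTerm (n : ℕ) (Y : FB) := termOf (ι := FB.toUbOrd) (Twisted.restr P.obj)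
  (Twisted.restr Q.obj) (prUb (FB.fin n) (FB.toUbOrd.obj Y))

theorem sgn_neg_mul (ε : ℤˣ) : sgn k (-ε) * sgn k ε = -1 := by
  rcases Int.units_eq_one_or ε with rfl | rfl <;> simp [sgn]

theorem ubTerm_flip (n : ℕ) (Y : FB) (p : Y × Y) :
    ubTerm P Q n Y [p] = ubTerm P Q n Y [p.swap] := by
  have hp (q : Y × Y) : (points [q.swap]).Perm (points [q]) := List.Perm.swap _ _ _
  rw [← one_smul k (ubTerm P Q n Y [p.swap])]
  refine termOf_rel _ (prUb_eq _ _) _ _ _ (fun φ h => ?_) (fun φ h => ?_)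
  · obtain ⟨φ', h', h''⟩ := prUb_exists φ [p.swap] (h ▸ hp p)
    refine ⟨φ', h', ?_⟩
    rw [← sgn_mul_self δ]
    exact innerMul_rel
      (Twisted.restr_rel P.property (UbTwist.flip [] [] p h''.symm h h'))
      (Twisted.restr_rel Q.property (UbTwist.flip [] [] p h''.symm h h'))
  · obtain ⟨φ', h', h''⟩ := prUb_exists φ [p] (h ▸ hp p.swap)
    exact ⟨φ', h'⟩

theorem ubTerm_swap (n : ℕ) (Y : FB) (p q : Y × Y) :
    ubTerm P Q n Y [p, q] = - ubTerm P Q n Y [q, p] := by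
  have hp (p q : Y × Y) : (points [q, p]).Perm (points [p, q]) :=
    points_perm (List.Perm.swap _ _ _)
  rw [← neg_one_smul k (ubTerm P Q n Y [q, p])]
  refine termOf_rel _ (prUb_eq _ _) _ _ _ (fun φ h => ?_) (fun φ h => ?_)
  · obtain ⟨φ', h', h''⟩ := prUb_exists φ [q, p] (h ▸ hp p q)
    refine ⟨φ', h', ?_⟩
    rw [← sgn_neg_mul ε]
    exact innerMul_rel
      (Twisted.restr_rel P.property (UbTwist.swap [] [] p q h''.symm h h'))
      (Twisted.restr_rel Q.property (UbTwist.swap [] [] p q h''.symm h h'))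
  · obtain ⟨φ', h', h''⟩ := prUb_exists φ [p, q] (h ▸ hp q p)
    exact ⟨φ', h'⟩

theorem ubTerm_diag (n : ℕ) (Y : FB) (i : Y) : ubTerm P Q n Y [(i, i)] = 0 := by
  refine termOf_of_not _ _ ?_
  rintro ⟨φ, h⟩
  have nd : ([i, i] : List Y).Nodup := by
    have := UbHom.nodup φ
    rw [show UbHom.pairs φ = [(i, i)] from h] at this
    exact this
  simp at nd

theorem innerMul_alpha_comp (n : ℕ) (Y : FB) (e : {e : Fin (n + 2) × Fin (n + 2) // e.1 < e.2})
    (σ : FB.fin (n + 2) ⟶ Y) :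
    innerMul FB.toUbOrd (Twisted.restr P.obj) (Twisted.restr Q.obj)
      (alpha n e ≫ FB.toUbOrd.map σ) =
      ubTerm P Q n Y [(FB.equiv σ e.1.1, FB.equiv σ e.1.2)] :=
  termOf_eq (ι := FB.toUbOrd) (prUb (FB.fin n) (FB.toUbOrd.obj Y)) (prUb_eq _ _)
    (alpha n e ≫ FB.toUbOrd.map σ)

variable [CharZero k]

theorem eq_of_add_self {V : Type*} [AddCommGroup V] [Module k V] {a b : V} (h : a + a = b + b) :
    a = b := by
  have h2 : (2 : k) ≠ 0 := two_ne_zero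
  rw [← two_smul k, ← two_smul k] at h
  exact smul_right_injective V h2 h

theorem sum_alpha_comp (n : ℕ) (σ : FB.fin (n + 2) ⟶ FB.fin (n + 2)) :
    ∑ e, innerMul FB.toUbOrd (Twisted.restr P.obj) (Twisted.restr Q.obj)
      (alpha n e ≫ FB.toUbOrd.map σ) =
    ∑ e, innerMul FB.toUbOrd (Twisted.restr P.obj) (Twisted.restr Q.obj) (alpha n e) := by
  have key : ∀ τ : FB.fin (n + 2) ⟶ FB.fin (n + 2),
      (∑ e, innerMul FB.toUbOrd (Twisted.restr P.obj) (Twisted.restr Q.obj)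
        (alpha n e ≫ FB.toUbOrd.map τ)) +
      (∑ e, innerMul FB.toUbOrd (Twisted.restr P.obj) (Twisted.restr Q.obj)
        (alpha n e ≫ FB.toUbOrd.map τ)) =
      ∑ e : Fin (n + 2) × Fin (n + 2), ubTerm P Q n (FB.fin (n + 2)) [e] := by
    intro τ
    rw [Finset.sum_congr rfl fun e _ => innerMul_alpha_comp P Q n _ e τ,
      two_sum_lt (fun i j => ubTerm P Q n (FB.fin (n + 2)) [(FB.equiv τ i, FB.equiv τ j)])]
    · exact Fintype.sum_equiv (Equiv.prodCongr (FB.equiv τ) (FB.equiv τ)) _ _ fun _ => rfl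
    · exact fun i j => ubTerm_flip _ _ _ _ _
    · exact fun i => ubTerm_diag _ _ _ _ _
  have h1 := (key σ).trans (key (𝟙 _)).symm
  have h2 := eq_of_add_self (k := k) h1
  refine h2.trans (Finset.sum_congr rfl fun e _ => ?_)
  exact congrArg _ ((congrArg _ (FB.toUbOrd.map_id _)).trans (Category.comp_id _))

/-- The Koszul differential
`p ⊗ q ↦ ∑_{i < j} p [α_(ij)] ⊗ [α_(ij)^op] q`. -/
def ubKoszul (n : ℕ) : UbTens P Q (n + 2) →ₗ[k] UbTens P Q n :=
  koszulMap (alpha n) (sum_alpha_comp P Q n)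

theorem sum_alpha_alpha (n : ℕ) :
    ∑ e : {e : Fin (n + 2 + 2) × Fin (n + 2 + 2) // e.1 < e.2} ×
        {e : Fin (n + 2) × Fin (n + 2) // e.1 < e.2},
      innerMul FB.toUbOrd (Twisted.restr P.obj) (Twisted.restr Q.obj)
        (alpha n e.2 ≫ alpha (n + 2) e.1) = 0 := by
  let E := {e : Fin (n + 2 + 2) × Fin (n + 2 + 2) // e.1 < e.2}
  have h1 : ∑ e : E × {e : Fin (n + 2) × Fin (n + 2) // e.1 < e.2},
      innerMul FB.toUbOrd (Twisted.restr P.obj) (Twisted.restr Q.obj)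
        (alpha n e.2 ≫ alpha (n + 2) e.1) =
      ∑ e : E × E, ubTerm P Q n (FB.fin (n + 2 + 2)) [e.2.1, e.1.1] := by
    refine Fintype.sum_of_injective (fun e => (e.1, ⟨(UbHom.map (alpha (n + 2) e.1) e.2.1.1,
      UbHom.map (alpha (n + 2) e.1) e.2.1.2), alpha_strictMono _ _ e.2.2⟩)) ?_ _ _ ?_ ?_
    · rintro ⟨e, a⟩ ⟨e', a'⟩ h
      rw [Prod.mk.injEq] at h
      obtain ⟨rfl, h⟩ := h
      have h1 := congrArg (fun x => x.1.1) h
      have h2 := congrArg (fun x => x.1.2) h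
      have i1 := UbHom.inj (alpha (n + 2) e) h1
      have i2 := UbHom.inj (alpha (n + 2) e) h2
      rw [Prod.mk.injEq]
      exact ⟨rfl, Subtype.ext (Prod.ext i1 i2)⟩
    · rintro ⟨e, a⟩ h
      refine termOf_of_not _ _ ?_
      rintro ⟨φ, hφ⟩
      refine h ?_
      have nd : ([a.1.1, a.1.2, e.1.1, e.1.2] : List (Fin (n + 2 + 2))).Nodup := by
        have := UbHom.nodup φ
        rw [show UbHom.pairs φ = [a.1, e.1] from hφ] at this
        exact this
      simp only [List.nodup_cons, List.mem_cons, List.not_mem_nil, or_false, not_or] at nd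
      have mem (b : Fin (n + 2 + 2)) (h1 : b ≠ e.1.1) (h2 : b ≠ e.1.2) :
          b ∉ ([e.1.1, e.1.2] : List (Fin (n + 2 + 2))) := by simp [h1, h2]
      obtain ⟨i, hi⟩ := (UbHom.compl (alpha (n + 2) e) a.1.1).2
        (mem _ nd.1.2.1 nd.1.2.2)
      obtain ⟨j, hj⟩ := (UbHom.compl (alpha (n + 2) e) a.1.2).2
        (mem _ nd.2.1.1 nd.2.1.2)
      refine ⟨(e, ⟨(i, j), ?_⟩), ?_⟩
      · have := a.2
        rw [← hi, ← hj] at this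
        exact (alpha_strictMono (n + 2) e).lt_iff_lt.1 this
      · rw [Prod.mk.injEq]
        exact ⟨rfl, Subtype.ext (Prod.ext hi hj)⟩
    · rintro ⟨e, a⟩
      exact termOf_eq (ι := FB.toUbOrd) (prUb (FB.fin n) (FB.toUbOrd.obj (FB.fin (n + 2 + 2))))
        (prUb_eq _ _) (alpha n a ≫ alpha (n + 2) e)
  rw [h1]
  have h2 : ∑ e : E × E, ubTerm P Q n (FB.fin (n + 2 + 2)) [e.2.1, e.1.1] =
      - ∑ e : E × E, ubTerm P Q n (FB.fin (n + 2 + 2)) [e.2.1, e.1.1] := by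
    rw [← Finset.sum_neg_distrib]
    exact Fintype.sum_equiv (Equiv.prodComm E E) _ _ fun e => ubTerm_swap _ _ _ _ _ _
  refine eq_of_add_self (k := k) ?_
  rw [add_zero]
  exact add_eq_zero_iff_eq_neg.2 h2

theorem ubKoszul_comp (n : ℕ) : ubKoszul P Q n ∘ₗ ubKoszul P Q (n + 2) = 0 :=
  koszulMap_comp_koszulMap _ _ _ _ (sum_alpha_alpha P Q n)

variable {P Q} {P' : OpMod k (KUb k δ (-ε))} {Q' : OpMod k (KUb k δ ε)}

/-- The map of components induced by morphisms of modules. -/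
def ubMap (a : P ⟶ P') (b : Q ⟶ Q') (n : ℕ) : UbTens P Q n →ₗ[k] UbTens P' Q' n :=
  resMap FB.toUbOrd (Functor.whiskerLeft (Twisted.quot _).op a.hom)
    (Functor.whiskerLeft (Twisted.quot _).op b.hom) (FB.fin n)

theorem ubMap_ubKoszul (a : P ⟶ P') (b : Q ⟶ Q') (n : ℕ) :
    ubMap a b n ∘ₗ ubKoszul P Q n = ubKoszul P' Q' n ∘ₗ ubMap a b (n + 2) :=
  koszulMap_naturality _ _ _ _ _

end Unwalled

section Walled

variable {k : Type u} [Field k]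

/-- The pair `(𝐦, 𝐧)`. -/
abbrev FB.fin₂ (m n : ℕ) : FB × FB := (FB.fin m, FB.fin n)

/-- The pair of order preserving injections `𝐦 → 𝐦 + 𝟏` and `𝐧 → 𝐧 + 𝟏` that omit `i` and `j`
respectively, together with the pair `(i, j)`. -/
def beta (m n : ℕ) (e : Fin (m + 1) × Fin (n + 1)) :
    FB.toUwbOrd.obj (FB.fin₂ m n) ⟶ FB.toUwbOrd.obj (FB.fin₂ (m + 1) (n + 1)) :=
  show UwbHom ⟨FB.fin m, FB.fin n⟩ ⟨FB.fin (m + 1), FB.fin (n + 1)⟩ from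
  { map₁ := e.1.succAbove
    map₂ := e.2.succAbove
    pairs := [e]
    inj₁ := Fin.succAbove_right_injective
    inj₂ := Fin.succAbove_right_injective
    nodup₁ := by simp
    nodup₂ := by simp
    compl₁ := fun b => by
      rw [Fin.range_succAbove]
      simp
    compl₂ := fun b => by
      rw [Fin.range_succAbove]
      simp }

/-- The list of pairs of a morphism. -/
def prUwb (x : FB × FB) (Y : UwbOrd) (φ : FB.toUwbOrd.obj x ⟶ Y) : List (Y.fst × Y.snd) :=
  UwbHom.pairs φ

theorem prUwb_eq (x : FB × FB) (Y : UwbOrd) (φ φ' : FB.toUwbOrd.obj x ⟶ Y)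
    (h : prUwb x Y φ = prUwb x Y φ') : ∃ σ : x ⟶ x, φ' = FB.toUwbOrd.map σ ≫ φ := by
  have hp : UwbHom.pairs φ = UwbHom.pairs φ' := h
  obtain ⟨σ, hσ⟩ := exists_equiv_comp (UwbHom.inj₁ φ) (UwbHom.inj₁ φ') (by
    ext b
    rw [UwbHom.compl₁, UwbHom.compl₁, hp])
  obtain ⟨τ, hτ⟩ := exists_equiv_comp (UwbHom.inj₂ φ) (UwbHom.inj₂ φ') (by
    ext b
    rw [UwbHom.compl₂, UwbHom.compl₂, hp])
  exact ⟨(σ, τ), UwbHom.ext hσ.symm hτ.symm h.symm⟩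

theorem prUwb_exists {x : FB × FB} {Y : UwbOrd} (φ : FB.toUwbOrd.obj x ⟶ Y)
    (p q : Y.fst × Y.snd) (h : prUwb x Y φ = [p, q]) :
    ∃ φ' : FB.toUwbOrd.obj x ⟶ Y, prUwb x Y φ' = [q, p] ∧ UwbHom.map₁ φ = UwbHom.map₁ φ' ∧
      UwbHom.map₂ φ = UwbHom.map₂ φ' := by
  have hp : [q, p].Perm (UwbHom.pairs φ) := by
    rw [show UwbHom.pairs φ = [p, q] from h]
    exact List.Perm.swap _ _ _
  refine ⟨show UwbHom _ Y from
    { map₁ := UwbHom.map₁ φ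
      map₂ := UwbHom.map₂ φ
      pairs := [q, p]
      inj₁ := UwbHom.inj₁ φ
      inj₂ := UwbHom.inj₂ φ
      nodup₁ := (hp.map _).nodup_iff.2 (UwbHom.nodup₁ φ)
      nodup₂ := (hp.map _).nodup_iff.2 (UwbHom.nodup₂ φ)
      compl₁ := fun y => (UwbHom.compl₁ φ y).trans (not_congr (hp.map _).mem_iff.symm)
      compl₂ := fun y => (UwbHom.compl₂ φ y).trans (not_congr (hp.map _).mem_iff.symm) },
    rfl, rfl, rfl⟩

variable {ε : ℤˣ} (P : OpMod k (KUwb k (-ε))) (Q : OpMod k (KUwb k ε))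

/-- The component `P(𝐦, 𝐧) ⊗_{𝔖_m × 𝔖_n} Q(𝐦, 𝐧)` of the Koszul complex. -/
abbrev UwbTens (m n : ℕ) : Type u :=
  Tens (resRight FB.toUwbOrd (Twisted.restr P.obj)) (resLeft FB.toUwbOrd (Twisted.restr Q.obj))
    (FB.fin₂ m n)

/-- The inner multiplications by the morphisms with a given list of pairs. -/
abbrev uwbTerm (m n : ℕ) (Y : FB × FB) := termOf (ι := FB.toUwbOrd) (Twisted.restr P.obj)
  (Twisted.restr Q.obj) (prUwb (FB.fin₂ m n) (FB.toUwbOrd.obj Y))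

theorem uwbTerm_swap (m n : ℕ) (Y : FB × FB) (p q : Y.1 × Y.2) :
    uwbTerm P Q m n Y [p, q] = - uwbTerm P Q m n Y [q, p] := by
  rw [← neg_one_smul k (uwbTerm P Q m n Y [q, p])]
  refine termOf_rel _ (prUwb_eq _ _) _ _ _ (fun φ h => ?_) (fun φ h => ?_)
  · obtain ⟨φ', h', h1, h2⟩ := prUwb_exists φ p q h
    refine ⟨φ', h', ?_⟩
    rw [← sgn_neg_mul ε]
    exact innerMul_rel
      (Twisted.restr_rel P.property (UwbTwist.swap [] [] p q h1 h2 h h'))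
      (Twisted.restr_rel Q.property (UwbTwist.swap [] [] p q h1 h2 h h'))
  · obtain ⟨φ', h', -⟩ := prUwb_exists φ q p h
    exact ⟨φ', h'⟩

theorem innerMul_beta_comp (m n : ℕ) (Y : FB × FB) (e : Fin (m + 1) × Fin (n + 1))
    (σ : FB.fin₂ (m + 1) (n + 1) ⟶ Y) :
    innerMul FB.toUwbOrd (Twisted.restr P.obj) (Twisted.restr Q.obj)
      (beta m n e ≫ FB.toUwbOrd.map σ) =
      uwbTerm P Q m n Y [(FB.equiv σ.1 e.1, FB.equiv σ.2 e.2)] :=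
  termOf_eq (ι := FB.toUwbOrd) (prUwb (FB.fin₂ m n) (FB.toUwbOrd.obj Y)) (prUwb_eq _ _)
    (beta m n e ≫ FB.toUwbOrd.map σ)

theorem sum_beta_comp (m n : ℕ) (σ : FB.fin₂ (m + 1) (n + 1) ⟶ FB.fin₂ (m + 1) (n + 1)) :
    ∑ e, innerMul FB.toUwbOrd (Twisted.restr P.obj) (Twisted.restr Q.obj)
      (beta m n e ≫ FB.toUwbOrd.map σ) =
    ∑ e, innerMul FB.toUwbOrd (Twisted.restr P.obj) (Twisted.restr Q.obj) (beta m n e) := by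
  refine Fintype.sum_equiv (Equiv.prodCongr (FB.equiv σ.1) (FB.equiv σ.2)) _ _ fun e => ?_
  refine (innerMul_beta_comp P Q m n _ e σ).trans ?_
  exact (termOf_eq (ι := FB.toUwbOrd) (prUwb (FB.fin₂ m n)
    (FB.toUwbOrd.obj (FB.fin₂ (m + 1) (n + 1)))) (prUwb_eq _ _) (beta m n _)).symm

/-- The Koszul differential
`p ⊗ q ↦ ∑_{i, j} p [β_(i, j)] ⊗ [β_(i, j)^op] q`. -/
def uwbKoszul (m n : ℕ) : UwbTens P Q (m + 1) (n + 1) →ₗ[k] UwbTens P Q m n :=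
  koszulMap (beta m n) (sum_beta_comp P Q m n)

theorem sum_beta_beta [CharZero k] (m n : ℕ) :
    ∑ e : (Fin (m + 1 + 1) × Fin (n + 1 + 1)) × (Fin (m + 1) × Fin (n + 1)),
      innerMul FB.toUwbOrd (Twisted.restr P.obj) (Twisted.restr Q.obj)
        (beta m n e.2 ≫ beta (m + 1) (n + 1) e.1) = 0 := by
  let E := Fin (m + 1 + 1) × Fin (n + 1 + 1)
  have h1 : ∑ e : E × (Fin (m + 1) × Fin (n + 1)),
      innerMul FB.toUwbOrd (Twisted.restr P.obj) (Twisted.restr Q.obj)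
        (beta m n e.2 ≫ beta (m + 1) (n + 1) e.1) =
      ∑ e : E × E, uwbTerm P Q m n (FB.fin₂ (m + 1 + 1) (n + 1 + 1)) [e.2, e.1] := by
    refine Fintype.sum_of_injective (fun e => (e.1, (e.1.1.succAbove e.2.1,
      e.1.2.succAbove e.2.2))) ?_ _ _ ?_ ?_
    · rintro ⟨e, a⟩ ⟨e', a'⟩ h
      rw [Prod.mk.injEq] at h
      obtain ⟨rfl, h⟩ := h
      have i1 := Fin.succAbove_right_injective (congrArg (fun x => x.1) h)
      have i2 := Fin.succAbove_right_injective (congrArg (fun x => x.2) h)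
      rw [Prod.mk.injEq]
      exact ⟨rfl, Prod.ext i1 i2⟩
    · rintro ⟨e, a⟩ h
      refine termOf_of_not _ _ ?_
      rintro ⟨φ, hφ⟩
      refine h ?_
      have nd1 : ([a.1, e.1] : List (Fin (m + 1 + 1))).Nodup := by
        have := UwbHom.nodup₁ φ
        rw [show UwbHom.pairs φ = [a, e] from hφ] at this
        exact this
      have nd2 : ([a.2, e.2] : List (Fin (n + 1 + 1))).Nodup := by
        have := UwbHom.nodup₂ φ
        rw [show UwbHom.pairs φ = [a, e] from hφ] at this
        exact this
      simp only [List.nodup_cons, List.mem_cons, List.not_mem_nil, or_false] at nd1 nd2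
      obtain ⟨i, hi⟩ := Fin.exists_succAbove_eq nd1.1
      obtain ⟨j, hj⟩ := Fin.exists_succAbove_eq nd2.1
      refine ⟨(e, (i, j)), ?_⟩
      rw [Prod.mk.injEq]
      exact ⟨rfl, Prod.ext hi hj⟩
    · rintro ⟨e, a⟩
      exact termOf_eq (ι := FB.toUwbOrd) (prUwb (FB.fin₂ m n)
        (FB.toUwbOrd.obj (FB.fin₂ (m + 1 + 1) (n + 1 + 1))))
        (prUwb_eq _ _) (beta m n a ≫ beta (m + 1) (n + 1) e)
  rw [h1]
  have h2 : ∑ e : E × E, uwbTerm P Q m n (FB.fin₂ (m + 1 + 1) (n + 1 + 1)) [e.2, e.1] =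
      - ∑ e : E × E, uwbTerm P Q m n (FB.fin₂ (m + 1 + 1) (n + 1 + 1)) [e.2, e.1] := by
    rw [← Finset.sum_neg_distrib]
    exact Fintype.sum_equiv (Equiv.prodComm E E) _ _ fun e => uwbTerm_swap _ _ _ _ _ _ _
  refine eq_of_add_self (k := k) ?_
  rw [add_zero]
  exact add_eq_zero_iff_eq_neg.2 h2

theorem uwbKoszul_comp [CharZero k] (m n : ℕ) : uwbKoszul P Q m n ∘ₗ uwbKoszul P Q (m + 1) (n + 1) = 0 :=
  koszulMap_comp_koszulMap _ _ _ _ (sum_beta_beta P Q m n)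

variable {P Q} {P' : OpMod k (KUwb k (-ε))} {Q' : OpMod k (KUwb k ε)}

/-- The map of components induced by morphisms of modules. -/
def uwbMap (a : P ⟶ P') (b : Q ⟶ Q') (m n : ℕ) : UwbTens P Q m n →ₗ[k] UwbTens P' Q' m n :=
  resMap FB.toUwbOrd (Functor.whiskerLeft (Twisted.quot _).op a.hom)
    (Functor.whiskerLeft (Twisted.quot _).op b.hom) (FB.fin₂ m n)

theorem uwbMap_uwbKoszul (a : P ⟶ P') (b : Q ⟶ Q') (m n : ℕ) :
    uwbMap a b m n ∘ₗ uwbKoszul P Q m n = uwbKoszul P' Q' m n ∘ₗ uwbMap a b (m + 1) (n + 1) :=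
  koszulMap_naturality _ _ _ _ _

end Walled

/-! ### The second Koszul complexes -/

section Complex

variable {V : Type*} [Category V] [Limits.HasZeroMorphisms V]

/-- The complex with given differentials `X (n + 2) ⟶ X n`. -/
def mkComplex (X : ℕ → V) (d : ∀ n, X (n + 2) ⟶ X n) (h : ∀ n, d (n + 2) ≫ d n = 0) :
    HomologicalComplex V (ComplexShape.down' (2 : ℕ)) where
  X := X
  d i j := if hij : j + 2 = i then eqToHom (congrArg X hij.symm) ≫ d j else 0
  shape i j hij := dif_neg hij
  d_comp_d' i j l hij hjl := by
    obtain rfl : j + 2 = i := hij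
    obtain rfl : l + 2 = j := hjl
    simp [h]

/-- Morphisms between such complexes. -/
def mkComplexMap {X Y : ℕ → V} {d : ∀ n, X (n + 2) ⟶ X n} {h : ∀ n, d (n + 2) ≫ d n = 0}
    {d' : ∀ n, Y (n + 2) ⟶ Y n} {h' : ∀ n, d' (n + 2) ≫ d' n = 0} (f : ∀ n, X n ⟶ Y n)
    (hf : ∀ n, f (n + 2) ≫ d' n = d n ≫ f n) : mkComplex X d h ⟶ mkComplex Y d' h' where
  f := f
  comm' i j hij := by
    obtain rfl : j + 2 = i := hij
    simp [mkComplex, hf]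

end Complex

section InnerMul

variable {k : Type u} [Field k] {G : Type*} [Groupoid G] {C : Type*} [Category C] {ι : G ⥤ C}
  {P P' P'' Q Q' Q'' : Cᵒᵖ ⥤ ModuleCat.{u} k}

theorem resMap_id (x : G) : resMap ι (𝟙 P) (𝟙 Q) x = LinearMap.id :=
  Tens.ext fun p q => resMap_mk (𝟙 P) (𝟙 Q) x p q

theorem resMap_comp (a : P ⟶ P') (a' : P' ⟶ P'') (b : Q ⟶ Q') (b' : Q' ⟶ Q'') (x : G) :
    resMap ι (a ≫ a') (b ≫ b') x = resMap ι a' b' x ∘ₗ resMap ι a b x :=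
  Tens.ext fun p q => by
    rw [LinearMap.comp_apply, resMap_mk, resMap_mk, resMap_mk]
    rfl

end InnerMul

section SecondUb

variable {k : Type u} [Field k] {δ ε : ℤˣ}

theorem ubMap_id (P : OpMod k (KUb k δ (-ε))) (Q : OpMod k (KUb k δ ε)) (n : ℕ) :
    ubMap (𝟙 P) (𝟙 Q) n = LinearMap.id := resMap_id _

theorem ubMap_comp {P P' P'' : OpMod k (KUb k δ (-ε))} {Q Q' Q'' : OpMod k (KUb k δ ε)}
    (a : P ⟶ P') (a' : P' ⟶ P'') (b : Q ⟶ Q') (b' : Q' ⟶ Q'') (n : ℕ) :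
    ubMap (a ≫ a') (b ≫ b') n = ubMap a' b' n ∘ₗ ubMap a b n :=
  resMap_comp (Functor.whiskerLeft (Twisted.quot _).op a.hom)
    (Functor.whiskerLeft (Twisted.quot _).op a'.hom)
    (Functor.whiskerLeft (Twisted.quot _).op b.hom)
    (Functor.whiskerLeft (Twisted.quot _).op b'.hom) _

variable (k δ ε) in
/-- The dual `(k ub)_(δ; -ε)^♯` as a functor from `FB` to the right `(k ub)_(δ; -ε)`-modules. -/
def ubSharp : FB ⥤ OpMod k (KUb k δ (-ε)) :=
  FB.toKUb k δ (-ε) ⋙ homSharp k (KUb k δ (-ε))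

variable (M : OpMod k (KUb k δ ε))

/-- The `k FB`-module `(k ub)_(δ; -ε)^♯(-, 𝐧) ⊗_{𝔖_n} M(𝐧)`. -/
def ubDegree (n : ℕ) : FB ⥤ ModuleCat.{u} k where
  obj U := ModuleCat.of k (UbTens ((ubSharp k δ ε).obj U) M n)
  map σ := ModuleCat.ofHom (ubMap ((ubSharp k δ ε).map σ) (𝟙 M) n)
  map_id U := by
    ext : 1
    rw [CategoryTheory.Functor.map_id]
    exact ubMap_id _ _ _
  map_comp σ τ := by
    ext : 1
    rw [CategoryTheory.Functor.map_comp]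
    exact ubMap_comp _ _ (𝟙 M) (𝟙 M) n

variable [CharZero k]

/-- The second Koszul complex `(k ub)_(δ; -ε)^♯ ⊗_{k FB} M` of `M`; the degree is the
cardinality of the set on which `M` is evaluated. -/
def ubComplex : HomologicalComplex (FB ⥤ ModuleCat.{u} k) (ComplexShape.down' (2 : ℕ)) :=
  mkComplex (ubDegree M)
    (fun n =>
      { app := fun U => ModuleCat.ofHom (ubKoszul ((ubSharp k δ ε).obj U) M n)
        naturality := fun U V σ => by
          ext : 1
          exact (ubMap_ubKoszul ((ubSharp k δ ε).map σ) (𝟙 M) n).symm })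
    (fun n => by
      ext U : 3
      exact ubKoszul_comp _ _ n)

variable (k δ ε) in
/-- The second Koszul complex as a functor. -/
def secondKoszulUb : OpMod k (KUb k δ ε) ⥤
    HomologicalComplex (FB ⥤ ModuleCat.{u} k) (ComplexShape.down' (2 : ℕ)) where
  obj M := ubComplex M
  map {M N} θ := mkComplexMap
    (fun n =>
      { app := fun U => ModuleCat.ofHom (ubMap (𝟙 ((ubSharp k δ ε).obj U)) θ n)
        naturality := fun U V σ => by
          ext : 1
          refine (ubMap_comp _ _ _ _ n).symm.trans ((ubMap_comp _ _ _ _ n).symm.trans ?_).symm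
          simp only [Category.comp_id, Category.id_comp] })
    (fun n => by
      ext U : 3
      exact (ubMap_ubKoszul (𝟙 ((ubSharp k δ ε).obj U)) θ n).symm)
  map_id M := by
    ext n U : 4
    exact ubMap_id _ _ n
  map_comp θ η := by
    ext n U : 4
    exact ubMap_comp (𝟙 ((ubSharp k δ ε).obj U)) (𝟙 ((ubSharp k δ ε).obj U)) θ η n

end SecondUb

section SecondUwb

variable {k : Type u} [Field k] {ε : ℤˣ}

theorem uwbMap_id (P : OpMod k (KUwb k (-ε))) (Q : OpMod k (KUwb k ε)) (m n : ℕ) :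
    uwbMap (𝟙 P) (𝟙 Q) m n = LinearMap.id := resMap_id _

theorem uwbMap_comp {P P' P'' : OpMod k (KUwb k (-ε))} {Q Q' Q'' : OpMod k (KUwb k ε)}
    (a : P ⟶ P') (a' : P' ⟶ P'') (b : Q ⟶ Q') (b' : Q' ⟶ Q'') (m n : ℕ) :
    uwbMap (a ≫ a') (b ≫ b') m n = uwbMap a' b' m n ∘ₗ uwbMap a b m n :=
  resMap_comp (Functor.whiskerLeft (Twisted.quot _).op a.hom)
    (Functor.whiskerLeft (Twisted.quot _).op a'.hom)
    (Functor.whiskerLeft (Twisted.quot _).op b.hom)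
    (Functor.whiskerLeft (Twisted.quot _).op b'.hom) _

section Sum

variable (P : OpMod k (KUwb k (-ε))) (Q : OpMod k (KUwb k ε))

/-- The sum `⨁_{m + n = N} P(𝐦, 𝐧) ⊗_{𝔖_m × 𝔖_n} Q(𝐦, 𝐧)`. -/
abbrev UwbSum (N : ℕ) : Type u :=
  ⨁ p : {p : ℕ × ℕ // p.1 + p.2 = N}, UwbTens P Q p.1.1 p.1.2

/-- The inclusion of a summand. -/
abbrev uwbIncl {m n N : ℕ} (h : m + n = N) : UwbTens P Q m n →ₗ[k] UwbSum P Q N :=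
  DirectSum.lof k {p : ℕ × ℕ // p.1 + p.2 = N} (fun p => UwbTens P Q p.1.1 p.1.2) ⟨(m, n), h⟩

/-- The components of the Koszul differential. -/
def uwbComponent (N : ℕ) : (m n : ℕ) → m + n = N + 2 → (UwbTens P Q m n →ₗ[k] UwbSum P Q N)
  | m + 1, n + 1, h => uwbIncl P Q (m := m) (n := n) (by omega) ∘ₗ uwbKoszul P Q m n
  | 0, _, _ => 0
  | _ + 1, 0, _ => 0

/-- The Koszul differential, from total degree `N + 2` to total degree `N`. -/
def uwbDiff (N : ℕ) : UwbSum P Q (N + 2) →ₗ[k] UwbSum P Q N :=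
  DirectSum.toModule k _ _ fun p => uwbComponent P Q N p.1.1 p.1.2 p.2

theorem uwbDiff_comp_incl {m n N : ℕ} (h : m + n = N + 2) :
    uwbDiff P Q N ∘ₗ uwbIncl P Q h = uwbComponent P Q N m n h :=
  LinearMap.ext fun _ => DirectSum.toModule_lof _ _ _

theorem uwbSum_ext {N : ℕ} {V : Type*} [AddCommMonoid V] [Module k V]
    {f g : UwbSum P Q N →ₗ[k] V}
    (H : ∀ (m n : ℕ) (h : m + n = N), f ∘ₗ uwbIncl P Q h = g ∘ₗ uwbIncl P Q h) : f = g := by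
  apply DirectSum.linearMap_ext
  rintro ⟨⟨m, n⟩, h⟩
  exact H m n h

theorem uwbDiff_comp [CharZero k] (N : ℕ) : uwbDiff P Q N ∘ₗ uwbDiff P Q (N + 2) = 0 := by
  apply uwbSum_ext
  intro m n h
  rw [LinearMap.comp_assoc, uwbDiff_comp_incl, LinearMap.zero_comp]
  match m, n, h with
  | 0, _, _ => simp [uwbComponent]
  | _ + 1, 0, _ => simp [uwbComponent]
  | m + 1, n + 1, h =>
    rw [uwbComponent, ← LinearMap.comp_assoc, uwbDiff_comp_incl]
    have h' : m + n = N + 2 := by omega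
    match m, n, h' with
    | 0, _, _ => simp [uwbComponent]
    | _ + 1, 0, _ => simp [uwbComponent]
    | m + 1, n + 1, h' =>
      rw [uwbComponent, LinearMap.comp_assoc, uwbKoszul_comp, LinearMap.comp_zero]

variable {P Q} {P' P'' : OpMod k (KUwb k (-ε))} {Q' Q'' : OpMod k (KUwb k ε)}

/-- The map induced by morphisms of modules. -/
def uwbSumMap (a : P ⟶ P') (b : Q ⟶ Q') (N : ℕ) : UwbSum P Q N →ₗ[k] UwbSum P' Q' N :=
  DirectSum.lmap fun p => uwbMap a b p.1.1 p.1.2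

theorem uwbSumMap_comp_incl (a : P ⟶ P') (b : Q ⟶ Q') {m n N : ℕ} (h : m + n = N) :
    uwbSumMap a b N ∘ₗ uwbIncl P Q h = uwbIncl P' Q' h ∘ₗ uwbMap a b m n :=
  LinearMap.ext fun _ => DirectSum.lmap_lof _ _ _

theorem uwbSumMap_uwbDiff (a : P ⟶ P') (b : Q ⟶ Q') (N : ℕ) :
    uwbSumMap a b N ∘ₗ uwbDiff P Q N = uwbDiff P' Q' N ∘ₗ uwbSumMap a b (N + 2) := by
  apply uwbSum_ext
  intro m n h
  rw [LinearMap.comp_assoc, LinearMap.comp_assoc, uwbDiff_comp_incl, uwbSumMap_comp_incl,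
    ← LinearMap.comp_assoc, uwbDiff_comp_incl]
  match m, n, h with
  | 0, _, _ => simp [uwbComponent]
  | _ + 1, 0, _ => simp [uwbComponent]
  | m + 1, n + 1, h =>
    rw [uwbComponent, uwbComponent, ← LinearMap.comp_assoc, uwbSumMap_comp_incl,
      LinearMap.comp_assoc, LinearMap.comp_assoc, uwbMap_uwbKoszul]

theorem uwbSumMap_id (N : ℕ) : uwbSumMap (𝟙 P) (𝟙 Q) N = LinearMap.id := by
  apply uwbSum_ext
  intro m n h
  rw [uwbSumMap_comp_incl, uwbMap_id]
  rfl

theorem uwbSumMap_comp (a : P ⟶ P') (a' : P' ⟶ P'') (b : Q ⟶ Q') (b' : Q' ⟶ Q'') (N : ℕ) :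
    uwbSumMap (a ≫ a') (b ≫ b') N = uwbSumMap a' b' N ∘ₗ uwbSumMap a b N := by
  apply uwbSum_ext
  intro m n h
  rw [LinearMap.comp_assoc, uwbSumMap_comp_incl, uwbSumMap_comp_incl, ← LinearMap.comp_assoc,
    uwbSumMap_comp_incl, uwbMap_comp]
  rfl

end Sum

variable (k ε) in
/-- The dual `(k uwb)_(-ε)^♯` as a functor from `FB × FB` to the right `(k uwb)_(-ε)`-modules. -/
def uwbSharp : FB × FB ⥤ OpMod k (KUwb k (-ε)) :=
  FB.toKUwb k (-ε) ⋙ homSharp k (KUwb k (-ε))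

variable (F : OpMod k (KUwb k ε))

/-- The `k (FB × FB)`-module `⨁_{m + n = N} (k uwb)_(-ε)^♯(-, (𝐦, 𝐧)) ⊗_{𝔖_m × 𝔖_n} F(𝐦, 𝐧)`. -/
def uwbDegree (N : ℕ) : FB × FB ⥤ ModuleCat.{u} k where
  obj U := ModuleCat.of k (UwbSum ((uwbSharp k ε).obj U) F N)
  map σ := ModuleCat.ofHom (uwbSumMap ((uwbSharp k ε).map σ) (𝟙 F) N)
  map_id U := by
    ext : 1
    rw [CategoryTheory.Functor.map_id]
    exact uwbSumMap_id _
  map_comp σ τ := by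
    ext : 1
    rw [CategoryTheory.Functor.map_comp]
    exact uwbSumMap_comp _ _ (𝟙 F) (𝟙 F) N

variable [CharZero k]

/-- The second Koszul complex `(k uwb)_(-ε)^♯ ⊗_{k (FB × FB)} F` of `F`; the degree is the
total cardinality `m + n` of the pair of sets on which `F` is evaluated. -/
def uwbComplex : HomologicalComplex (FB × FB ⥤ ModuleCat.{u} k) (ComplexShape.down' (2 : ℕ)) :=
  mkComplex (uwbDegree F)
    (fun N =>
      { app := fun U => ModuleCat.ofHom (uwbDiff ((uwbSharp k ε).obj U) F N)
        naturality := fun U V σ => by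
          ext : 1
          exact (uwbSumMap_uwbDiff ((uwbSharp k ε).map σ) (𝟙 F) N).symm })
    (fun N => by
      ext U : 3
      exact uwbDiff_comp _ _ N)

variable (k ε) in
/-- The second Koszul complex as a functor. -/
def secondKoszulUwb : OpMod k (KUwb k ε) ⥤
    HomologicalComplex (FB × FB ⥤ ModuleCat.{u} k) (ComplexShape.down' (2 : ℕ)) where
  obj F := uwbComplex F
  map {F F'} θ := mkComplexMap
    (fun N =>
      { app := fun U => ModuleCat.ofHom (uwbSumMap (𝟙 ((uwbSharp k ε).obj U)) θ N)
        naturality := fun U V σ => by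
          ext : 1
          refine (uwbSumMap_comp _ _ _ _ N).symm.trans
            ((uwbSumMap_comp _ _ _ _ N).symm.trans ?_).symm
          simp only [Category.comp_id, Category.id_comp] })
    (fun N => by
      ext U : 3
      exact (uwbSumMap_uwbDiff (𝟙 ((uwbSharp k ε).obj U)) θ N).symm)
  map_id F := by
    ext N U : 4
    exact uwbSumMap_id N
  map_comp θ η := by
    ext N U : 4
    exact uwbSumMap_comp (𝟙 ((uwbSharp k ε).obj U)) (𝟙 ((uwbSharp k ε).obj U)) θ η N

end SecondUwb

/-! ### The functor from `k (FB × FB)`-modules to `k FB`-modules -/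

section Phi

variable {k : Type u} [Field k]

/-- The `k`-vector space `⨁_{X = X₁ ⊔ X₂} H(X₁, X₂)`. -/
abbrev CoprodSum (H : (FB × FB)ᵒᵖ ⥤ ModuleCat.{u} k) (X : FB) : Type u :=
  ⨁ c : Splitting X, H.obj (op (c.part true, c.part false))

/-- The bijections between the parts of a decomposition and those of its inverse image under a
bijection. -/
def Splitting.equiv {X Y : FB} (σ : X ⟶ Y) (c : Splitting Y) :
    ((c.pull (FB.equiv σ)).part true, (c.pull (FB.equiv σ)).part false) ⟶
      (c.part true, c.part false) :=
  (Equiv.subtypeEquiv (FB.equiv σ) fun _ => Iff.rfl,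
    Equiv.subtypeEquiv (FB.equiv σ) fun _ => Iff.rfl)

/-- The action of a bijection. -/
def CoprodSum.map (H : (FB × FB)ᵒᵖ ⥤ ModuleCat.{u} k) {X Y : FB} (σ : X ⟶ Y) :
    CoprodSum H Y →ₗ[k] CoprodSum H X :=
  DirectSum.toModule k _ _ fun c =>
    DirectSum.lof k (Splitting X) (fun c => H.obj (op (c.part true, c.part false)))
      (c.pull (FB.equiv σ)) ∘ₗ (H.map (Splitting.equiv σ c).op).hom

theorem CoprodSum.map_lof (H : (FB × FB)ᵒᵖ ⥤ ModuleCat.{u} k) {X Y : FB} (σ : X ⟶ Y)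
    (c : Splitting Y) (x : H.obj (op (c.part true, c.part false))) :
    CoprodSum.map H σ
      (DirectSum.lof k (Splitting Y) (fun c => H.obj (op (c.part true, c.part false))) c x) =
      DirectSum.lof k (Splitting X) (fun c => H.obj (op (c.part true, c.part false)))
        (c.pull (FB.equiv σ)) ((H.map (Splitting.equiv σ c).op).hom x) := by
  rw [CoprodSum.map, DirectSum.toModule_lof]
  rfl

theorem CoprodSum.map_id (H : (FB × FB)ᵒᵖ ⥤ ModuleCat.{u} k) (X : FB) :
    CoprodSum.map H (𝟙 X) = LinearMap.id := by
  apply DirectSum.linearMap_ext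
  intro c
  refine LinearMap.ext fun x => ?_
  refine (CoprodSum.map_lof H (𝟙 X) c x).trans ?_
  exact congrArg _ (congrArg (fun φ => φ.hom x) (H.map_id (op (c.part true, c.part false))))

theorem CoprodSum.map_comp (H : (FB × FB)ᵒᵖ ⥤ ModuleCat.{u} k) {X Y Z : FB} (σ : X ⟶ Y)
    (τ : Y ⟶ Z) : CoprodSum.map H (σ ≫ τ) = CoprodSum.map H σ ∘ₗ CoprodSum.map H τ := by
  apply DirectSum.linearMap_ext
  intro c
  refine LinearMap.ext fun x => ?_
  refine (CoprodSum.map_lof H (σ ≫ τ) c x).trans ?_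
  rw [LinearMap.comp_apply, LinearMap.comp_apply, CoprodSum.map_lof, CoprodSum.map_lof]
  exact congrArg _ (congrArg (fun φ => φ.hom x)
    (H.map_comp (Splitting.equiv τ c).op (Splitting.equiv σ (c.pull (FB.equiv τ))).op))

theorem CoprodSum.lmap_map {H H' : (FB × FB)ᵒᵖ ⥤ ModuleCat.{u} k} (θ : H ⟶ H') {X Y : FB}
    (σ : X ⟶ Y) :
    (DirectSum.lmap fun c : Splitting X => (θ.app (op (c.part true, c.part false))).hom) ∘ₗ
        CoprodSum.map H σ =
      CoprodSum.map H' σ ∘ₗ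
        DirectSum.lmap fun c : Splitting Y => (θ.app (op (c.part true, c.part false))).hom := by
  apply DirectSum.linearMap_ext
  intro c
  refine LinearMap.ext fun x => ?_
  simp only [LinearMap.comp_apply, DirectSum.lmap_lof]
  rw [CoprodSum.map_lof, CoprodSum.map_lof, DirectSum.lmap_lof]
  exact congrArg _ (congrArg (fun φ => φ.hom x) (θ.naturality (Splitting.equiv σ c).op))

variable (k) in
/-- The functor `⊔_*^op`, from right `k (FB × FB)`-modules to right `k FB`-modules, with values
`X ↦ ⨁_{X = X₁ ⊔ X₂} H(X₁, X₂)`. -/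
def coprodPush : ((FB × FB)ᵒᵖ ⥤ ModuleCat.{u} k) ⥤ FBᵒᵖ ⥤ ModuleCat.{u} k where
  obj H :=
    { obj := fun X => ModuleCat.of k (CoprodSum H X.unop)
      map := fun σ => ModuleCat.ofHom (CoprodSum.map H σ.unop)
      map_id := fun X => by
        ext : 1
        exact CoprodSum.map_id H X.unop
      map_comp := fun σ τ => by
        ext : 1
        exact CoprodSum.map_comp H τ.unop σ.unop }
  map θ :=
    { app := fun X => ModuleCat.ofHom
        (DirectSum.lmap fun c : Splitting X.unop => (θ.app (op (c.part true, c.part false))).hom)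
      naturality := fun X Y σ => by
        ext : 1
        exact CoprodSum.lmap_map θ σ.unop }
  map_id H := by
    ext X : 3
    exact DirectSum.lmap_id
  map_comp θ η := by
    ext X : 3
    exact DirectSum.lmap_comp _ _

variable (k) in
/-- For a functor `J` from `FB` to a linear category `L`, the bimodule with values
`((A, B), (X, Y)) ↦ L(J A, J X) ⊗ L(J B, J Y)`, contravariant in `(A, B)` and covariant in
`(X, Y)`. -/
def homTensorTwo {L : Type w} [Category.{u} L] [Preadditive L] [Linear k L] (J : FB ⥤ L) : FB × FB ⥤ (FB × FB)ᵒᵖ ⥤ ModuleCat.{u} k where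
  obj Y :=
    { obj := fun A => ModuleCat.of k
        ((J.obj A.unop.1 ⟶ J.obj Y.1) ⊗[k]
          (J.obj A.unop.2 ⟶ J.obj Y.2))
      map := fun σ => ModuleCat.ofHom (TensorProduct.map
        (Linear.leftComp k (J.obj Y.1) (J.map σ.unop.1))
        (Linear.leftComp k (J.obj Y.2) (J.map σ.unop.2)))
      map_id := fun A => by
        ext : 1
        refine TensorProduct.ext' fun a b => ?_
        simp
      map_comp := fun σ τ => by
        ext : 1
        refine TensorProduct.ext' fun a b => ?_
        simp }
  map τ :=
    { app := fun A => ModuleCat.ofHom (TensorProduct.map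
        (Linear.rightComp k (J.obj A.unop.1) (J.map τ.1))
        (Linear.rightComp k (J.obj A.unop.2) (J.map τ.2)))
      naturality := fun A B σ => by
        ext : 1
        refine TensorProduct.ext' fun a b => ?_
        simp }
  map_id Y := by
    ext A : 3
    refine TensorProduct.ext' fun a b => ?_
    simp
  map_comp σ τ := by
    ext A : 3
    refine TensorProduct.ext' fun a b => ?_
    simp

variable (k) in
/-- The bimodule `(k ub)_(δ; ε) ⊗ (k ub)_(δ; ε)`, with values
`((A, B), (X, Y)) ↦ (k ub)(A, X) ⊗ (k ub)(B, Y)`. -/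
def ubTensorTwo (δ ε : ℤˣ) : FB × FB ⥤ (FB × FB)ᵒᵖ ⥤ ModuleCat.{u} k :=
  homTensorTwo k (FB.toKUb k δ ε)

variable (k) in
/-- The bimodule `(⊔_*^op ((k ub)_(δ; ε) ⊗ (k ub)_(δ; ε)))^♯`: a left `k FB`-module and a right
`k (FB × FB)`-module. -/
def phiKernel (δ ε : ℤˣ) : FB ⥤ (FB × FB)ᵒᵖ ⥤ ModuleCat.{u} k :=
  sharp (ubTensorTwo k δ ε ⋙ coprodPush k).flip

variable (k) in
/-- The functor `(⊔_*^op ((k ub)_(δ; ε) ⊗ (k ub)_(δ; ε)))^♯ ⊗_{k (FB × FB)} -` from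
`k (FB × FB)`-modules to `k FB`-modules, formed over the skeleton of `FB × FB` given by the pairs
`(𝐦, 𝐧)`. -/
def phi (δ ε : ℤˣ) : (FB × FB ⥤ ModuleCat.{u} k) ⥤ FB ⥤ ModuleCat.{u} k where
  obj M :=
    { obj := fun U => ModuleCat.of k
        (⨁ p : ℕ × ℕ, Tens ((phiKernel k δ ε).obj U) M (FB.fin₂ p.1 p.2))
      map := fun σ => ModuleCat.ofHom
        (DirectSum.lmap fun p => Tens.map ((phiKernel k δ ε).map σ) (𝟙 M) (FB.fin₂ p.1 p.2))
      map_id := fun U => by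
        ext : 1
        rw [CategoryTheory.Functor.map_id]
        exact Tens.lmap_id (fun p : ℕ × ℕ => FB.fin₂ p.1 p.2) _ _
      map_comp := fun σ τ => by
        ext : 1
        rw [CategoryTheory.Functor.map_comp]
        exact Tens.lmap_comp (fun p : ℕ × ℕ => FB.fin₂ p.1 p.2) _ _ (𝟙 M) (𝟙 M) }
  map {M N} θ :=
    { app := fun U => ModuleCat.ofHom
        (DirectSum.lmap fun p => Tens.map (𝟙 ((phiKernel k δ ε).obj U)) θ (FB.fin₂ p.1 p.2))
      naturality := fun U V σ => by
        ext : 1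
        refine (Tens.lmap_comp (fun p : ℕ × ℕ => FB.fin₂ p.1 p.2) _ _ _ _).symm.trans
          ((Tens.lmap_comp (fun p : ℕ × ℕ => FB.fin₂ p.1 p.2) _ _ _ _).symm.trans ?_).symm
        simp only [Category.comp_id, Category.id_comp] }
  map_id M := by
    ext U : 3
    exact Tens.lmap_id (fun p : ℕ × ℕ => FB.fin₂ p.1 p.2) _ _
  map_comp {M N L} θ η := by
    ext U : 3
    exact Tens.lmap_comp (fun p : ℕ × ℕ => FB.fin₂ p.1 p.2) (𝟙 ((phiKernel k δ ε).obj U))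
      (𝟙 ((phiKernel k δ ε).obj U)) θ η

instance (δ ε : ℤˣ) : (phi k δ ε).Additive where
  map_add {M N} θ η := by
    ext U : 3
    apply DirectSum.linearMap_ext
    intro p
    refine LinearMap.ext fun x => ?_
    let T (p : ℕ × ℕ) := Tens ((phiKernel k δ ε).obj U) M (FB.fin₂ p.1 p.2)
    let T' (p : ℕ × ℕ) := Tens ((phiKernel k δ ε).obj U) N (FB.fin₂ p.1 p.2)
    let f (η : M ⟶ N) (p : ℕ × ℕ) : T p →ₗ[k] T' p :=
      Tens.map (𝟙 ((phiKernel k δ ε).obj U)) η (FB.fin₂ p.1 p.2)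
    change DirectSum.lmap (f (θ + η)) (DirectSum.lof k (ℕ × ℕ) T p x) =
      DirectSum.lmap (f θ) (DirectSum.lof k (ℕ × ℕ) T p x) +
        DirectSum.lmap (f η) (DirectSum.lof k (ℕ × ℕ) T p x)
    rw [DirectSum.lmap_lof, DirectSum.lmap_lof, DirectSum.lmap_lof, ← map_add]
    exact congrArg _ (LinearMap.congr_fun (Tens.map_add_right _ θ η _) x)

end Phi

end

end BrauerKoszul

namespace BrauerKoszul

noncomputable section

/-! ### The norm map and exactness of tensor products over finite groupoids -/

/-! In characteristic zero the coinvariants of a finite group are its invariants. So the tensor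
product of `V(x)^*` with `Q(x)` over the automorphisms of `x` embeds, by the norm, in the linear
maps `V(x) → Q(x)`, and for finite-dimensional `V(x)` its image consists of the equivariant maps
(`Tens.toHom_injective`, `Tens.exists_toHom_eq`). Hence a degree `N` element of the unwalled complex
at `U` is a family of linear maps from `kub(U, X)` to the sum of the `F(X₁, X₂)` over `X = X₁ ⊔ X₂`,
natural for bijections of `X` and supported on `|X| = N`. Looking only at the component of `X = Y₁ ⊔
Y₂` given by the two summands loses nothing, and leaves natural linear maps `kub(U, Y₁ ⊔ Y₂) → F(Y₁,
Y₂)`.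

On the other side, an element of `Φ` of the walled complex can be evaluated twice, first at `f₁ ⊗
f₂` with `f₁ : U₁ ⟶ x` and `f₂ : U₂ ⟶ y`, then at a walled `h : (x, y) ⟶ (Y₁, Y₂)`. It becomes a
function of such data, collected in `Dec`, with values in `F(Y₁, Y₂)`.

The two descriptions agree because a morphism `U ⟶ Y₁ ⊔ Y₂` is, up to sign, the disjoint union of
`f₁` and `f₂` followed by that of `h`: its pairs are sorted into those inside `Y₁`, those inside
`Y₂` and those between the two. Such factorisations exist by `Dec.exists_cls_eq` and are unique up
to bijections of the middle objects by `Dec.exists_eq_of_hom_map_eq`. The signs are consistent by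
`IsTwisted.sortPairs_swap` and `IsTwisted.sortPairs_flip`, which yields
`Dec.IsCompatible.exists_linearMap`. Both sides therefore inject into the functions on
decompositions, with the same image `Dec.IsNatural`, and the isomorphism matches elements having the
same values.

In this picture both differentials are one formula: the new value at `t` is the value at `t`
followed by the adjunction of one walled pair, pulled back along that adjunction. For the unwalled
differential this uses that the transfer turns the sum over `i < j` into a sum over both directions
of each pair, the sign `δ` of a reversal cancelling against the `δ` of the relation in `kub`
(`ubEvalTerm_add_reverse`), and that a morphism with one pair is a fixed one followed by a unique
bijection.

The norm also shows that tensoring over a finite group is exact, so `Φ` is exact; an exact functor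
commutes with homology, which gives the last statement. -/

instance FB.fintypeHom (x y : FB) : Fintype (x ⟶ y) :=
  haveI : Finite (x ⟶ y) := inferInstanceAs (Finite (x ≃ y))
  Fintype.ofFinite _

instance FB.fintypeHomProd (x y : FB × FB) : Fintype (x ⟶ y) :=
  inferInstanceAs (Fintype ((x.1 ⟶ y.1) × (x.2 ⟶ y.2)))

section Norm

variable {k : Type u} [Field k] {G : Type*} [Groupoid G]
  {P P' : Gᵒᵖ ⥤ ModuleCat.{u} k} {Q Q' : G ⥤ ModuleCat.{u} k}

theorem Tens.mk_surjective (x : G) : Function.Surjective (Tens.mk P Q x) :=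
  Submodule.mkQ_surjective _

theorem Tens.map_mk' (a : P ⟶ P') (b : Q ⟶ Q') (x : G) (z) :
    Tens.map a b x (Tens.mk P Q x z) =
      Tens.mk P' Q' x (TensorProduct.map (a.app (op x)).hom (b.app x).hom z) :=
  Tens.desc_mk _ _ _

variable [∀ x y : G, Fintype (x ⟶ y)]

variable (P Q) in
/-- The norm map `p ⊗ q ↦ ∑_ρ p ρ ⊗ ρ⁻¹ q`, the sum being taken over all isomorphisms
`ρ : y ⟶ x`. -/
def Tens.norm (x y : G) :
    Tens P Q x →ₗ[k] P.obj (op y) ⊗[k] Q.obj y :=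
  Tens.desc (∑ ρ : y ⟶ x, TensorProduct.map (P.map ρ.op).hom (Q.map (Groupoid.inv ρ)).hom) (by
    intro σ p q
    simp only [LinearMap.sum_apply, TensorProduct.map_tmul]
    -- Replacing `ρ` by `ρ ≫ σ` moves `σ` from the left factor to the right one, so the sum is
    -- balanced.
    refine Fintype.sum_bijective (fun ρ => ρ ≫ σ)
      ((Groupoid.isoEquivHom x x).symm σ).homToEquiv.bijective _ _ fun ρ => ?_
    simp [← LinearMap.comp_apply, ← ModuleCat.hom_comp, ← Functor.map_comp])

theorem Tens.norm_mk (x y : G) (p : P.obj (op x)) (q : Q.obj x) :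
    Tens.norm P Q x y (Tens.mk P Q x (p ⊗ₜ q)) =
      ∑ ρ : y ⟶ x, (P.map ρ.op).hom p ⊗ₜ (Q.map (Groupoid.inv ρ)).hom q := by
  rw [Tens.norm, Tens.desc_mk]
  simp

/-- In the quotient every summand `pρ ⊗ ρ⁻¹q` of the norm equals `p ⊗ q`. As the group order is
invertible, this makes the norm a split embedding of the coinvariants into the plain tensor product,
which is the only use of characteristic zero for tensor products. -/
theorem Tens.mk_norm (x : G) (z : Tens P Q x) :
    Tens.mk P Q x (Tens.norm P Q x x z) = (Fintype.card (x ⟶ x) : k) • z := by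
  suffices Tens.mk P Q x ∘ₗ Tens.norm P Q x x = (Fintype.card (x ⟶ x) : k) • LinearMap.id from
    LinearMap.congr_fun this z
  refine Tens.ext fun p q => ?_
  rw [LinearMap.comp_apply, Tens.norm_mk, map_sum, LinearMap.smul_apply, LinearMap.id_apply,
    Nat.cast_smul_eq_nsmul, ← Finset.card_univ, ← Finset.sum_const]
  refine Finset.sum_congr rfl fun ρ _ => ?_
  rw [Tens.mk_act, ← LinearMap.comp_apply, ← ModuleCat.hom_comp, ← Functor.map_comp,
    Groupoid.inv_comp, CategoryTheory.Functor.map_id]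
  rfl

theorem card_aut_ne_zero [CharZero k] (x : G) : (Fintype.card (x ⟶ x) : k) ≠ 0 :=
  Nat.cast_ne_zero.2 (Fintype.card_pos_iff.2 ⟨𝟙 x⟩).ne'

theorem Tens.norm_injective [CharZero k] (x : G) :
    Function.Injective (Tens.norm P Q x x) := by
  intro z z' h
  have := congrArg (Tens.mk P Q x) h
  rw [Tens.mk_norm, Tens.mk_norm] at this
  exact smul_right_injective _ (card_aut_ne_zero (k := k) x) this

theorem Tens.norm_map (a : P ⟶ P') (b : Q ⟶ Q') (x y : G) (z : Tens P Q x) :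
    Tens.norm P' Q' x y (Tens.map a b x z) =
      TensorProduct.map (a.app (op y)).hom (b.app y).hom (Tens.norm P Q x y z) := by
  suffices Tens.norm P' Q' x y ∘ₗ Tens.map a b x =
      TensorProduct.map (a.app (op y)).hom (b.app y).hom ∘ₗ Tens.norm P Q x y from
    LinearMap.congr_fun this z
  refine Tens.ext fun p q => ?_
  rw [LinearMap.comp_apply, LinearMap.comp_apply, Tens.map_mk, Tens.norm_mk, Tens.norm_mk,
    map_sum]
  refine Finset.sum_congr rfl fun ρ _ => ?_
  rw [TensorProduct.map_tmul]
  have h1 := congrArg (fun φ => φ.hom p) (a.naturality ρ.op)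
  have h2 := congrArg (fun φ => φ.hom q) (b.naturality (Groupoid.inv ρ))
  exact congrArg₂ _ h1.symm h2.symm

/-- The tensor product over a finite group is exact in characteristic zero. -/
theorem Tens.exact_map [CharZero k] {Q₁ Q₂ Q₃ : G ⥤ ModuleCat.{u} k} (f : Q₁ ⟶ Q₂) (g : Q₂ ⟶ Q₃)
    (x : G) (h : Function.Exact (f.app x).hom (g.app x).hom) :
    Function.Exact (Tens.map (𝟙 P) f x) (Tens.map (𝟙 P) g x) := by
  have h' : Function.Exact ((f.app x).hom.lTensor (P.obj (op x)))
      ((g.app x).hom.lTensor (P.obj (op x))) := Module.Flat.lTensor_exact _ h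
  intro z
  constructor
  · intro hz
    have h1 := Tens.norm_map (𝟙 P) g x x z
    rw [hz, map_zero] at h1
    obtain ⟨w, hw⟩ := (h' _).1 h1.symm
    -- `w` is a preimage of the norm of `z` before passing to coinvariants; projecting the norm back
    -- multiplies `z` by the group order, which is divided out.
    refine ⟨(Fintype.card (x ⟶ x) : k)⁻¹ • Tens.mk P Q₁ x w, ?_⟩
    have h2 : Tens.map (𝟙 P) f x (Tens.mk P Q₁ x w) = (Fintype.card (x ⟶ x) : k) • z := by
      rw [← Tens.mk_norm, ← hw]
      exact Tens.map_mk' _ _ _ _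
    rw [map_smul, h2, inv_smul_smul₀ (card_aut_ne_zero (k := k) x)]
  · rintro ⟨z, rfl⟩
    obtain ⟨w, rfl⟩ := Tens.mk_surjective x z
    rw [Tens.map_mk', Tens.map_mk']
    refine (congrArg _ ((h' _).2 ⟨w, rfl⟩)).trans (map_zero _)

/-- An identification of a right module with the dual of a left module. -/
structure DualPairing (P : Gᵒᵖ ⥤ ModuleCat.{u} k) (V : G ⥤ ModuleCat.{u} k) where
  equiv : ∀ x, P.obj (op x) ≃ₗ[k] Module.Dual k (V.obj x)
  equiv_map : ∀ {x y : G} (ρ : x ⟶ y) (p : P.obj (op y)) (v : V.obj x),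
    equiv x ((P.map ρ.op).hom p) v = equiv y p ((V.map ρ).hom v)

variable {V V' : G ⥤ ModuleCat.{u} k} (e : DualPairing P V) (e' : DualPairing P' V')

/-- The linear map from the tensor product of the dual of `V(x)` with `Q(x)` to the space of linear
maps from `V(y)` to `Q(y)` given by the norm. -/
def Tens.toHom (Q : G ⥤ ModuleCat.{u} k) (x y : G) : Tens P Q x →ₗ[k] V.obj y →ₗ[k] Q.obj y :=
  dualTensorHom k (V.obj y) (Q.obj y) ∘ₗ (e.equiv y).toLinearMap.rTensor (Q.obj y) ∘ₗ
    Tens.norm P Q x y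

theorem Tens.toHom_mk (x y : G) (p : P.obj (op x)) (q : Q.obj x) (v : V.obj y) :
    Tens.toHom e Q x y (Tens.mk P Q x (p ⊗ₜ q)) v =
      ∑ ρ : y ⟶ x, e.equiv x p ((V.map ρ).hom v) • (Q.map (Groupoid.inv ρ)).hom q := by
  simp [Tens.toHom, Tens.norm_mk, dualTensorHom_apply, e.equiv_map]

/-- The sum over all isomorphisms to `x` is invariant under reindexing by `ρ`, so the linear maps
coming from the norm form a family natural for isomorphisms, not just unrelated maps. -/
theorem Tens.toHom_act (x : G) {y y' : G} (ρ : y ⟶ y') (z : Tens P Q x) (v : V.obj y) :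
    Tens.toHom e Q x y' z ((V.map ρ).hom v) = (Q.map ρ).hom (Tens.toHom e Q x y z v) := by
  suffices LinearMap.lcomp k _ (V.map ρ).hom ∘ₗ Tens.toHom e Q x y' =
      LinearMap.compRight k (Q.map ρ).hom ∘ₗ Tens.toHom e Q x y from
    LinearMap.congr_fun (LinearMap.congr_fun this z) v
  refine Tens.ext fun p q => LinearMap.ext fun v => ?_
  change Tens.toHom e Q x y' _ _ = (Q.map ρ).hom (Tens.toHom e Q x y _ _)
  rw [Tens.toHom_mk, Tens.toHom_mk, map_sum]
  refine (Fintype.sum_bijective (fun τ => Groupoid.inv ρ ≫ τ)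
    ((Groupoid.isoEquivHom y y').symm ρ).homFromEquiv.bijective _ _
    fun τ => ?_).symm
  have h1 : (V.map τ).hom v = (V.map (Groupoid.inv ρ ≫ τ)).hom ((V.map ρ).hom v) := by
    rw [← LinearMap.comp_apply, ← ModuleCat.hom_comp, ← Functor.map_comp]
    simp
  have h2 : (Q.map ρ).hom ((Q.map (Groupoid.inv τ)).hom q) =
      (Q.map (Groupoid.inv (Groupoid.inv ρ ≫ τ))).hom q := by
    rw [← LinearMap.comp_apply, ← ModuleCat.hom_comp, ← Functor.map_comp]
    simp
  rw [map_smul, h1, h2]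

/-- A composite of three injections: the norm, the identification of `P` with the dual of `V`, and
the map from `V^* ⊗ Q` to linear maps, bijective because `V(x)` is finite-dimensional. -/
theorem Tens.toHom_injective [CharZero k] (x : G) [FiniteDimensional k (V.obj x)] :
    Function.Injective (Tens.toHom e Q x x) :=
  ((dualTensorHomEquiv k (V.obj x) (Q.obj x)).injective.comp
    ((e.equiv x).rTensor (Q.obj x)).injective).comp (Tens.norm_injective x)

/-- Lifting `φ` to `P(x) ⊗ Q(x)` and taking the norm symmetrises `φ`. No equivariance is required
here; for an equivariant `φ` the sum collapses to a multiple of it. -/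
theorem Tens.exists_toHom (x : G) [FiniteDimensional k (V.obj x)] (φ : V.obj x →ₗ[k] Q.obj x) :
    ∃ z : Tens P Q x, ∀ (y : G) (v : V.obj y),
      Tens.toHom e Q x y z v =
        ∑ ρ : y ⟶ x, (Q.map (Groupoid.inv ρ)).hom (φ ((V.map ρ).hom v)) := by
  obtain ⟨w, rfl⟩ := (dualTensorHomEquiv k (V.obj x) (Q.obj x)).surjective φ
  obtain ⟨w, rfl⟩ := ((e.equiv x).rTensor (Q.obj x)).surjective w
  refine ⟨Tens.mk P Q x w, fun y v => ?_⟩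
  induction w using TensorProduct.induction_on with
  | zero => simp
  | add a b ha hb =>
    simp only [map_add, LinearMap.add_apply, ha, hb, Finset.sum_add_distrib]
  | tmul p q =>
    rw [Tens.toHom_mk]
    simp [dualTensorHom_apply]

/-- The hypothesis says that `a` is the transpose of `θ` at the single object `y`. Functoriality in
the dual variable thus becomes precomposition, which is how changes of `U` are read off later. -/
theorem Tens.toHom_map (a : P ⟶ P') (b : Q ⟶ Q') {y : G} (θ : V'.obj y →ₗ[k] V.obj y)
    (h : ∀ (p : P.obj (op y)) (v : V'.obj y),
      e'.equiv y ((a.app (op y)).hom p) v = e.equiv y p (θ v)) (x : G) (z : Tens P Q x)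
    (v : V'.obj y) :
    Tens.toHom e' Q' x y (Tens.map a b x z) v = (b.app y).hom (Tens.toHom e Q x y z (θ v)) := by
  rw [Tens.toHom, LinearMap.comp_apply, LinearMap.comp_apply, Tens.norm_map]
  rw [Tens.toHom, LinearMap.comp_apply, LinearMap.comp_apply]
  generalize Tens.norm P Q x y z = w
  induction w using TensorProduct.induction_on with
  | zero => simp
  | add a b ha hb => simp only [map_add, LinearMap.add_apply, ha, hb]
  | tmul p q => simp [dualTensorHom_apply, h]

end Norm

/-! ### Exactness of the functor `Φ` -/

section Exact

variable {k : Type u} [Field k]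

theorem exact_lmap {ι : Type*} {V₁ V₂ V₃ : ι → Type*} [∀ i, AddCommGroup (V₁ i)]
    [∀ i, Module k (V₁ i)] [∀ i, AddCommGroup (V₂ i)] [∀ i, Module k (V₂ i)]
    [∀ i, AddCommGroup (V₃ i)] [∀ i, Module k (V₃ i)] (f : ∀ i, V₁ i →ₗ[k] V₂ i)
    (g : ∀ i, V₂ i →ₗ[k] V₃ i) (h : ∀ i, Function.Exact (f i) (g i)) :
    Function.Exact (DirectSum.lmap f) (DirectSum.lmap g) := by
  rw [LinearMap.exact_iff, DirectSum.ker_lmap, DirectSum.range_lmap]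
  exact congrArg _ (congrArg _ (funext fun i => LinearMap.exact_iff.1 (h i)))

/-- Evaluation at an object commutes with homology, so the homology of `S` vanishes once all its
values do. -/
theorem exact_of_forall_app {J : Type*} [Category J] (S : ShortComplex (J ⥤ ModuleCat.{u} k))
    (h : ∀ j, Function.Exact (S.f.app j).hom (S.g.app j).hom) : S.Exact := by
  rw [ShortComplex.exact_iff_isZero_homology, Functor.isZero_iff]
  intro j
  have h1 : (S.map ((evaluation J (ModuleCat.{u} k)).obj j)).Exact :=
    (ShortComplex.ShortExact.moduleCat_exact_iff_function_exact _).2 (h j)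
  rw [ShortComplex.exact_iff_isZero_homology] at h1
  exact h1.of_iso (S.mapHomologyIso ((evaluation J (ModuleCat.{u} k)).obj j)).symm

theorem app_exact {J : Type*} [Category J] (S : ShortComplex (J ⥤ ModuleCat.{u} k))
    (h : S.Exact) (j : J) : Function.Exact (S.f.app j).hom (S.g.app j).hom :=
  (ShortComplex.ShortExact.moduleCat_exact_iff_function_exact _).1
    (h.map ((evaluation J (ModuleCat.{u} k)).obj j))

theorem phi_exact [CharZero k] (δ ε : ℤˣ) : Limits.PreservesFiniteLimits (phi k δ ε) ∧
    Limits.PreservesFiniteColimits (phi k δ ε) := by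
  -- These two entries of the list of equivalent conditions are the preservation of exact short
  -- complexes and the preservation of finite limits and colimits.
  refine ((phi k δ ε).exact_tfae.out 1 3).1 fun S hS => ?_
  refine exact_of_forall_app _ fun U => ?_
  exact exact_lmap _ _ fun p => Tens.exact_map _ _ _ (app_exact S hS _)

end Exact

/-! ### Sorting lists of pairs in a disjoint union -/

section SortPairs

variable {k : Type u} [Field k] {A B : Type} {V : Type*} [AddCommGroup V] [Module k V]

/-- Functions of three lists of pairs, in `A`, in `B` and between `A` and `B`, on which
exchanging adjacent pairs acts through `e` and reversing a pair in `A` or `B` through `d`. -/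
structure IsTwisted (e d : k) (Ψ : List (A × A) → List (B × B) → List (A × B) → V) : Prop where
  swap₁ : ∀ a b p q l m, Ψ (a ++ p :: q :: b) l m = e • Ψ (a ++ q :: p :: b) l m
  flip₁ : ∀ a b p l m, Ψ (a ++ p :: b) l m = d • Ψ (a ++ p.swap :: b) l m
  swap₂ : ∀ a b p q l m, Ψ l (a ++ p :: q :: b) m = e • Ψ l (a ++ q :: p :: b) m
  flip₂ : ∀ a b p l m, Ψ l (a ++ p :: b) m = d • Ψ l (a ++ p.swap :: b) m
  swap₃ : ∀ a b p q l m, Ψ l m (a ++ p :: q :: b) = e • Ψ l m (a ++ q :: p :: b)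

/-- The function on lists of pairs in `A ⊕ B` induced by a function of three lists: the pairs in
`A` are moved to the front, followed by those in `B` and by those between `A` and `B`, directed
from `A` to `B`, each exchange contributing `e` and each reversal `d`. -/
def sortPairs (e d : k) : List ((A ⊕ B) × (A ⊕ B)) →
    (List (A × A) → List (B × B) → List (A × B) → V) → V
  | [], Ψ => Ψ [] [] []
  | (.inl a, .inl a') :: L, Ψ => sortPairs e d L fun l m n => Ψ ((a, a') :: l) m n
  | (.inr b, .inr b') :: L, Ψ => sortPairs e d L fun l m n => e ^ l.length • Ψ l ((b, b') :: m) n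
  | (.inl a, .inr b) :: L, Ψ =>
      sortPairs e d L fun l m n => e ^ (l.length + m.length) • Ψ l m ((a, b) :: n)
  | (.inr b, .inl a) :: L, Ψ =>
      sortPairs e d L fun l m n => d • e ^ (l.length + m.length) • Ψ l m ((a, b) :: n)

theorem sortPairs_smul (e d c : k) (L : List ((A ⊕ B) × (A ⊕ B)))
    (Ψ : List (A × A) → List (B × B) → List (A × B) → V) :
    sortPairs e d L (fun l m n => c • Ψ l m n) = c • sortPairs e d L Ψ := by
  induction L generalizing Ψ with
  | nil => rfl
  | cons p L ih =>
    obtain ⟨a | b, a' | b'⟩ := p <;> simp only [sortPairs, ← ih] <;> congr 1 <;> funext l m n <;>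
      module

variable {e d : k} {Ψ : List (A × A) → List (B × B) → List (A × B) → V}

/-- Consuming the head replaces `Ψ` by another twisted function, because the new powers of `e`
depend only on the lengths of the lists, which exchanges and reversals preserve. Inductions along a
prefix therefore reduce to relations at the head of the list. -/
theorem IsTwisted.cons (h : IsTwisted e d Ψ) (p : (A ⊕ B) × (A ⊕ B)) :
    ∃ Ψ' : List (A × A) → List (B × B) → List (A × B) → V, IsTwisted e d Ψ' ∧
      ∀ L, sortPairs e d (p :: L) Ψ = sortPairs e d L Ψ' := by
  obtain ⟨a | b, a' | b'⟩ := p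
  · exact ⟨_, ⟨fun l _ _ _ _ _ => h.swap₁ (_ :: l) _ _ _ _ _, fun l _ _ _ _ => h.flip₁ (_ :: l) _ _ _ _,
      fun _ _ _ _ _ _ => h.swap₂ _ _ _ _ _ _, fun _ _ _ _ _ => h.flip₂ _ _ _ _ _,
      fun _ _ _ _ _ _ => h.swap₃ _ _ _ _ _ _⟩, fun L => rfl⟩
  · refine ⟨_, ⟨fun l _ _ _ _ _ => ?_, fun l _ _ _ _ => ?_, fun _ _ _ _ _ _ => ?_,
      fun _ _ _ _ _ => ?_, fun l _ _ _ _ _ => ?_⟩, fun L => rfl⟩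
    · rw [h.swap₁]; simp only [List.length_append, List.length_cons, smul_smul]; congr 1; ring1
    · rw [h.flip₁]; simp only [List.length_append, List.length_cons, smul_smul]; congr 1; ring1
    · rw [h.swap₂]; simp only [List.length_append, List.length_cons, smul_smul]; congr 1; ring1
    · rw [h.flip₂]; simp only [List.length_append, List.length_cons, smul_smul]; congr 1; ring1
    · rw [← List.cons_append, h.swap₃]; simp only [smul_smul]; congr 1; ring1
  · refine ⟨_, ⟨fun l _ _ _ _ _ => ?_, fun l _ _ _ _ => ?_, fun _ _ _ _ _ _ => ?_,
      fun _ _ _ _ _ => ?_, fun l _ _ _ _ _ => ?_⟩, fun L => rfl⟩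
    · rw [h.swap₁]; simp only [List.length_append, List.length_cons, smul_smul]; congr 1; ring1
    · rw [h.flip₁]; simp only [List.length_append, List.length_cons, smul_smul]; congr 1; ring1
    · rw [h.swap₂]; simp only [List.length_append, List.length_cons, smul_smul]; congr 1; ring1
    · rw [h.flip₂]; simp only [List.length_append, List.length_cons, smul_smul]; congr 1; ring1
    · rw [← List.cons_append, h.swap₃]; simp only [smul_smul]; congr 1; ring1
  · refine ⟨_, ⟨fun l _ _ _ _ _ => ?_, fun l _ _ _ _ => ?_, fun l _ _ _ _ _ => ?_,
      fun l _ _ _ _ => ?_, fun l _ _ _ _ _ => ?_⟩, fun L => rfl⟩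
    · rw [h.swap₁]; simp only [List.length_append, List.length_cons, smul_smul]; congr 1; ring1
    · rw [h.flip₁]; simp only [List.length_append, List.length_cons, smul_smul]; congr 1; ring1
    · rw [← List.cons_append, h.swap₂]; simp only [smul_smul]; congr 1; ring1
    · rw [← List.cons_append, h.flip₂]; simp only [smul_smul]; congr 1; ring1
    · rw [h.swap₃]; simp only [smul_smul]; congr 1; ring1

/-- At the head there are sixteen cases. If `p` and `q` go to the same block, the relation comes
from an exchange inside that block. If they go to different blocks, both orders give the same three
lists and the exponents of `e` differ by one, which `e * e = 1` corrects in either direction. -/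
theorem IsTwisted.sortPairs_swap (h : IsTwisted e d Ψ) (he : e * e = 1)
    (L₁ L₂ : List ((A ⊕ B) × (A ⊕ B))) (p q : (A ⊕ B) × (A ⊕ B)) :
    sortPairs e d (L₁ ++ p :: q :: L₂) Ψ = e • sortPairs e d (L₁ ++ q :: p :: L₂) Ψ := by
  induction L₁ generalizing Ψ with
  | cons r L ih =>
    obtain ⟨Ψ', h', H⟩ := h.cons r
    rw [List.cons_append, List.cons_append, H, H, ih h']
  | nil =>
    have s₂ : ∀ b p q l m, Ψ l (p :: q :: b) m = e • Ψ l (q :: p :: b) m := h.swap₂ []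
    have s₃ : ∀ b p q l m, Ψ l m (p :: q :: b) = e • Ψ l m (q :: p :: b) := h.swap₃ []
    obtain ⟨a | b, a' | b'⟩ := p <;> obtain ⟨s | t, s' | t'⟩ := q <;>
      simp only [sortPairs, List.nil_append, ← sortPairs_smul] <;> congr 1 <;> funext l m n
    -- The last four alternatives differ only in the monomial by which the relation `he` has to be
    -- multiplied; it depends on the two blocks and on whether a mixed pair was reversed.
    all_goals first
      | exact h.swap₁ [] _ _ _ _ _
      | (rw [s₂]; simp only [smul_smul]; congr 1; ring1)
      | (rw [s₃]; simp only [smul_smul]; congr 1; ring1)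
      | (simp only [List.length_cons, smul_smul]; congr 1; ring1)
      | (simp only [List.length_cons, smul_smul]; congr 1
         linear_combination (-(e ^ l.length)) * he)
      | (simp only [List.length_cons, smul_smul]; congr 1
         linear_combination (-(e ^ (l.length + m.length))) * he)
      | (simp only [List.length_cons, smul_smul]; congr 1
         linear_combination (-(d * e ^ (l.length + m.length))) * he)
      | (simp only [List.length_cons, smul_smul]; congr 1
         linear_combination (-(e ^ l.length * e ^ (l.length + m.length))) * he)
      | (simp only [List.length_cons, smul_smul]; congr 1
         linear_combination (-(d * e ^ l.length * e ^ (l.length + m.length))) * he)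

/-- A pair inside one summand uses the relation of `Ψ`. A mixed pair and its reversal contribute the
same entry to the third list, with coefficients differing by `d`; one direction is immediate and the
other uses `d * d = 1`. -/
theorem IsTwisted.sortPairs_flip (h : IsTwisted e d Ψ) (hd : d * d = 1)
    (L₁ L₂ : List ((A ⊕ B) × (A ⊕ B))) (p : (A ⊕ B) × (A ⊕ B)) :
    sortPairs e d (L₁ ++ p :: L₂) Ψ = d • sortPairs e d (L₁ ++ p.swap :: L₂) Ψ := by
  induction L₁ generalizing Ψ with
  | cons r L ih =>
    obtain ⟨Ψ', h', H⟩ := h.cons r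
    rw [List.cons_append, List.cons_append, H, H, ih h']
  | nil =>
    obtain ⟨a | b, a' | b'⟩ := p <;> 
      simp only [sortPairs, List.nil_append, ← sortPairs_smul, Prod.swap] <;> congr 1 <;> funext l m n
    · exact h.flip₁ [] _ _ _ _
    · rw [smul_smul, hd, one_smul]
    · rw [smul_comm d]
      exact congrArg _ (h.flip₂ [] _ _ _ _)

/-- Whenever a pair is consumed, the blocks that it would have to cross are empty in the rest of the
list, so all exponents of `e` are zero and nothing is reversed. -/
theorem sortPairs_sorted (l : List (A × A)) (m : List (B × B)) (n : List (A × B))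
    (Ψ : List (A × A) → List (B × B) → List (A × B) → V) :
    sortPairs e d (l.map (Prod.map Sum.inl Sum.inl) ++ (m.map (Prod.map Sum.inr Sum.inr) ++
      n.map (Prod.map Sum.inl Sum.inr))) Ψ = Ψ l m n := by
  induction l generalizing Ψ with
  | cons p l ih => exact ih _
  | nil =>
    induction m generalizing Ψ with
    | cons p m ih => exact (ih _).trans (by simp)
    | nil =>
      induction n generalizing Ψ with
      | cons p n ih => exact (ih _).trans (by simp)
      | nil => rfl

end SortPairs


/-! ### Disjoint unions of morphisms -/

section Disjoint

variable {A B : Type}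

/-- Used for finiteness: a morphism is determined by its map and its flattened list of points, and
repetition-free lists in a finite set are finite in number. -/
theorem points_injective {α : Type} : Function.Injective (points (α := α)) := by
  intro l
  induction l with
  | nil =>
    rintro (_ | ⟨p, m⟩) h
    · rfl
    · simp [points] at h
  | cons p l ih =>
    rintro (_ | ⟨q, m⟩) h
    · simp [points] at h
    · simp only [points, List.flatMap_cons, List.cons_append, List.nil_append,
        List.cons.injEq] at h
      obtain ⟨h1, h2, h3⟩ := h
      rw [ih h3, Prod.ext h1 h2]

/-- The list of pairs in `A ⊕ B` obtained from a list of pairs in `A`, a list of pairs in `B` and a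
list of pairs between `A` and `B`. -/
def joinPairs (l : List (A × A)) (m : List (B × B)) (n : List (A × B)) :
    List ((A ⊕ B) × (A ⊕ B)) :=
  l.map (Prod.map Sum.inl Sum.inl) ++ (m.map (Prod.map Sum.inr Sum.inr) ++
    n.map (Prod.map Sum.inl Sum.inr))

theorem inl_mem_points_joinPairs (l : List (A × A)) (m : List (B × B)) (n : List (A × B)) (a : A) :
    Sum.inl a ∈ points (joinPairs l m n) ↔ a ∈ points l ∨ a ∈ n.map Prod.fst := by
  rw [joinPairs, points_append, points_append, points_map, points_map]
  simp [mem_points, eq_comm]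

theorem inr_mem_points_joinPairs (l : List (A × A)) (m : List (B × B)) (n : List (A × B)) (b : B) :
    Sum.inr b ∈ points (joinPairs l m n) ↔ b ∈ points m ∨ b ∈ n.map Prod.snd := by
  rw [joinPairs, points_append, points_append, points_map, points_map]
  simp [mem_points, eq_comm]

theorem points_joinPairs_perm (l : List (A × A)) (m : List (B × B)) (n : List (A × B)) :
    (points (joinPairs l m n)).Perm ((points l ++ n.map Prod.fst).map Sum.inl ++
      (points m ++ n.map Prod.snd).map Sum.inr) := by
  have h : (points (n.map (Prod.map (Sum.inl : A → A ⊕ B) (Sum.inr : B → A ⊕ B)))).Perm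
      ((n.map Prod.fst).map Sum.inl ++ (n.map Prod.snd).map Sum.inr) := by
    induction n with
    | nil => exact List.Perm.refl _
    | cons p n ih =>
      refine List.Perm.cons _ ?_
      exact (ih.cons _).trans List.perm_middle.symm
  rw [joinPairs, points_append, points_append, points_map, points_map, List.map_append,
    List.map_append, List.append_assoc]
  refine List.Perm.append_left _ ?_
  refine (h.append_left _).trans ?_
  rw [← List.append_assoc, ← List.append_assoc]
  exact List.perm_append_comm.append_right _

/-- A mixed pair contributes one point to each summand, so the condition on the union separates into
one condition in `A` and one in `B`. -/
theorem nodup_points_joinPairs (l : List (A × A)) (m : List (B × B)) (n : List (A × B)) :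
    (points (joinPairs l m n)).Nodup ↔
      (points l ++ n.map Prod.fst).Nodup ∧ (points m ++ n.map Prod.snd).Nodup := by
  rw [(points_joinPairs_perm l m n).nodup_iff, List.nodup_append',
    List.nodup_map_iff Sum.inl_injective, List.nodup_map_iff Sum.inr_injective]
  refine ⟨fun h => ⟨h.1, h.2.1⟩, fun h => ⟨h.1, h.2, ?_⟩⟩
  intro x hx hx'
  obtain ⟨a, -, rfl⟩ := List.mem_map.1 hx
  obtain ⟨b, -, h⟩ := List.mem_map.1 hx'
  cases h

theorem joinPairs_map {A' B' : Type} (f : A → A') (g : B → B') (l : List (A × A))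
    (m : List (B × B)) (n : List (A × B)) :
    (joinPairs l m n).map (Prod.map (Sum.map f g) (Sum.map f g)) =
      joinPairs (l.map (Prod.map f f)) (m.map (Prod.map g g)) (n.map (Prod.map f g)) := by
  simp [joinPairs, Function.comp_def, Prod.map]

theorem joinPairs_append_left (l l' : List (A × A)) (m : List (B × B)) (n : List (A × B)) :
    joinPairs (l ++ l') m n = l.map (Prod.map Sum.inl Sum.inl) ++ joinPairs l' m n := by
  simp [joinPairs]

theorem joinPairs_append_right (l : List (A × A)) (m m' : List (B × B)) (n : List (A × B)) :
    joinPairs l (m ++ m') n = joinPairs l m [] ++ joinPairs [] m' n := by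
  simp [joinPairs]

theorem joinPairs_append_mixed (l : List (A × A)) (m : List (B × B)) (n n' : List (A × B)) :
    joinPairs l m n ++ joinPairs [] [] n' = joinPairs l m (n ++ n') := by
  simp [joinPairs]

theorem sum_range_iff {X Y : Type} {f : X → A} {g : Y → B} {l : List (A × A)} {m : List (B × B)}
    {n : List (A × B)} (hf : ∀ a, a ∈ Set.range f ↔ a ∉ points l ++ n.map Prod.fst)
    (hg : ∀ b, b ∈ Set.range g ↔ b ∉ points m ++ n.map Prod.snd) (s : A ⊕ B) :
    s ∈ Set.range (Sum.map f g) ↔ s ∉ points (joinPairs l m n) := by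
  obtain a | b := s
  · rw [inl_mem_points_joinPairs, ← List.mem_append, ← hf]
    simp
  · rw [inr_mem_points_joinPairs, ← List.mem_append, ← hg]
    simp

/-- The disjoint union of the two sets. -/
abbrev UwbOrd.sum (Y : UwbOrd) : UbOrd := ⟨⟨Y.fst ⊕ Y.snd⟩⟩

/-- The disjoint union of a walled morphism. -/
def UwbOrd.sumHom {Y Z : UwbOrd} (h : Y ⟶ Z) : Y.sum ⟶ Z.sum :=
  show UbHom Y.sum.set Z.sum.set from
  { map := Sum.map (UwbHom.map₁ h) (UwbHom.map₂ h)
    pairs := joinPairs [] [] (UwbHom.pairs h)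
    inj := (UwbHom.inj₁ h).sumMap (UwbHom.inj₂ h)
    nodup := (nodup_points_joinPairs _ _ _).2 ⟨UwbHom.nodup₁ h, UwbHom.nodup₂ h⟩
    compl := sum_range_iff (UwbHom.compl₁ h) (UwbHom.compl₂ h) }

theorem UwbOrd.sumHom_comp {X Y Z : UwbOrd} (f : X ⟶ Y) (g : Y ⟶ Z) :
    UwbOrd.sumHom (f ≫ g) = UwbOrd.sumHom f ≫ UwbOrd.sumHom g := by
  refine UbHom.ext ?_ ?_
  · exact (Sum.map_comp_map (UwbHom.map₁ g) (UwbHom.map₂ g) (UwbHom.map₁ f) (UwbHom.map₂ f)).symm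
  · change joinPairs [] [] ((UwbHom.pairs f).map _ ++ UwbHom.pairs g) =
      (joinPairs [] [] (UwbHom.pairs f)).map (Prod.map (Sum.map _ _) (Sum.map _ _)) ++ _
    rw [joinPairs_map]
    exact (joinPairs_append_mixed _ _ _ _).symm

/-- Walled pairs have a fixed direction, so only exchanges occur and `δ` plays no role. -/
theorem uwbTwist_sumHom {k : Type u} [Field k] {δ ε : ℤˣ} {Y Z : UwbOrd} {f g : Y ⟶ Z} {c : k}
    (h : (uwbTwistRel k ε).rel f g c) :
    (ubTwistRel k δ ε).rel (UwbOrd.sumHom f) (UwbOrd.sumHom g) c := by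
  obtain ⟨l₁, l₂, p, q, h1, h2, h3, h4⟩ := h
  refine UbTwist.swap (l₁.map (Prod.map Sum.inl Sum.inr)) (l₂.map (Prod.map Sum.inl Sum.inr))
    (Prod.map Sum.inl Sum.inr p) (Prod.map Sum.inl Sum.inr q) ?_ ?_ ?_
  · change Sum.map _ _ = Sum.map _ _
    rw [h1, h2]
  · change joinPairs [] [] (UwbHom.pairs f) = _
    rw [h3]
    simp [joinPairs]
  · change joinPairs [] [] (UwbHom.pairs g) = _
    rw [h4]
    simp [joinPairs]

end Disjoint

/-! ### Gluing morphisms along a decomposition of the source -/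

section Glue

variable {U : FB} {c : Splitting U} {X Y : FB}

/-- The map on a set obtained from maps on the two parts of a decomposition. -/
def Splitting.glueMap {α β : Type} (c : Splitting U) (f : c.part true → α) (g : c.part false → β)
    (u : U) : α ⊕ β :=
  if h : c u = true then .inl (f ⟨u, h⟩) else .inr (g ⟨u, Bool.eq_false_iff.2 h⟩)

theorem Splitting.glueMap_true {α β : Type} (f : c.part true → α) (g : c.part false → β) {u : U}
    (h : c u = true) : c.glueMap f g u = .inl (f ⟨u, h⟩) := dif_pos h

theorem Splitting.glueMap_false {α β : Type} (f : c.part true → α) (g : c.part false → β) {u : U}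
    (h : c u = false) : c.glueMap f g u = .inr (g ⟨u, h⟩) :=
  dif_neg (by simp [h])

/-- Recovers the decomposition from the glued map, which forces two decompositions with the same
underlying map to split `U` in the same way. -/
theorem Splitting.isLeft_glueMap {α β : Type} (f : c.part true → α) (g : c.part false → β) (u : U) :
    (c.glueMap f g u).isLeft = c u := by
  cases h : c u
  · rw [Splitting.glueMap_false f g h]; rfl
  · rw [Splitting.glueMap_true f g h]; rfl

theorem Splitting.sumMap_glueMap {α β α' β' : Type} (f : c.part true → α) (g : c.part false → β)
    (φ : α → α') (ψ : β → β') : Sum.map φ ψ ∘ c.glueMap f g = c.glueMap (φ ∘ f) (ψ ∘ g) := by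
  funext u
  cases h : c u
  · simp [Splitting.glueMap_false _ _ h]
  · simp [Splitting.glueMap_true _ _ h]

theorem Splitting.inl_mem_range_glueMap {α β : Type} (f : c.part true → α) (g : c.part false → β)
    (a : α) : Sum.inl a ∈ Set.range (c.glueMap f g) ↔ a ∈ Set.range f := by
  constructor
  · rintro ⟨u, hu⟩
    cases h : c u
    · rw [Splitting.glueMap_false _ _ h] at hu; cases hu
    · rw [Splitting.glueMap_true _ _ h] at hu; exact ⟨_, Sum.inl_injective hu⟩
  · rintro ⟨⟨u, h⟩, rfl⟩
    exact ⟨u, Splitting.glueMap_true _ _ h⟩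

theorem Splitting.inr_mem_range_glueMap {α β : Type} (f : c.part true → α) (g : c.part false → β)
    (b : β) : Sum.inr b ∈ Set.range (c.glueMap f g) ↔ b ∈ Set.range g := by
  constructor
  · rintro ⟨u, hu⟩
    cases h : c u
    · rw [Splitting.glueMap_false _ _ h] at hu; exact ⟨_, Sum.inr_injective hu⟩
    · rw [Splitting.glueMap_true _ _ h] at hu; cases hu
  · rintro ⟨⟨u, h⟩, rfl⟩
    exact ⟨u, Splitting.glueMap_false _ _ h⟩

theorem Splitting.glueMap_injective {α β : Type} {f : c.part true → α} {g : c.part false → β}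
    (hf : Function.Injective f) (hg : Function.Injective g) :
    Function.Injective (c.glueMap f g) := by
  intro u v huv
  have hc : c u = c v := by
    rw [← Splitting.isLeft_glueMap f g u, huv, Splitting.isLeft_glueMap]
  cases h : c v
  · rw [Splitting.glueMap_false _ _ (hc.trans h), Splitting.glueMap_false _ _ h] at huv
    exact congrArg Subtype.val (hg (Sum.inr_injective huv))
  · rw [Splitting.glueMap_true _ _ (hc.trans h), Splitting.glueMap_true _ _ h] at huv
    exact congrArg Subtype.val (hf (Sum.inl_injective huv))

/-- The morphism obtained from morphisms on the two parts of a decomposition. -/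
def Splitting.glue (c : Splitting U) (f : UbHom (c.part true) X) (g : UbHom (c.part false) Y) :
    UbHom U ⟨X ⊕ Y⟩ where
  map := c.glueMap f.map g.map
  pairs := joinPairs f.pairs g.pairs []
  inj := Splitting.glueMap_injective f.inj g.inj
  nodup := (nodup_points_joinPairs _ _ _).2 ⟨by simpa using f.nodup, by simpa using g.nodup⟩
  compl := by
    rintro (a | b)
    · rw [inl_mem_points_joinPairs, Splitting.inl_mem_range_glueMap, f.compl]
      simp
    · rw [inr_mem_points_joinPairs, Splitting.inr_mem_range_glueMap, g.compl]
      simp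

/-- The pairs of `f` form a contiguous block of the glued list, and so do those of `g`; a relation
in either one is a relation of the same kind in the glued morphism, with no extra sign. -/
theorem Splitting.glue_rel_left {k : Type u} [Field k] {δ ε : ℤˣ}
    {f f' : UbHom (c.part true) X} {a : k} (h : UbTwist k δ ε f f' a)
    (g : UbHom (c.part false) Y) : UbTwist k δ ε (c.glue f g) (c.glue f' g) a := by
  obtain (⟨l₁, l₂, p, q, h1, h2, h3⟩ | ⟨l₁, l₂, p, h1, h2, h3⟩) := h
  · refine .swap (l₁.map (Prod.map Sum.inl Sum.inl)) (joinPairs l₂ g.pairs [])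
      (Prod.map Sum.inl Sum.inl p) (Prod.map Sum.inl Sum.inl q)
      (congrArg (c.glueMap · g.map) h1) ?_ ?_
    · exact (congrArg (joinPairs · _ _) h2).trans (joinPairs_append_left _ _ _ _)
    · exact (congrArg (joinPairs · _ _) h3).trans (joinPairs_append_left _ _ _ _)
  · refine .flip (l₁.map (Prod.map Sum.inl Sum.inl)) (joinPairs l₂ g.pairs [])
      (Prod.map Sum.inl Sum.inl p) (congrArg (c.glueMap · g.map) h1) ?_ ?_
    · exact (congrArg (joinPairs · _ _) h2).trans (joinPairs_append_left _ _ _ _)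
    · exact (congrArg (joinPairs · _ _) h3).trans (joinPairs_append_left _ _ _ _)

theorem Splitting.glue_rel_right {k : Type u} [Field k] {δ ε : ℤˣ} (f : UbHom (c.part true) X)
    {g g' : UbHom (c.part false) Y} {a : k} (h : UbTwist k δ ε g g' a) :
    UbTwist k δ ε (c.glue f g) (c.glue f g') a := by
  obtain (⟨l₁, l₂, p, q, h1, h2, h3⟩ | ⟨l₁, l₂, p, h1, h2, h3⟩) := h
  · refine .swap (joinPairs f.pairs l₁ []) (joinPairs [] l₂ [])
      (Prod.map Sum.inr Sum.inr p) (Prod.map Sum.inr Sum.inr q)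
      (congrArg (c.glueMap f.map ·) h1) ?_ ?_
    · exact (congrArg (joinPairs _ · _) h2).trans (joinPairs_append_right _ _ _ _)
    · exact (congrArg (joinPairs _ · _) h3).trans (joinPairs_append_right _ _ _ _)
  · refine .flip (joinPairs f.pairs l₁ []) (joinPairs [] l₂ [])
      (Prod.map Sum.inr Sum.inr p) (congrArg (c.glueMap f.map ·) h1) ?_ ?_
    · exact (congrArg (joinPairs _ · _) h2).trans (joinPairs_append_right _ _ _ _)
    · exact (congrArg (joinPairs _ · _) h3).trans (joinPairs_append_right _ _ _ _)

/-- The glued morphism, in the category `UbOrd`. -/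
def Splitting.glueHom (c : Splitting U) (f : FB.toUbOrd.obj (c.part true) ⟶ FB.toUbOrd.obj X)
    (g : FB.toUbOrd.obj (c.part false) ⟶ FB.toUbOrd.obj Y) :
    FB.toUbOrd.obj U ⟶ (FB.toUwbOrd.obj (X, Y)).sum := c.glue f g

/-- Bijections of the middle objects may be absorbed on either side. This is the ambiguity of a
decomposition, and the source of the `middle` condition in `Dec.IsCompatible`. -/
theorem Splitting.glueHom_comp {X' Y' : FB}
    (f : FB.toUbOrd.obj (c.part true) ⟶ FB.toUbOrd.obj X)
    (g : FB.toUbOrd.obj (c.part false) ⟶ FB.toUbOrd.obj Y) (ρ : (X, Y) ⟶ (X', Y')) :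
    c.glueHom (f ≫ FB.toUbOrd.map ρ.1) (g ≫ FB.toUbOrd.map ρ.2) =
      c.glueHom f g ≫ UwbOrd.sumHom (FB.toUwbOrd.map ρ) :=
  UbHom.ext (Splitting.sumMap_glueMap _ _ _ _).symm
    ((congrArg₂ (joinPairs · · []) (List.append_nil _) (List.append_nil _)).trans
      ((joinPairs_map (FB.equiv ρ.1) (FB.equiv ρ.2) (UbHom.pairs f) (UbHom.pairs g) []).symm.trans
        (List.append_nil _).symm))

theorem Splitting.glueHom_pull {U' : FB} (σ : U' ⟶ U)
    (f : FB.toUbOrd.obj (c.part true) ⟶ FB.toUbOrd.obj X)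
    (g : FB.toUbOrd.obj (c.part false) ⟶ FB.toUbOrd.obj Y) :
    (c.pull (FB.equiv σ)).glueHom (FB.toUbOrd.map (Splitting.equiv σ c).1 ≫ f)
      (FB.toUbOrd.map (Splitting.equiv σ c).2 ≫ g) = FB.toUbOrd.map σ ≫ c.glueHom f g :=
  UbHom.ext rfl rfl

end Glue


/-! ### Decompositions of morphisms to a disjoint union -/

section Dec

/-- Data for a morphism from `U` to `Y₁ ⊔ Y₂`: a decomposition `U = U₁ ⊔ U₂`, morphisms
`U₁ ⟶ 𝐱` and `U₂ ⟶ 𝐲`, and a walled morphism `(𝐱, 𝐲) ⟶ (Y₁, Y₂)`. -/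
structure Dec (U : FB) (Y : UwbOrd) where
  x : ℕ
  y : ℕ
  c : Splitting U
  f₁ : FB.toUbOrd.obj (c.part true) ⟶ FB.toUbOrd.obj (FB.fin x)
  f₂ : FB.toUbOrd.obj (c.part false) ⟶ FB.toUbOrd.obj (FB.fin y)
  h : FB.toUwbOrd.obj (FB.fin₂ x y) ⟶ Y

namespace Dec

variable {U : FB} {Y Z : UwbOrd}

/-- The composite morphism. -/
def hom (t : Dec U Y) : FB.toUbOrd.obj U ⟶ Y.sum :=
  t.c.glueHom t.f₁ t.f₂ ≫ UwbOrd.sumHom t.h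

/-- Composition with a walled morphism. -/
def comp (t : Dec U Y) (g : Y ⟶ Z) : Dec U Z := ⟨t.x, t.y, t.c, t.f₁, t.f₂, t.h ≫ g⟩

/-- Composition with a bijection. -/
def pull {U' : FB} (σ : U' ⟶ U) (t : Dec U Y) : Dec U' Y :=
  ⟨t.x, t.y, t.c.pull (FB.equiv σ), FB.toUbOrd.map (Splitting.equiv σ t.c).1 ≫ t.f₁,
    FB.toUbOrd.map (Splitting.equiv σ t.c).2 ≫ t.f₂, t.h⟩

theorem hom_comp (t : Dec U Y) (g : Y ⟶ Z) : (t.comp g).hom = t.hom ≫ UwbOrd.sumHom g := by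
  rw [hom, hom, Category.assoc, ← UwbOrd.sumHom_comp]
  rfl

theorem hom_pull {U' : FB} (σ : U' ⟶ U) (t : Dec U Y) :
    (t.pull σ).hom = FB.toUbOrd.map σ ≫ t.hom := by
  rw [hom, hom, ← Category.assoc, ← Splitting.glueHom_pull]
  rfl

/-- The pairs in the first part. -/
def pairs₁ (t : Dec U Y) : List (Y.fst × Y.fst) :=
  (UbHom.pairs t.f₁).map (Prod.map (UwbHom.map₁ t.h) (UwbHom.map₁ t.h))

/-- The pairs in the second part. -/
def pairs₂ (t : Dec U Y) : List (Y.snd × Y.snd) :=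
  (UbHom.pairs t.f₂).map (Prod.map (UwbHom.map₂ t.h) (UwbHom.map₂ t.h))

/-- The composite has its pairs in the order inside `Y₁`, inside `Y₂`, mixed, so evaluating the
sorted extension at it produces no sign. -/
theorem hom_pairs (t : Dec U Y) :
    UbHom.pairs t.hom = joinPairs t.pairs₁ t.pairs₂ (UwbHom.pairs t.h) := by
  change (joinPairs (UbHom.pairs t.f₁) (UbHom.pairs t.f₂) []).map
    (Prod.map (Sum.map (UwbHom.map₁ t.h) (UwbHom.map₂ t.h)) _) ++ joinPairs [] [] _ = _
  refine (congrArg (· ++ _) (joinPairs_map (UwbHom.map₁ t.h) (UwbHom.map₂ t.h)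
    (UbHom.pairs t.f₁) (UbHom.pairs t.f₂) [])).trans ?_
  exact joinPairs_append_mixed _ _ _ _

theorem hom_map (t : Dec U Y) :
    UbHom.map t.hom = t.c.glueMap (UwbHom.map₁ t.h ∘ UbHom.map t.f₁)
      (UwbHom.map₂ t.h ∘ UbHom.map t.f₂) :=
  Splitting.sumMap_glueMap _ _ _ _

theorem exists_equiv_comp' {α β γ : Type} {f : α → γ} {g : β → γ} (hf : Function.Injective f)
    (hg : Function.Injective g) (h : Set.range f = Set.range g) : ∃ σ : α ≃ β, g ∘ σ = f := by
  refine ⟨(Equiv.ofInjective f hf).trans ((Equiv.setCongr h).trans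
    (Equiv.ofInjective g hg).symm), ?_⟩
  funext a
  simp only [Function.comp_apply, Equiv.trans_apply]
  exact Equiv.apply_ofInjective_symm hg _

theorem _root_.BrauerKoszul.Splitting.glueMap_inj {c : Splitting U} {α β : Type}
    {f f' : c.part true → α} {g g' : c.part false → β} (h : c.glueMap f g = c.glueMap f' g') :
    f = f' ∧ g = g' := by
  constructor
  · funext ⟨u, hu⟩
    have := congrFun h u
    rw [Splitting.glueMap_true _ _ hu, Splitting.glueMap_true _ _ hu] at this
    exact Sum.inl_injective this
  · funext ⟨u, hu⟩
    have := congrFun h u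
    rw [Splitting.glueMap_false _ _ hu, Splitting.glueMap_false _ _ hu] at this
    exact Sum.inr_injective this

/-- The data of a decomposition are unique up to the choice of the middle objects. -/
theorem exists_eq_of_hom_map_eq (t t' : Dec U Y) (hm : UbHom.map t.hom = UbHom.map t'.hom)
    (h₁ : t.pairs₁ = t'.pairs₁) (h₂ : t.pairs₂ = t'.pairs₂)
    (h₃ : UwbHom.pairs t.h = UwbHom.pairs t'.h) :
    ∃ (x y x' y' : ℕ) (c : Splitting U)
      (f₁ : FB.toUbOrd.obj (c.part true) ⟶ FB.toUbOrd.obj (FB.fin x))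
      (f₂ : FB.toUbOrd.obj (c.part false) ⟶ FB.toUbOrd.obj (FB.fin y))
      (ρ : FB.fin₂ x y ⟶ FB.fin₂ x' y') (h : FB.toUwbOrd.obj (FB.fin₂ x' y') ⟶ Y),
      t = ⟨x, y, c, f₁, f₂, FB.toUwbOrd.map ρ ≫ h⟩ ∧
        t' = ⟨x', y', c, f₁ ≫ FB.toUbOrd.map ρ.1, f₂ ≫ FB.toUbOrd.map ρ.2, h⟩ := by
  rw [hom_map, hom_map] at hm
  obtain ⟨x, y, c, f₁, f₂, h⟩ := t
  obtain ⟨x', y', c', f₁', f₂', h'⟩ := t'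
  obtain rfl : c = c' := by
    funext u
    have := congrArg Sum.isLeft (congrFun hm u)
    rwa [Splitting.isLeft_glueMap, Splitting.isLeft_glueMap] at this
  -- The images of `h` and `h'` are the complements of the same mixed pairs, so the two injections
  -- differ by a unique bijection of the middle objects.
  obtain ⟨ρ₁, hρ₁⟩ := exists_equiv_comp' (UwbHom.inj₁ h) (UwbHom.inj₁ h') (by
    ext b
    rw [UwbHom.compl₁, UwbHom.compl₁]
    exact not_congr (by rw [h₃]))
  obtain ⟨ρ₂, hρ₂⟩ := exists_equiv_comp' (UwbHom.inj₂ h) (UwbHom.inj₂ h') (by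
    ext b
    rw [UwbHom.compl₂, UwbHom.compl₂]
    exact not_congr (by rw [h₃]))
  obtain ⟨hm₁, hm₂⟩ := Splitting.glueMap_inj hm
  let ρ : FB.fin₂ x y ⟶ FB.fin₂ x' y' := (ρ₁, ρ₂)
  have hh : h = FB.toUwbOrd.map ρ ≫ h' := UwbHom.ext hρ₁.symm hρ₂.symm h₃
  have e₁ : f₁' = f₁ ≫ FB.toUbOrd.map ρ.1 := by
    refine UbHom.ext ?_ ?_
    -- Both the map and the pairs of `f₁'` are determined after the injection `h'`, which can be
    -- cancelled.
    · refine (UwbHom.inj₁ h').comp_left (hm₁.symm.trans ?_)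
      exact congrArg (· ∘ UbHom.map f₁) hρ₁.symm
    · refine (List.map_injective_iff.2
        ((UwbHom.inj₁ h').prodMap (UwbHom.inj₁ h'))) (h₁.symm.trans ?_)
      change (UbHom.pairs f₁).map (Prod.map (UwbHom.map₁ h) (UwbHom.map₁ h)) =
        ((UbHom.pairs f₁).map (Prod.map ρ₁ ρ₁) ++ []).map _
      rw [List.append_nil, ← hρ₁]
      exact (List.map_map (f := Prod.map ρ₁ ρ₁)
        (g := Prod.map (UwbHom.map₁ h') (UwbHom.map₁ h'))).symm
  have e₂ : f₂' = f₂ ≫ FB.toUbOrd.map ρ.2 := by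
    refine UbHom.ext ?_ ?_
    · refine (UwbHom.inj₂ h').comp_left (hm₂.symm.trans ?_)
      exact congrArg (· ∘ UbHom.map f₂) hρ₂.symm
    · refine (List.map_injective_iff.2
        ((UwbHom.inj₂ h').prodMap (UwbHom.inj₂ h'))) (h₂.symm.trans ?_)
      change (UbHom.pairs f₂).map (Prod.map (UwbHom.map₂ h) (UwbHom.map₂ h)) =
        ((UbHom.pairs f₂).map (Prod.map ρ₂ ρ₂) ++ []).map _
      rw [List.append_nil, ← hρ₂]
      exact (List.map_map (f := Prod.map ρ₂ ρ₂)
        (g := Prod.map (UwbHom.map₂ h') (UwbHom.map₂ h'))).symm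
  exact ⟨x, y, x', y', c, f₁, f₂, ρ, h', by rw [hh], by rw [e₁, e₂]⟩

/-- The middle objects are forced: they consist of the points of `Y₁` and `Y₂` that lie in no mixed
pair. The part `U₁` is the preimage of `Y₁`, and the walled morphism is the inclusion together with
the mixed pairs. What remains of `f` lands in the middle objects. -/
theorem exists_hom_eq (f : FB.toUbOrd.obj U ⟶ Y.sum) (l : List (Y.fst × Y.fst))
    (m : List (Y.snd × Y.snd)) (n : List (Y.fst × Y.snd))
    (hf : UbHom.pairs f = joinPairs l m n) : ∃ t : Dec U Y, t.hom = f := by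
  have hc := UbHom.compl f
  have hnd := UbHom.nodup f
  rw [hf] at hc hnd
  obtain ⟨hnd₁, hnd₂⟩ := (nodup_points_joinPairs _ _ _).1 hnd
  have hc₁ (a : Y.fst) : Sum.inl a ∈ Set.range (UbHom.map f) ↔
      a ∉ points l ∧ a ∉ n.map Prod.fst := by
    rw [hc, inl_mem_points_joinPairs, not_or]
  have hc₂ (b : Y.snd) : Sum.inr b ∈ Set.range (UbHom.map f) ↔
      b ∉ points m ∧ b ∉ n.map Prod.snd := by
    rw [hc, inr_mem_points_joinPairs, not_or]
  let X₁ := {a : Y.fst // a ∉ n.map Prod.fst}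
  let X₂ := {b : Y.snd // b ∉ n.map Prod.snd}
  let e₁ : X₁ ≃ Fin (Nat.card X₁) := Finite.equivFin X₁
  let e₂ : X₂ ≃ Fin (Nat.card X₂) := Finite.equivFin X₂
  let h : UwbHom ⟨FB.fin (Nat.card X₁), FB.fin (Nat.card X₂)⟩ Y :=
    { map₁ := fun i => (e₁.symm i).1
      map₂ := fun i => (e₂.symm i).1
      pairs := n
      inj₁ := Subtype.val_injective.comp e₁.symm.injective
      inj₂ := Subtype.val_injective.comp e₂.symm.injective
      nodup₁ := (List.nodup_append'.1 hnd₁).2.1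
      nodup₂ := (List.nodup_append'.1 hnd₂).2.1
      compl₁ := fun y => ⟨by rintro ⟨i, rfl⟩; exact (e₁.symm i).2,
        fun hy => ⟨e₁ ⟨y, hy⟩, by simp⟩⟩
      compl₂ := fun y => ⟨by rintro ⟨i, rfl⟩; exact (e₂.symm i).2,
        fun hy => ⟨e₂ ⟨y, hy⟩, by simp⟩⟩ }
  let c : Splitting U := fun u => Sum.isLeft (UbHom.map f u)
  have hg₁ (u : c.part true) : ∃ i, UbHom.map f u.1 = Sum.inl (h.map₁ i) := by
    obtain ⟨a, ha⟩ := Sum.isLeft_iff.1 u.2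
    obtain ⟨i, rfl⟩ := (h.compl₁ a).2 ((hc₁ a).1 ⟨_, ha⟩).2
    exact ⟨i, ha⟩
  have hg₂ (u : c.part false) : ∃ i, UbHom.map f u.1 = Sum.inr (h.map₂ i) := by
    have hu : Sum.isLeft (UbHom.map f u.1) = false := u.2
    obtain ⟨b, hb⟩ := Sum.isRight_iff.1 (Sum.isLeft_eq_false.1 hu)
    obtain ⟨i, rfl⟩ := (h.compl₂ b).2 ((hc₂ b).1 ⟨_, hb⟩).2
    exact ⟨i, hb⟩
  choose g₁ hg₁ using hg₁
  choose g₂ hg₂ using hg₂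
  -- No point occurs twice, so the pairs of `l` avoid the mixed points and lift to the middle
  -- object.
  have hl : ∃ l' : List (_ × _), l'.map (Prod.map h.map₁ h.map₁) = l := by
    have : l ∈ Set.range (List.map (Prod.map h.map₁ h.map₁)) := by
      rw [Set.range_list_map]
      rintro ⟨a, b⟩ hp
      have ha := (h.compl₁ a).2 fun ha => (List.nodup_append'.1 hnd₁).2.2
        (mem_points.2 ⟨_, hp, Or.inl rfl⟩) ha
      have hb := (h.compl₁ b).2 fun hb => (List.nodup_append'.1 hnd₁).2.2
        (mem_points.2 ⟨_, hp, Or.inr rfl⟩) hb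
      obtain ⟨i, rfl⟩ := ha
      obtain ⟨j, rfl⟩ := hb
      exact ⟨(i, j), rfl⟩
    exact this
  have hm : ∃ m' : List (_ × _), m'.map (Prod.map h.map₂ h.map₂) = m := by
    have : m ∈ Set.range (List.map (Prod.map h.map₂ h.map₂)) := by
      rw [Set.range_list_map]
      rintro ⟨a, b⟩ hp
      have ha := (h.compl₂ a).2 fun ha => (List.nodup_append'.1 hnd₂).2.2
        (mem_points.2 ⟨_, hp, Or.inl rfl⟩) ha
      have hb := (h.compl₂ b).2 fun hb => (List.nodup_append'.1 hnd₂).2.2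
        (mem_points.2 ⟨_, hp, Or.inr rfl⟩) hb
      obtain ⟨i, rfl⟩ := ha
      obtain ⟨j, rfl⟩ := hb
      exact ⟨(i, j), rfl⟩
    exact this
  obtain ⟨l', hl⟩ := hl
  obtain ⟨m', hm⟩ := hm
  rw [← hl, points_map] at hc₁ hnd₁
  rw [← hm, points_map] at hc₂ hnd₂
  let f₁ : UbHom (c.part true) (FB.fin (Nat.card X₁)) :=
    { map := g₁
      pairs := l'
      inj := fun u v huv => Subtype.ext (UbHom.inj f (by rw [hg₁, hg₁, huv]))
      nodup := (List.nodup_append'.1 hnd₁).1.of_map _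
      compl := fun i => by
        rw [← List.mem_map_of_injective h.inj₁]
        have := hc₁ (h.map₁ i)
        rw [and_iff_left ((h.compl₁ _).1 ⟨i, rfl⟩)] at this
        rw [← this]
        constructor
        · rintro ⟨u, rfl⟩
          exact ⟨u.1, hg₁ u⟩
        · rintro ⟨u, hu⟩
          have hcu : c u = true := by simp [c, hu]
          refine ⟨⟨u, hcu⟩, h.inj₁ (Sum.inl_injective ((hg₁ ⟨u, hcu⟩).symm.trans hu))⟩ }
  let f₂ : UbHom (c.part false) (FB.fin (Nat.card X₂)) :=
    { map := g₂
      pairs := m'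
      inj := fun u v huv => Subtype.ext (UbHom.inj f (by rw [hg₂, hg₂, huv]))
      nodup := (List.nodup_append'.1 hnd₂).1.of_map _
      compl := fun i => by
        rw [← List.mem_map_of_injective h.inj₂]
        have := hc₂ (h.map₂ i)
        rw [and_iff_left ((h.compl₂ _).1 ⟨i, rfl⟩)] at this
        rw [← this]
        constructor
        · rintro ⟨u, rfl⟩
          exact ⟨u.1, hg₂ u⟩
        · rintro ⟨u, hu⟩
          have hcu : c u = false := by simp [c, hu]
          refine ⟨⟨u, hcu⟩, h.inj₂ (Sum.inr_injective ((hg₂ ⟨u, hcu⟩).symm.trans hu))⟩ }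
  refine ⟨⟨_, _, c, f₁, f₂, h⟩, UbHom.ext ?_ ?_⟩
  · refine (hom_map _).trans (funext fun u => ?_)
    cases hu : c u
    · exact (Splitting.glueMap_false _ _ hu).trans (hg₂ ⟨u, hu⟩).symm
    · exact (Splitting.glueMap_true _ _ hu).trans (hg₁ ⟨u, hu⟩).symm
  · exact (hom_pairs _).trans (Eq.trans (congrArg₂ (joinPairs · · n) hl hm) hf.symm)

end Dec

end Dec


/-! ### Linear maps on the morphisms to a disjoint union -/

section DecLinear

variable {k : Type u} [Field k] {δ ε : ℤˣ} {U : FB} {Y : UwbOrd}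

theorem points_flip_perm {α : Type} (a b : List (α × α)) (p : α × α) :
    (points (a ++ p.swap :: b)).Perm (points (a ++ p :: b)) := by
  rw [points_append, points_append]
  exact (List.Perm.swap _ _ _).append_left _

theorem cons_joinPairs_perm₂ {A B : Type} (l : List (A × A)) (m : List (B × B))
    (n : List (A × B)) (p : B × B) :
    (Prod.map Sum.inr Sum.inr p :: joinPairs l m n).Perm (joinPairs l (p :: m) n) :=
  List.perm_middle.symm

theorem cons_joinPairs_perm₃ {A B : Type} (l : List (A × A)) (m : List (B × B))
    (n : List (A × B)) (p : A × B) :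
    (Prod.map Sum.inl Sum.inr p :: joinPairs l m n).Perm (joinPairs l m (p :: n)) := by
  rw [joinPairs, joinPairs, List.map_cons, ← List.append_assoc, ← List.append_assoc]
  exact List.perm_middle.symm

/-- A permutation is a sequence of adjacent exchanges, each a defining relation. The fixed prefix
`a` makes the induction pass through the `cons` case. The scalar stays unspecified because only
spanning is deduced from this. -/
theorem exists_cls_perm {A B : UbOrd} {L L' : List (B.set × B.set)} (h : L.Perm L')
    (a : List (B.set × B.set)) (f : A ⟶ B) (hf : UbHom.pairs f = a ++ L) :
    ∃ (g : A ⟶ B) (c : k), UbHom.pairs g = a ++ L' ∧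
      (Twisted.cls f : Twisted.Hom (ubTwistRel k δ ε) A B) = c • Twisted.cls g := by
  induction h generalizing a f with
  | nil => exact ⟨f, 1, hf, (one_smul _ _).symm⟩
  | cons x _ ih =>
    obtain ⟨g, c, h1, h2⟩ := ih (a ++ [x]) f (by simpa using hf)
    exact ⟨g, c, by simpa using h1, h2⟩
  | swap x y l =>
    have hp : (a ++ x :: y :: l).Perm (UbHom.pairs f) := by
      rw [hf]
      exact (List.Perm.swap _ _ _).append_left _
    refine ⟨UbHom.rearrange f _ (points_perm hp), sgn k ε, rfl, ?_⟩
    exact Twisted.cls_rel (T := ubTwistRel k δ ε) (.swap a l y x rfl hf rfl)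
  | trans _ _ ih₁ ih₂ =>
    obtain ⟨g, c, h1, h2⟩ := ih₁ a f hf
    obtain ⟨g', c', h1', h2'⟩ := ih₂ a g h1
    exact ⟨g', c * c', h1', by rw [h2, h2', smul_smul]⟩

/-- The tail is sorted behind the head; then the head moves into its own block, after a reversal if
it goes from the second summand to the first. -/
theorem exists_cls_joinPairs (L : List (Y.sum.set × Y.sum.set)) (a : List (Y.sum.set × Y.sum.set))
    (f : FB.toUbOrd.obj U ⟶ Y.sum) (hf : UbHom.pairs f = a ++ L) :
    ∃ (l : List (Y.fst × Y.fst)) (m : List (Y.snd × Y.snd)) (n : List (Y.fst × Y.snd))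
      (g : FB.toUbOrd.obj U ⟶ Y.sum) (c : k), UbHom.pairs g = a ++ joinPairs l m n ∧
      (Twisted.cls f : Twisted.Hom (ubTwistRel k δ ε) _ _) = c • Twisted.cls g := by
  induction L generalizing a f with
  | nil => exact ⟨[], [], [], f, 1, hf, (one_smul _ _).symm⟩
  | cons p L ih =>
    obtain ⟨l, m, n, g, c, h1, h2⟩ := ih (a ++ [p]) f (by simpa using hf)
    rw [List.append_assoc, List.singleton_append] at h1
    obtain ⟨s | t, s' | t'⟩ := p
    · exact ⟨(s, s') :: l, m, n, g, c, h1, h2⟩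
    · obtain ⟨g', c', h3, h4⟩ := exists_cls_perm (δ := δ) (ε := ε) (k := k)
        (cons_joinPairs_perm₃ l m n (s, t')) a g h1
      exact ⟨l, m, (s, t') :: n, g', c * c', h3, by rw [h2, h4, smul_smul]⟩
    · have hp := points_flip_perm a (joinPairs l m n) (Sum.inr t, Sum.inl s')
      obtain ⟨g', c', h3, h4⟩ := exists_cls_perm (δ := δ) (ε := ε) (k := k)
        (cons_joinPairs_perm₃ l m n (s', t)) a (UbHom.rearrange g _ (h1 ▸ hp)) rfl
      have h5 : (Twisted.cls g : Twisted.Hom (ubTwistRel k δ ε) _ _) =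
          sgn k δ • Twisted.cls (UbHom.rearrange g _ (h1 ▸ hp)) :=
        Twisted.cls_rel (T := ubTwistRel k δ ε) (.flip a _ _ rfl h1 rfl)
      exact ⟨l, m, (s', t) :: n, g', c * (sgn k δ * c'), h3,
        by rw [h2, h5, ← smul_smul, ← smul_smul]; exact congrArg (c • sgn k δ • ·) h4⟩
    · obtain ⟨g', c', h3, h4⟩ := exists_cls_perm (δ := δ) (ε := ε) (k := k)
        (cons_joinPairs_perm₂ l m n (t, t')) a g h1
      exact ⟨l, (t, t') :: m, n, g', c * c', h3, by rw [h2, h4, smul_smul]⟩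

/-- Hence the composites of decompositions span, and by `Dec.hom_ext` a linear map is determined by
its values at them. -/
theorem Dec.exists_cls_eq (f : FB.toUbOrd.obj U ⟶ Y.sum) :
    ∃ (t : Dec U Y) (c : k),
      (Twisted.cls f : Twisted.Hom (ubTwistRel k δ ε) _ _) = c • Twisted.cls t.hom := by
  obtain ⟨l, m, n, g, c, h1, h2⟩ := exists_cls_joinPairs (δ := δ) (ε := ε) (k := k) (UbHom.pairs f) [] f rfl
  obtain ⟨t, rfl⟩ := Dec.exists_hom_eq g l m n h1
  exact ⟨t, c, h2⟩

variable {V : Type*} [AddCommGroup V] [Module k V]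

theorem Dec.hom_ext {φ ψ : Twisted.Hom (ubTwistRel k δ ε) (FB.toUbOrd.obj U) Y.sum →ₗ[k] V}
    (h : ∀ t : Dec U Y, φ (Twisted.cls t.hom) = ψ (Twisted.cls t.hom)) : φ = ψ := by
  refine Twisted.hom_ext fun f => ?_
  obtain ⟨t, c, ht⟩ := Dec.exists_cls_eq (k := k) (δ := δ) (ε := ε) f
  rw [ht, map_smul, map_smul, h]

variable (k δ ε) in
/-- Functions of decompositions that behave like the values of a linear map at the composites. -/
structure Dec.IsCompatible (Ψ : Dec U Y → V) : Prop where
  left : ∀ {x y : ℕ} {c : Splitting U}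
    {f f' : FB.toUbOrd.obj (c.part true) ⟶ FB.toUbOrd.obj (FB.fin x)}
    (g : FB.toUbOrd.obj (c.part false) ⟶ FB.toUbOrd.obj (FB.fin y))
    (h : FB.toUwbOrd.obj (FB.fin₂ x y) ⟶ Y) {a : k}, (ubTwistRel k δ ε).rel f f' a →
    Ψ ⟨x, y, c, f, g, h⟩ = a • Ψ ⟨x, y, c, f', g, h⟩
  right : ∀ {x y : ℕ} {c : Splitting U}
    (f : FB.toUbOrd.obj (c.part true) ⟶ FB.toUbOrd.obj (FB.fin x))
    {g g' : FB.toUbOrd.obj (c.part false) ⟶ FB.toUbOrd.obj (FB.fin y)}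
    (h : FB.toUwbOrd.obj (FB.fin₂ x y) ⟶ Y) {a : k}, (ubTwistRel k δ ε).rel g g' a →
    Ψ ⟨x, y, c, f, g, h⟩ = a • Ψ ⟨x, y, c, f, g', h⟩
  wall : ∀ {x y : ℕ} {c : Splitting U}
    (f : FB.toUbOrd.obj (c.part true) ⟶ FB.toUbOrd.obj (FB.fin x))
    (g : FB.toUbOrd.obj (c.part false) ⟶ FB.toUbOrd.obj (FB.fin y))
    {h h' : FB.toUwbOrd.obj (FB.fin₂ x y) ⟶ Y} {a : k}, (uwbTwistRel k ε).rel h h' a →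
    Ψ ⟨x, y, c, f, g, h⟩ = a • Ψ ⟨x, y, c, f, g, h'⟩
  middle : ∀ {x y x' y' : ℕ} {c : Splitting U}
    (f : FB.toUbOrd.obj (c.part true) ⟶ FB.toUbOrd.obj (FB.fin x))
    (g : FB.toUbOrd.obj (c.part false) ⟶ FB.toUbOrd.obj (FB.fin y))
    (ρ : FB.fin₂ x y ⟶ FB.fin₂ x' y') (h : FB.toUwbOrd.obj (FB.fin₂ x' y') ⟶ Y),
    Ψ ⟨x, y, c, f, g, FB.toUwbOrd.map ρ ≫ h⟩ =
      Ψ ⟨x', y', c, f ≫ FB.toUbOrd.map ρ.1, g ≫ FB.toUbOrd.map ρ.2, h⟩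

/-- The values of a linear map at the composites are compatible. -/
theorem Dec.isCompatible_cls
    (φ : Twisted.Hom (ubTwistRel k δ ε) (FB.toUbOrd.obj U) Y.sum →ₗ[k] V) :
    Dec.IsCompatible k δ ε fun t : Dec U Y => φ (Twisted.cls t.hom) where
  left {x y c f f'} g h a H := by
    rw [← map_smul]
    refine congrArg _ (Twisted.cls_rel (T := ubTwistRel k δ ε) ?_)
    exact (ubTwistRel k δ ε).postcomp (UwbOrd.sumHom h) (f := c.glueHom f g)
      (g := c.glueHom f' g) (Splitting.glue_rel_left H g)
  right {x y c} f {g g'} h a H := by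
    rw [← map_smul]
    refine congrArg _ (Twisted.cls_rel (T := ubTwistRel k δ ε) ?_)
    exact (ubTwistRel k δ ε).postcomp (UwbOrd.sumHom h) (f := c.glueHom f g)
      (g := c.glueHom f g') (Splitting.glue_rel_right f H)
  wall {x y c} f g {h h'} a H := by
    rw [← map_smul]
    refine congrArg _ (Twisted.cls_rel (T := ubTwistRel k δ ε) ?_)
    exact (ubTwistRel k δ ε).precomp (c.glueHom f g) (uwbTwist_sumHom H)
  middle {x y x' y' c} f g ρ h := by
    refine congrArg _ (congrArg _ ?_)
    change c.glueHom f g ≫ UwbOrd.sumHom (FB.toUwbOrd.map ρ ≫ h) =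
      c.glueHom (f ≫ FB.toUbOrd.map ρ.1) (g ≫ FB.toUbOrd.map ρ.2) ≫ UwbOrd.sumHom h
    rw [UwbOrd.sumHom_comp, ← Category.assoc, Splitting.glueHom_comp]

/-- The decompositions with given underlying map and lists of pairs. -/
structure Dec.HasData (t : Dec U Y) (μ : U → Y.fst ⊕ Y.snd) (l : List (Y.fst × Y.fst))
    (m : List (Y.snd × Y.snd)) (n : List (Y.fst × Y.snd)) : Prop where
  map : UbHom.map t.hom = μ
  pairs₁ : t.pairs₁ = l
  pairs₂ : t.pairs₂ = m
  pairs₃ : UwbHom.pairs t.h = n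

open Classical in
/-- The value of a function at a decomposition with given data (`0` if there is none). -/
def Dec.valueAt (Ψ : Dec U Y → V) (μ : U → Y.fst ⊕ Y.snd) (l : List (Y.fst × Y.fst))
    (m : List (Y.snd × Y.snd)) (n : List (Y.fst × Y.snd)) : V :=
  if h : ∃ t : Dec U Y, t.HasData μ l m n then Ψ h.choose else 0

variable {Ψ : Dec U Y → V}

/-- Equal data leave only a bijection of the middle objects free, and the `middle` condition makes
`Ψ` insensitive to it. This makes the choice in `Dec.valueAt` harmless. -/
theorem Dec.IsCompatible.eq_of_hasData (hΨ : Dec.IsCompatible k δ ε Ψ) {t t' : Dec U Y}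
    {μ : U → Y.fst ⊕ Y.snd} {l : List (Y.fst × Y.fst)} {m : List (Y.snd × Y.snd)}
    {n : List (Y.fst × Y.snd)} (h : t.HasData μ l m n) (h' : t'.HasData μ l m n) :
    Ψ t = Ψ t' := by
  obtain ⟨x, y, x', y', c, f, g, ρ, w, rfl, rfl⟩ := t.exists_eq_of_hom_map_eq t'
    (h.map.trans h'.map.symm) (h.pairs₁.trans h'.pairs₁.symm) (h.pairs₂.trans h'.pairs₂.symm)
    (h.pairs₃.trans h'.pairs₃.symm)
  exact hΨ.middle f g ρ w

theorem Dec.IsCompatible.valueAt_eq (hΨ : Dec.IsCompatible k δ ε Ψ) {t : Dec U Y}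
    {μ : U → Y.fst ⊕ Y.snd} {l : List (Y.fst × Y.fst)} {m : List (Y.snd × Y.snd)}
    {n : List (Y.fst × Y.snd)} (h : t.HasData μ l m n) : Dec.valueAt Ψ μ l m n = Ψ t := by
  have h' : ∃ t : Dec U Y, t.HasData μ l m n := ⟨t, h⟩
  rw [Dec.valueAt, dif_pos h']
  exact hΨ.eq_of_hasData h'.choose_spec h

/-- The converse hypothesis `h'` takes care of the default value: if no decomposition has the first
data, none has the second, and both sides vanish. -/
theorem Dec.IsCompatible.valueAt_rel (hΨ : Dec.IsCompatible k δ ε Ψ)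
    {μ : U → Y.fst ⊕ Y.snd} {l l' : List (Y.fst × Y.fst)} {m m' : List (Y.snd × Y.snd)}
    {n n' : List (Y.fst × Y.snd)} {a : k}
    (h : ∀ t : Dec U Y, t.HasData μ l m n → ∃ t' : Dec U Y, t'.HasData μ l' m' n' ∧ Ψ t = a • Ψ t')
    (h' : ∀ t : Dec U Y, t.HasData μ l' m' n' → ∃ t' : Dec U Y, t'.HasData μ l m n) :
    Dec.valueAt Ψ μ l m n = a • Dec.valueAt Ψ μ l' m' n' := by
  by_cases H : ∃ t : Dec U Y, t.HasData μ l m n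
  · obtain ⟨t, ht⟩ := H
    obtain ⟨t', ht', e⟩ := h t ht
    rw [hΨ.valueAt_eq ht, hΨ.valueAt_eq ht', e]
  · have H' : ¬ ∃ t : Dec U Y, t.HasData μ l' m' n' := fun ⟨t, ht⟩ => H (h' t ht)
    rw [Dec.valueAt, Dec.valueAt, dif_neg H, dif_neg H', smul_zero]

/-- The pairs inside `Y₁` are the images of those of `f₁`, so the exchange is performed upstream on
`f₁`, where the `left` condition applies. The next lemmas treat the reversals and the other two
blocks alike, with `right` for `f₂` and `wall` for `h`. -/
theorem Dec.IsCompatible.exists_swap₁ (hΨ : Dec.IsCompatible k δ ε Ψ)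
    {μ : U → Y.fst ⊕ Y.snd} (a b : List (Y.fst × Y.fst)) (p q : Y.fst × Y.fst)
    {m : List (Y.snd × Y.snd)} {n : List (Y.fst × Y.snd)} (t : Dec U Y)
    (ht : t.HasData μ (a ++ p :: q :: b) m n) :
    ∃ t' : Dec U Y, t'.HasData μ (a ++ q :: p :: b) m n ∧ Ψ t = sgn k ε • Ψ t' := by
  obtain ⟨x, y, c, f, g, h⟩ := t
  obtain ⟨h0, h1, h2, h3⟩ := ht
  obtain ⟨a', b₁, hf, ha, hb₁⟩ := List.map_eq_append_iff.1 h1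
  obtain ⟨p', b₂, e₁, hp, hb₂⟩ := List.map_eq_cons_iff.1 hb₁
  obtain ⟨q', b', e₂, hq, hb⟩ := List.map_eq_cons_iff.1 hb₂
  rw [e₁, e₂] at hf
  refine ⟨⟨x, y, c, UbHom.rearrange f (a' ++ q' :: p' :: b') (points_perm (hf ▸ (List.Perm.swap _ _ _).append_left _)), g, h⟩,
    ⟨h0, ?_, h2, h3⟩, hΨ.left g h (.swap a' b' p' q' rfl hf rfl)⟩
  refine (List.map_append (l₁ := a')).trans ?_
  rw [List.map_cons, List.map_cons]
  exact congrArg₂ _ ha (congrArg₂ _ hq (congrArg₂ _ hp hb))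

theorem Dec.IsCompatible.exists_flip₁ (hΨ : Dec.IsCompatible k δ ε Ψ)
    {μ : U → Y.fst ⊕ Y.snd} (a b : List (Y.fst × Y.fst)) (p : Y.fst × Y.fst)
    {m : List (Y.snd × Y.snd)} {n : List (Y.fst × Y.snd)} (t : Dec U Y)
    (ht : t.HasData μ (a ++ p :: b) m n) :
    ∃ t' : Dec U Y, t'.HasData μ (a ++ p.swap :: b) m n ∧ Ψ t = sgn k δ • Ψ t' := by
  obtain ⟨x, y, c, f, g, h⟩ := t
  obtain ⟨h0, h1, h2, h3⟩ := ht
  obtain ⟨a', b₁, hf, ha, hb₁⟩ := List.map_eq_append_iff.1 h1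
  obtain ⟨p', b', e₁, hp, hb⟩ := List.map_eq_cons_iff.1 hb₁
  rw [e₁] at hf
  refine ⟨⟨x, y, c, UbHom.rearrange f (a' ++ p'.swap :: b') (hf ▸ points_flip_perm _ _ _), g, h⟩,
    ⟨h0, ?_, h2, h3⟩, hΨ.left g h (.flip a' b' p' rfl hf rfl)⟩
  refine (List.map_append (l₁ := a')).trans ?_
  rw [List.map_cons]
  exact congrArg₂ _ ha (congrArg₂ _ (congrArg Prod.swap hp) hb)

theorem Dec.IsCompatible.exists_swap₂ (hΨ : Dec.IsCompatible k δ ε Ψ)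
    {μ : U → Y.fst ⊕ Y.snd} (a b : List (Y.snd × Y.snd)) (p q : Y.snd × Y.snd)
    {l : List (Y.fst × Y.fst)} {n : List (Y.fst × Y.snd)} (t : Dec U Y)
    (ht : t.HasData μ l (a ++ p :: q :: b) n) :
    ∃ t' : Dec U Y, t'.HasData μ l (a ++ q :: p :: b) n ∧ Ψ t = sgn k ε • Ψ t' := by
  obtain ⟨x, y, c, f, g, h⟩ := t
  obtain ⟨h0, h1, h2, h3⟩ := ht
  obtain ⟨a', b₁, hf, ha, hb₁⟩ := List.map_eq_append_iff.1 h2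
  obtain ⟨p', b₂, e₁, hp, hb₂⟩ := List.map_eq_cons_iff.1 hb₁
  obtain ⟨q', b', e₂, hq, hb⟩ := List.map_eq_cons_iff.1 hb₂
  rw [e₁, e₂] at hf
  refine ⟨⟨x, y, c, f, UbHom.rearrange g (a' ++ q' :: p' :: b') (points_perm (hf ▸ (List.Perm.swap _ _ _).append_left _)), h⟩,
    ⟨h0, h1, ?_, h3⟩, hΨ.right f h (.swap a' b' p' q' rfl hf rfl)⟩
  refine (List.map_append (l₁ := a')).trans ?_
  rw [List.map_cons, List.map_cons]
  exact congrArg₂ _ ha (congrArg₂ _ hq (congrArg₂ _ hp hb))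

theorem Dec.IsCompatible.exists_flip₂ (hΨ : Dec.IsCompatible k δ ε Ψ)
    {μ : U → Y.fst ⊕ Y.snd} (a b : List (Y.snd × Y.snd)) (p : Y.snd × Y.snd)
    {l : List (Y.fst × Y.fst)} {n : List (Y.fst × Y.snd)} (t : Dec U Y)
    (ht : t.HasData μ l (a ++ p :: b) n) :
    ∃ t' : Dec U Y, t'.HasData μ l (a ++ p.swap :: b) n ∧ Ψ t = sgn k δ • Ψ t' := by
  obtain ⟨x, y, c, f, g, h⟩ := t
  obtain ⟨h0, h1, h2, h3⟩ := ht
  obtain ⟨a', b₁, hf, ha, hb₁⟩ := List.map_eq_append_iff.1 h2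
  obtain ⟨p', b', e₁, hp, hb⟩ := List.map_eq_cons_iff.1 hb₁
  rw [e₁] at hf
  refine ⟨⟨x, y, c, f, UbHom.rearrange g (a' ++ p'.swap :: b') (hf ▸ points_flip_perm _ _ _), h⟩,
    ⟨h0, h1, ?_, h3⟩, hΨ.right f h (.flip a' b' p' rfl hf rfl)⟩
  refine (List.map_append (l₁ := a')).trans ?_
  rw [List.map_cons]
  exact congrArg₂ _ ha (congrArg₂ _ (congrArg Prod.swap hp) hb)

theorem Dec.IsCompatible.exists_swap₃ (hΨ : Dec.IsCompatible k δ ε Ψ)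
    {μ : U → Y.fst ⊕ Y.snd} (a b : List (Y.fst × Y.snd)) (p q : Y.fst × Y.snd)
    {l : List (Y.fst × Y.fst)} {m : List (Y.snd × Y.snd)} (t : Dec U Y)
    (ht : t.HasData μ l m (a ++ p :: q :: b)) :
    ∃ t' : Dec U Y, t'.HasData μ l m (a ++ q :: p :: b) ∧ Ψ t = sgn k ε • Ψ t' := by
  obtain ⟨x, y, c, f, g, h⟩ := t
  obtain ⟨h0, h1, h2, h3⟩ := ht
  have hp : (a ++ q :: p :: b).Perm (UwbHom.pairs h) := by
    rw [show UwbHom.pairs h = _ from h3]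
    exact (List.Perm.swap _ _ _).append_left _
  let h' : FB.toUwbOrd.obj (FB.fin₂ x y) ⟶ Y :=
    show UwbHom _ _ from
    { map₁ := UwbHom.map₁ h
      map₂ := UwbHom.map₂ h
      pairs := a ++ q :: p :: b
      inj₁ := UwbHom.inj₁ h
      inj₂ := UwbHom.inj₂ h
      nodup₁ := (hp.map _).nodup_iff.2 (UwbHom.nodup₁ h)
      nodup₂ := (hp.map _).nodup_iff.2 (UwbHom.nodup₂ h)
      compl₁ := fun y => (UwbHom.compl₁ h y).trans (not_congr (hp.map _).mem_iff.symm)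
      compl₂ := fun y => (UwbHom.compl₂ h y).trans (not_congr (hp.map _).mem_iff.symm) }
  exact ⟨⟨x, y, c, f, g, h'⟩, ⟨h0, h1, h2, rfl⟩, hΨ.wall f g (.swap a b p q rfl rfl h3 rfl)⟩

/-- Exchanges and reversals are involutions, so the same existence lemmas supply the converse
hypothesis of `Dec.IsCompatible.valueAt_rel`. -/
theorem Dec.IsCompatible.isTwisted (hΨ : Dec.IsCompatible k δ ε Ψ) (μ : U → Y.fst ⊕ Y.snd) :
    IsTwisted (sgn k ε) (sgn k δ) (Dec.valueAt Ψ μ) where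
  swap₁ a b p q _ _ := hΨ.valueAt_rel (fun t => hΨ.exists_swap₁ a b p q t)
    fun t ht => (hΨ.exists_swap₁ a b q p t ht).imp fun _ h => h.1
  flip₁ a b p _ _ := hΨ.valueAt_rel (fun t => hΨ.exists_flip₁ a b p t)
    fun t ht => (hΨ.exists_flip₁ a b p.swap t ht).imp fun _ h => h.1
  swap₂ a b p q _ _ := hΨ.valueAt_rel (fun t => hΨ.exists_swap₂ a b p q t)
    fun t ht => (hΨ.exists_swap₂ a b q p t ht).imp fun _ h => h.1
  flip₂ a b p _ _ := hΨ.valueAt_rel (fun t => hΨ.exists_flip₂ a b p t)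
    fun t ht => (hΨ.exists_flip₂ a b p.swap t ht).imp fun _ h => h.1
  swap₃ a b p q _ _ := hΨ.valueAt_rel (fun t => hΨ.exists_swap₃ a b p q t)
    fun t ht => (hΨ.exists_swap₃ a b q p t ht).imp fun _ h => h.1

/-- A compatible function of decompositions is given by a linear map. -/
theorem Dec.IsCompatible.exists_linearMap (hΨ : Dec.IsCompatible k δ ε Ψ) :
    ∃ φ : Twisted.Hom (ubTwistRel k δ ε) (FB.toUbOrd.obj U) Y.sum →ₗ[k] V,
      ∀ t : Dec U Y, φ (Twisted.cls t.hom) = Ψ t := by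
  -- The value at an arbitrary morphism is obtained by sorting its pairs with signs and reading `Ψ`
  -- at the sorted data; the relations hold because sorting transforms correctly under exchanges and
  -- reversals.
  refine ⟨Twisted.desc (fun f => sortPairs (sgn k ε) (sgn k δ) (UbHom.pairs f)
    (Dec.valueAt Ψ (UbHom.map f))) ?_, fun t => ?_⟩
  · rintro f g _ (⟨l₁, l₂, p, q, h1, h2, h3⟩ | ⟨l₁, l₂, p, h1, h2, h3⟩)
    · rw [h1, h2, h3]
      exact (hΨ.isTwisted _).sortPairs_swap (sgn_mul_self ε) _ _ _ _
    · rw [h1, h2, h3]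
      exact (hΨ.isTwisted _).sortPairs_flip (sgn_mul_self δ) _ _ _
  · rw [Twisted.desc_cls, Dec.hom_pairs]
    exact (sortPairs_sorted _ _ _ _).trans (hΨ.valueAt_eq ⟨rfl, rfl, rfl, rfl⟩)

end DecLinear


/-! ### Tensor products as spaces of natural transformations -/

section SumToHom

variable {k : Type u} [Field k] {G : Type*} [Groupoid G] [∀ x y : G, Fintype (x ⟶ y)]
  {P : Gᵒᵖ ⥤ ModuleCat.{u} k} {Q V : G ⥤ ModuleCat.{u} k} (e : DualPairing P V)

theorem Tens.toHom_of_isEmpty {x y : G} (h : IsEmpty (y ⟶ x)) (z : Tens P Q x) :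
    Tens.toHom e Q x y z = 0 := by
  suffices Tens.toHom e Q x y = 0 by rw [this, LinearMap.zero_apply]
  refine Tens.ext fun p q => LinearMap.ext fun v => ?_
  rw [Tens.toHom_mk, Fintype.sum_empty]
  rfl

/-- In characteristic zero every natural family of linear maps supported on the isomorphism class
of `x` comes from the tensor product at `x`. -/
theorem Tens.exists_toHom_eq [CharZero k] (x : G) [FiniteDimensional k (V.obj x)]
    (φ : ∀ y, V.obj y →ₗ[k] Q.obj y)
    (hφ : ∀ {y y' : G} (ρ : y ⟶ y') (v : V.obj y),
      φ y' ((V.map ρ).hom v) = (Q.map ρ).hom (φ y v))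
    (h0 : ∀ y, IsEmpty (y ⟶ x) → φ y = 0) :
    ∃ z : Tens P Q x, ∀ y, Tens.toHom e Q x y z = φ y := by
  obtain ⟨z, hz⟩ := Tens.exists_toHom e (Q := Q) x (φ x)
  refine ⟨(Fintype.card (x ⟶ x) : k)⁻¹ • z, fun y => ?_⟩
  rcases isEmpty_or_nonempty (y ⟶ x) with h | ⟨⟨σ⟩⟩
  · rw [h0 y h, Tens.toHom_of_isEmpty e h]
  · refine LinearMap.ext fun v => ?_
    rw [map_smul, LinearMap.smul_apply, hz, inv_smul_eq_iff₀ (card_aut_ne_zero (k := k) x)]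
    have h1 (ρ : y ⟶ x) : (Q.map (Groupoid.inv ρ)).hom (φ x ((V.map ρ).hom v)) = φ y v := by
      rw [hφ, ← LinearMap.comp_apply, ← ModuleCat.hom_comp, ← Functor.map_comp,
        Groupoid.comp_inv, CategoryTheory.Functor.map_id]
      rfl
    rw [Finset.sum_congr rfl fun ρ _ => h1 ρ, Finset.sum_const, Finset.card_univ,
      ← Nat.cast_smul_eq_nsmul k]
    -- Once an isomorphism `σ : y ⟶ x` exists, the isomorphisms `y ⟶ x` are as many as the
    -- automorphisms of `x`, the number divided out in the witness.
    refine congrArg (fun n : ℕ => (n : k) • φ y v) (Fintype.card_congr ?_)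
    exact ((Groupoid.isoEquivHom y x).symm σ).homFromEquiv

variable {I : Type*} [DecidableEq I] (s : I → G)

/-- The linear maps from `V(y)` to `Q(y)` given by an element of a sum of tensor products. -/
def Tens.sumToHom (Q : G ⥤ ModuleCat.{u} k) (y : G) :
    (⨁ i, Tens P Q (s i)) →ₗ[k] V.obj y →ₗ[k] Q.obj y :=
  DirectSum.toModule k I _ fun i => Tens.toHom e Q (s i) y

theorem Tens.sumToHom_lof (y : G) (i : I) (z : Tens P Q (s i)) :
    Tens.sumToHom e s Q y (DirectSum.lof k I (fun i => Tens P Q (s i)) i z) =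
      Tens.toHom e Q (s i) y z :=
  DirectSum.toModule_lof _ _ _

theorem Tens.sumToHom_act {y y' : G} (ρ : y ⟶ y') (z : ⨁ i, Tens P Q (s i)) (v : V.obj y) :
    Tens.sumToHom e s Q y' z ((V.map ρ).hom v) = (Q.map ρ).hom (Tens.sumToHom e s Q y z v) := by
  suffices LinearMap.lcomp k _ (V.map ρ).hom ∘ₗ Tens.sumToHom e s Q y' =
      LinearMap.compRight k (Q.map ρ).hom ∘ₗ Tens.sumToHom e s Q y from
    LinearMap.congr_fun (LinearMap.congr_fun this z) v
  refine DirectSum.linearMap_ext _ fun i => LinearMap.ext fun z => LinearMap.ext fun v => ?_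
  change Tens.sumToHom e s Q y' (DirectSum.lof k I (fun i => Tens P Q (s i)) i z)
      ((V.map ρ).hom v) =
    (Q.map ρ).hom (Tens.sumToHom e s Q y (DirectSum.lof k I (fun i => Tens P Q (s i)) i z) v)
  rw [Tens.sumToHom_lof, Tens.sumToHom_lof, Tens.toHom_act]

/-- The objects `s j` are pairwise non-isomorphic, so evaluation at `s i` sees only the component of
index `i`. -/
theorem Tens.sumToHom_apply_self (hs : ∀ i j, Nonempty (s i ⟶ s j) → i = j) (i : I)
    (z : ⨁ i, Tens P Q (s i)) :
    Tens.sumToHom e s Q (s i) z = Tens.toHom e Q (s i) (s i) (z i) := by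
  suffices Tens.sumToHom e s Q (s i) = Tens.toHom e Q (s i) (s i) ∘ₗ
      DirectSum.component k I (fun i => Tens P Q (s i)) i from LinearMap.congr_fun this z
  refine DirectSum.linearMap_ext _ fun j => LinearMap.ext fun z => ?_
  rw [LinearMap.comp_apply, LinearMap.comp_apply, LinearMap.comp_apply, Tens.sumToHom_lof]
  by_cases h : j = i
  · subst h
    rw [DirectSum.component.lof_self]
  · rw [DirectSum.component.of, dif_neg h, map_zero,
      Tens.toHom_of_isEmpty e (not_nonempty_iff.1 fun h' => h (hs i j h').symm)]

theorem Tens.eq_zero_of_sumToHom [CharZero k] (hs : ∀ i j, Nonempty (s i ⟶ s j) → i = j)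
    [∀ i, FiniteDimensional k (V.obj (s i))] (z : ⨁ i, Tens P Q (s i))
    (h : ∀ i, Tens.sumToHom e s Q (s i) z = 0) : z = 0 := by
  refine DFinsupp.ext fun i => Tens.toHom_injective e (s i) ?_
  rw [← Tens.sumToHom_apply_self e s hs, h]
  exact (map_zero _).symm

/-- In characteristic zero every natural family of linear maps supported on finitely many of the
isomorphism classes of the objects `s i` comes from the sum of the tensor products. -/
theorem Tens.exists_sumToHom_eq [CharZero k] (hs : ∀ i j, Nonempty (s i ⟶ s j) → i = j)
    [∀ i, FiniteDimensional k (V.obj (s i))] (φ : ∀ y, V.obj y →ₗ[k] Q.obj y)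
    (hφ : ∀ {y y' : G} (ρ : y ⟶ y') (v : V.obj y),
      φ y' ((V.map ρ).hom v) = (Q.map ρ).hom (φ y v))
    (J : Finset I) (h0 : ∀ y, (∀ i ∈ J, IsEmpty (y ⟶ s i)) → φ y = 0) :
    ∃ z : ⨁ i, Tens P Q (s i), ∀ y, Tens.sumToHom e s Q y z = φ y := by
  classical
  -- The restriction of `φ` to the isomorphism class of `s i` is still natural, and is realised at
  -- `s i` alone. The finite set `J` ensures that the pieces add up to an element of the direct sum.
  have h1 (i : I) : ∃ z : Tens P Q (s i), ∀ y,
      Tens.toHom e Q (s i) y z = if Nonempty (y ⟶ s i) then φ y else 0 := by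
    refine Tens.exists_toHom_eq e (s i) (fun y => if Nonempty (y ⟶ s i) then φ y else 0)
      (fun {y y'} ρ v => ?_) (fun y h => if_neg (not_nonempty_iff.2 h))
    have : Nonempty (y ⟶ s i) ↔ Nonempty (y' ⟶ s i) :=
      ⟨fun ⟨σ⟩ => ⟨Groupoid.inv ρ ≫ σ⟩, fun ⟨σ⟩ => ⟨ρ ≫ σ⟩⟩
    by_cases h : Nonempty (y ⟶ s i)
    · rw [if_pos h, if_pos (this.1 h), hφ]
    · rw [if_neg h, if_neg (this.not.1 h), LinearMap.zero_apply, LinearMap.zero_apply, map_zero]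
  choose z hz using h1
  refine ⟨∑ i ∈ J, DirectSum.lof k I (fun i => Tens P Q (s i)) i (z i), fun y => ?_⟩
  rw [map_sum, Finset.sum_congr rfl fun i _ => (Tens.sumToHom_lof e s y i (z i)).trans (hz i y)]
  by_cases h : ∃ i ∈ J, Nonempty (y ⟶ s i)
  · obtain ⟨i, hi, ⟨σ⟩⟩ := h
    rw [Finset.sum_eq_single_of_mem i hi, if_pos ⟨σ⟩]
    rintro j - hj
    exact if_neg fun ⟨τ⟩ => hj (hs i j ⟨Groupoid.inv σ ≫ τ⟩).symm
  · push Not at h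
    rw [h0 y fun i hi => h i hi]
    exact Finset.sum_eq_zero fun i _ => ite_self _

end SumToHom

/-! ### Finiteness -/

section Finite

instance (A B : FB) : Finite (UbHom A B) := by
  have := Fintype.ofFinite B
  classical
  refine Finite.of_injective (β := (A → B) × {l : List B // l.Nodup})
    (fun f => (f.map, ⟨points f.pairs, f.nodup⟩)) fun f g h => ?_
  exact UbHom.ext (congrArg Prod.fst h)
    (points_injective (congrArg (fun x => x.2.1) h))

instance (X Y : UwbOrd) : Finite (UwbHom X Y) := by
  have := Fintype.ofFinite Y.fst
  have := Fintype.ofFinite Y.snd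
  classical
  refine Finite.of_injective
    (β := (X.fst → Y.fst) × (X.snd → Y.snd) × {l : List (Y.fst × Y.snd) // l.Nodup})
    (fun f => (f.map₁, f.map₂, ⟨f.pairs, f.nodup₁.of_map _⟩)) fun f g h => ?_
  exact UwbHom.ext (congrArg Prod.fst h) (congrArg (fun x => x.2.1) h)
    (congrArg (fun x => x.2.2.1) h)

instance (A B : UbOrd) : Finite (A ⟶ B) := inferInstanceAs (Finite (UbHom A.set B.set))

instance (X Y : UwbOrd) : Finite (X ⟶ Y) := inferInstanceAs (Finite (UwbHom X Y))

instance {k : Type u} [Field k] {C : Type w} [Category.{0} C] (T : TwistRel k C) (X Y : C)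
    [Finite (X ⟶ Y)] : FiniteDimensional k (Twisted.Hom T X Y) :=
  inferInstance

end Finite


/-! ### The component at a disjoint union -/

section WallProj

variable {k : Type u} [Field k]

/-- The decomposition of `Y₁ ⊔ Y₂` into `Y₁` and `Y₂`. -/
abbrev UwbOrd.IsLeft {Y : UwbOrd} (c : Splitting Y.sum.set) : Prop :=
  (∀ a, c (Sum.inl a) = true) ∧ ∀ b, c (Sum.inr b) = false

instance (Y : UwbOrd) : DecidableEq (Splitting Y.sum.set) := Classical.decEq _

/-- The bijections between `Y₁`, `Y₂` and the parts of the decomposition of `Y₁ ⊔ Y₂`. -/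
def UwbOrd.toParts {Y : UwbOrd} (c : Splitting Y.sum.set) (hc : UwbOrd.IsLeft c) :
    (Y.fst, Y.snd) ⟶ ((c.part true, c.part false) : FB × FB) :=
  (Equiv.ofBijective (fun a => ⟨Sum.inl a, hc.1 a⟩)
      ⟨fun a b h => Sum.inl_injective (congrArg Subtype.val h), by
        rintro ⟨a | b, h⟩
        · exact ⟨a, rfl⟩
        · rw [hc.2] at h
          cases h⟩,
    Equiv.ofBijective (fun b => ⟨Sum.inr b, hc.2 b⟩)
      ⟨fun a b h => Sum.inr_injective (congrArg Subtype.val h), by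
        rintro ⟨a | b, h⟩
        · rw [hc.1] at h
          cases h
        · exact ⟨b, rfl⟩⟩)

/-- The bijections `UwbOrd.toParts` as a walled morphism. -/
def UwbOrd.toPartsHom {Y : UwbOrd} (c : Splitting Y.sum.set) (hc : UwbOrd.IsLeft c) :
    Y ⟶ (c.parts : UwbOrd) := FB.toUwbOrd.map (UwbOrd.toParts c hc)

open Classical in
/-- The component at the decomposition of `Y₁ ⊔ Y₂` into `Y₁` and `Y₂`. -/
def WallSum.proj (M : UwbOrdᵒᵖ ⥤ ModuleCat.{u} k) (Y : UwbOrd) :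
    WallSum M Y.sum.set →ₗ[k] M.obj (op Y) :=
  DirectSum.toModule k _ _ fun c =>
    if hc : UwbOrd.IsLeft c then (M.map (UwbOrd.toPartsHom c hc).op).hom else 0

theorem WallSum.proj_lof (M : UwbOrdᵒᵖ ⥤ ModuleCat.{u} k) (Y : UwbOrd)
    (c : Splitting Y.sum.set) (hc : UwbOrd.IsLeft c) (x : M.obj (op c.parts)) :
    WallSum.proj M Y (DirectSum.lof k (Splitting Y.sum.set) (fun c => M.obj (op c.parts)) c x) =
      (M.map (UwbOrd.toPartsHom c hc).op).hom x := by
  rw [WallSum.proj, DirectSum.toModule_lof, dif_pos hc]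

theorem WallSum.proj_lof_of_not (M : UwbOrdᵒᵖ ⥤ ModuleCat.{u} k) (Y : UwbOrd)
    (c : Splitting Y.sum.set) (hc : ¬ UwbOrd.IsLeft c) (x : M.obj (op c.parts)) :
    WallSum.proj M Y (DirectSum.lof k (Splitting Y.sum.set) (fun c => M.obj (op c.parts)) c x) =
      0 := by
  rw [WallSum.proj, DirectSum.toModule_lof, dif_neg hc, LinearMap.zero_apply]

theorem UwbOrd.isWalled_sumHom {Y Z : UwbOrd} (h : Y ⟶ Z) (c : Splitting Z.sum.set)
    (hc : UwbOrd.IsLeft c) : UbHom.IsWalled (UwbOrd.sumHom h) c := by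
  intro p hp
  obtain ⟨q, -, rfl⟩ := List.mem_map.1 hp
  exact ⟨hc.1 _, hc.2 _⟩

theorem UwbOrd.isLeft_pull {Y Z : UwbOrd} (h : Y ⟶ Z) (c : Splitting Z.sum.set)
    (hc : UwbOrd.IsLeft c) : UwbOrd.IsLeft (Y := Y) (c.pull (UbHom.map (UwbOrd.sumHom h))) :=
  ⟨fun _ => hc.1 _, fun _ => hc.2 _⟩

/-- A point of the target lies either in the image of `h`, where the pulled back decomposition
decides, or in a pair of `h`, where walledness decides. So no other summand can be carried into the
standard one. -/
theorem UwbOrd.isLeft_of_pull {Y Z : UwbOrd} (h : Y ⟶ Z) (c : Splitting Z.sum.set)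
    (hw : UbHom.IsWalled (UwbOrd.sumHom h) c)
    (hc : UwbOrd.IsLeft (Y := Y) (c.pull (UbHom.map (UwbOrd.sumHom h)))) : UwbOrd.IsLeft c := by
  constructor
  · intro a
    by_cases ha : a ∈ Set.range (UwbHom.map₁ h)
    · obtain ⟨a, rfl⟩ := ha
      exact hc.1 a
    · rw [UwbHom.compl₁, not_not] at ha
      obtain ⟨q, hq, rfl⟩ := List.mem_map.1 ha
      exact (hw (Sum.inl q.1, Sum.inr q.2) (List.mem_map.2 ⟨q, hq, rfl⟩)).1
  · intro a
    by_cases ha : a ∈ Set.range (UwbHom.map₂ h)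
    · obtain ⟨a, rfl⟩ := ha
      exact hc.2 a
    · rw [UwbHom.compl₂, not_not] at ha
      obtain ⟨q, hq, rfl⟩ := List.mem_map.1 ha
      exact (hw (Sum.inl q.1, Sum.inr q.2) (List.mem_map.2 ⟨q, hq, rfl⟩)).2

theorem UwbOrd.toPartsHom_wall {Y Z : UwbOrd} (h : Y ⟶ Z) (c : Splitting Z.sum.set)
    (hc : UwbOrd.IsLeft c) :
    UwbOrd.toPartsHom _ (UwbOrd.isLeft_pull h c hc) ≫
      (show (Splitting.parts (c.pull (UbHom.map (UwbOrd.sumHom h))) : UwbOrd) ⟶ c.parts from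
        UbHom.wall (UwbOrd.sumHom h) c (UwbOrd.isWalled_sumHom h c hc)) =
      h ≫ UwbOrd.toPartsHom c hc := by
  refine UwbHom.ext rfl rfl ?_
  refine Eq.trans (List.nil_append _) (Eq.trans ?_ (List.append_nil _).symm)
  refine (List.pmap_map _).trans ?_
  exact List.pmap_eq_map (f := fun q : Z.fst × Z.snd =>
    ((⟨Sum.inl q.1, hc.1 _⟩, ⟨Sum.inr q.2, hc.2 _⟩) : c.part true × c.part false)) _

/-- The component at a disjoint union is natural for walled morphisms. -/
theorem WallSum.proj_map (M : UwbOrdᵒᵖ ⥤ ModuleCat.{u} k) {Y Z : UwbOrd} (h : Y ⟶ Z)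
    (x : WallSum M Z.sum.set) :
    WallSum.proj M Y (WallSum.map M (UwbOrd.sumHom h) x) =
      (M.map h.op).hom (WallSum.proj M Z x) := by
  suffices WallSum.proj M Y ∘ₗ WallSum.map M (UwbOrd.sumHom h) =
    (M.map h.op).hom ∘ₗ WallSum.proj M Z from LinearMap.congr_fun this x
  refine DirectSum.linearMap_ext _ fun c => LinearMap.ext fun x => ?_
  change WallSum.proj M Y (WallSum.map M (UwbOrd.sumHom h) (DirectSum.lof k (Splitting Z.sum.set)
      (fun c => M.obj (op c.parts)) c x)) =
    (M.map h.op).hom (WallSum.proj M Z (DirectSum.lof k (Splitting Z.sum.set)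
      (fun c => M.obj (op c.parts)) c x))
  by_cases hc : UwbOrd.IsLeft c
  · have hw := UwbOrd.isWalled_sumHom h c hc
    rw [WallSum.proj_lof M Z c hc]
    refine (congrArg (WallSum.proj M Y) (WallSum.map_lof M (UwbOrd.sumHom h) c hw x)).trans ?_
    refine (WallSum.proj_lof M Y _ (UwbOrd.isLeft_pull h c hc) _).trans ?_
    rw [← LinearMap.comp_apply, ← LinearMap.comp_apply, ← ModuleCat.hom_comp,
      ← ModuleCat.hom_comp, ← M.map_comp, ← M.map_comp, ← op_comp, ← op_comp]
    exact congrArg (fun f => (M.map (Quiver.Hom.op f)).hom x) (UwbOrd.toPartsHom_wall h c hc)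
  · rw [WallSum.proj_lof_of_not M Z c hc, map_zero]
    -- A non-standard summand is killed either by the action, when the pairs are not walled for it,
    -- or by the projection, when it lands in another non-standard summand.
    by_cases hw : UbHom.IsWalled (UwbOrd.sumHom h) c
    · refine (congrArg (WallSum.proj M Y) (WallSum.map_lof M (UwbOrd.sumHom h) c hw x)).trans ?_
      exact WallSum.proj_lof_of_not M Y _ (fun h' => hc (UwbOrd.isLeft_of_pull h c hw h')) _
    · refine (congrArg (WallSum.proj M Y)
        (WallSum.map_lof_of_not M (UwbOrd.sumHom h) c hw x)).trans (map_zero _)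

theorem WallSum.proj_lmap {M M' : UwbOrdᵒᵖ ⥤ ModuleCat.{u} k} (θ : M ⟶ M') (Y : UwbOrd)
    (x : WallSum M Y.sum.set) :
    WallSum.proj M' Y
        (DirectSum.lmap (fun c : Splitting Y.sum.set => (θ.app (op c.parts)).hom) x) =
      (θ.app (op Y)).hom (WallSum.proj M Y x) := by
  suffices WallSum.proj M' Y ∘ₗ
      DirectSum.lmap (fun c : Splitting Y.sum.set => (θ.app (op c.parts)).hom) =
    (θ.app (op Y)).hom ∘ₗ WallSum.proj M Y from LinearMap.congr_fun this x
  refine DirectSum.linearMap_ext _ fun c => LinearMap.ext fun x => ?_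
  simp only [LinearMap.comp_apply, DirectSum.lmap_lof]
  by_cases hc : UwbOrd.IsLeft c
  · rw [WallSum.proj_lof M Y c hc, WallSum.proj_lof M' Y c hc]
    exact congrArg (fun φ => φ.hom x) (θ.naturality (UwbOrd.toPartsHom c hc).op).symm
  · rw [WallSum.proj_lof_of_not M Y c hc, WallSum.proj_lof_of_not M' Y c hc, map_zero]

end WallProj

/-! ### The action of morphisms with at most one pair -/

section DJ

variable {k : Type u} [Field k] {δ ε : ℤˣ} (F : OpMod k (KUwb k ε))

/-- The action of the directed category on `⨁_{X = X₁ ⊔ X₂} F(X₁, X₂)`, extended linearly. -/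
def WallSum.mapLinear (A B : UbOrd) : Twisted.Hom (dirTwistRel k ε) A B →ₗ[k]
    WallSum (Twisted.restr F.obj) B.set →ₗ[k] WallSum (Twisted.restr F.obj) A.set :=
  Twisted.desc (fun f => WallSum.map (Twisted.restr F.obj) f) fun f g a h => by
    obtain rfl : a = sgn k ε := by cases h; rfl
    exact WallSum.map_twist F.property f g h

theorem WallSum.mapLinear_cls {A B : UbOrd} (f : A ⟶ B) :
    WallSum.mapLinear F A B (Twisted.cls f) = WallSum.map (Twisted.restr F.obj) f :=
  Twisted.desc_cls _ _ _

theorem dJ_map {A B : UbOrd} (g : A ⟶ B) :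
    ((Twisted.restr ((dJ k δ ε).obj F).obj).map g.op).hom =
      WallSum.mapLinear F A B (flipSum (sgn k δ) (UbHom.pairs g) (clsOf ε (UbHom.map g))) := by
  have h1 : (show Twisted.Hom (dirTwistRel k ε) A B from
      (transfer k δ ε).map ((Twisted.quot (ubTwistRel k δ ε)).map g)) =
      flipSum (sgn k δ) (UbHom.pairs g) (clsOf ε (UbHom.map g)) :=
    Twisted.desc_cls (T := ubTwistRel k δ ε) _ (transferOrd_rel δ ε) g
  have h2 (a : Twisted.Hom (dirTwistRel k ε) A B) : (((upsilonPush k ε).obj F).obj.map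
      (Quiver.Hom.op (X := (⟨A⟩ : KDub k ε)) (Y := (⟨B⟩ : KDub k ε)) a)).hom =
      WallSum.mapLinear F A B a := by
    have h3 := Twisted.hom_ext (a := ModuleCat.homLinearEquiv.toLinearMap ∘ₗ
      Twisted.desc (T := dirTwistRel k ε)
        (fun f : A ⟶ B => (WallSum.functor (Twisted.restr F.obj)).map f.op)
        (WallSum.map_rel F.property)) (b := WallSum.mapLinear F A B) fun f =>
        (congrArg ModuleCat.Hom.hom (Twisted.desc_cls (T := dirTwistRel k ε) _
          (WallSum.map_rel F.property) f)).trans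
          (WallSum.mapLinear_cls F f).symm
    exact LinearMap.congr_fun h3 a
  rw [← h2, ← h1]
  rfl

/-- Without pairs the transfer has a single term. This case governs naturality for bijections, and
the next one, with the two terms of a single pair, governs the differential. -/
theorem dJ_map_of_nil {A B : UbOrd} (g : A ⟶ B) (hg : UbHom.pairs g = []) :
    ((Twisted.restr ((dJ k δ ε).obj F).obj).map g.op).hom =
      WallSum.map (Twisted.restr F.obj) g := by
  rw [dJ_map]
  have h1 : flipSum (sgn k δ) (UbHom.pairs g) (clsOf ε (UbHom.map g)) =
      (Twisted.cls g : Twisted.Hom (dirTwistRel k ε) A B) := by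
    rw [← clsOf_eq, hg]
    rfl
  rw [h1, WallSum.mapLinear_cls]

theorem dJ_map_of_singleton {A B : UbOrd} (g g' : A ⟶ B) (p : B.set × B.set)
    (hg : UbHom.pairs g = [p]) (hg' : UbHom.pairs g' = [p.swap])
    (h : UbHom.map g = UbHom.map g') :
    ((Twisted.restr ((dJ k δ ε).obj F).obj).map g.op).hom =
      WallSum.map (Twisted.restr F.obj) g + sgn k δ • WallSum.map (Twisted.restr F.obj) g' := by
  rw [dJ_map]
  have h1 : flipSum (sgn k δ) (UbHom.pairs g) (clsOf ε (UbHom.map g)) =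
      (Twisted.cls g + sgn k δ • Twisted.cls g' : Twisted.Hom (dirTwistRel k ε) A B) := by
    rw [← clsOf_eq ε g, ← clsOf_eq ε g', hg, hg', ← h]
    rfl
  rw [h1, map_add, map_smul, WallSum.mapLinear_cls, WallSum.mapLinear_cls]

end DJ


/-! ### Duals of morphism spaces -/

section HomPairing

variable {k : Type u} [Field k] {G : Type*} [Groupoid G] {C : Type w} [Category.{0} C]

/-- The covariant functor of morphisms from `A`, restricted along `ι`. -/
abbrev homFrom (T : TwistRel k C) (ι : G ⥤ C) (A : C) : G ⥤ ModuleCat.{u} k :=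
  (ι ⋙ Twisted.quot T) ⋙ (linearCoyoneda k (Twisted T)).obj (op ⟨A⟩)

/-- The dual `Hom(A, -)^♯` is dual to `Hom(A, -)`. -/
def homPairing (T : TwistRel k C) (ι : G ⥤ C) (A : C) :
    DualPairing (resRight ι (Twisted.restr ((homSharp k (Twisted T)).obj ⟨A⟩).obj))
      (homFrom T ι A) where
  equiv _ := LinearEquiv.refl k _
  equiv_map _ _ _ := rfl

/-- Composition with a fixed morphism. -/
def Twisted.postL (T : TwistRel k C) (X : C) {Y Z : C} (g : Y ⟶ Z) :
    Twisted.Hom T X Y →ₗ[k] Twisted.Hom T X Z :=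
  (Twisted.compL X Y Z).flip (Twisted.cls g)

theorem Twisted.postL_cls (T : TwistRel k C) {X Y Z : C} (f : X ⟶ Y) (g : Y ⟶ Z) :
    Twisted.postL T X g (Twisted.cls f) = Twisted.cls (f ≫ g) := Twisted.compL_cls f g

end HomPairing

/-! ### Natural functions of decompositions -/

/-- The disjoint union of two bijections. -/
def FB.sumMap {Y Z : FB × FB} (τ : Y ⟶ Z) :
    (FB.toUwbOrd.obj Y).sum.set ⟶ (FB.toUwbOrd.obj Z).sum.set :=
  Equiv.sumCongr (FB.equiv τ.1) (FB.equiv τ.2)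

theorem FB.toUbOrd_sumMap {Y Z : FB × FB} (τ : Y ⟶ Z) :
    (FB.toUbOrd.map (FB.sumMap τ) : (FB.toUwbOrd.obj Y).sum ⟶ (FB.toUwbOrd.obj Z).sum) =
      UwbOrd.sumHom (FB.toUwbOrd.map τ) :=
  UbHom.ext rfl rfl

section Natural

variable {k : Type u} [Field k] {δ ε : ℤˣ} {U : FB} {M : UwbOrdᵒᵖ ⥤ ModuleCat.{u} k}

variable (δ ε) in
/-- Families of functions of the decompositions of the morphisms from `U` to disjoint unions
`Y₁ ⊔ Y₂` with values in `M(Y₁, Y₂)`, compatible with the relations, natural for bijections and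
supported on the pairs of sets with `N` elements in total. -/
structure Dec.IsNatural (N : ℕ)
    (Ψ : ∀ Y : FB × FB, Dec U (FB.toUwbOrd.obj Y) → M.obj (op (FB.toUwbOrd.obj Y))) : Prop where
  compatible : ∀ Y, Dec.IsCompatible k δ ε (Ψ Y)
  natural : ∀ {Y Z : FB × FB} (τ : Y ⟶ Z) (t : Dec U (FB.toUwbOrd.obj Y)),
    (M.map (FB.toUwbOrd.map τ).op).hom (Ψ Z (t.comp (FB.toUwbOrd.map τ))) = Ψ Y t
  support : ∀ (Y : FB × FB) (t : Dec U (FB.toUwbOrd.obj Y)),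
    Nat.card Y.1 + Nat.card Y.2 ≠ N → Ψ Y t = 0

/-- The linear maps given by a natural family. -/
theorem Dec.IsNatural.exists_linearMap {N : ℕ}
    {Ψ : ∀ Y : FB × FB, Dec U (FB.toUwbOrd.obj Y) → M.obj (op (FB.toUwbOrd.obj Y))}
    (hΨ : Dec.IsNatural δ ε N Ψ) :
    ∃ φ : ∀ Y : FB × FB, Twisted.Hom (ubTwistRel k δ ε) (FB.toUbOrd.obj U)
        (FB.toUwbOrd.obj Y).sum →ₗ[k] M.obj (op (FB.toUwbOrd.obj Y)),
      (∀ Y (t : Dec U (FB.toUwbOrd.obj Y)), φ Y (Twisted.cls t.hom) = Ψ Y t) ∧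
      (∀ {Y Z : FB × FB} (τ : Y ⟶ Z) (f : FB.toUbOrd.obj U ⟶ (FB.toUwbOrd.obj Y).sum),
        (M.map (FB.toUwbOrd.map τ).op).hom
          (φ Z (Twisted.cls (f ≫ FB.toUbOrd.map (FB.sumMap τ)))) = φ Y (Twisted.cls f)) ∧
      ∀ Y : FB × FB, Nat.card Y.1 + Nat.card Y.2 ≠ N → φ Y = 0 := by
  choose φ hφ using fun Y => (hΨ.compatible Y).exists_linearMap
  refine ⟨φ, hφ, fun {Y Z} τ f => ?_, fun Y hY => Dec.hom_ext fun t => ?_⟩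
  · have h : (M.map (FB.toUwbOrd.map τ).op).hom ∘ₗ φ Z ∘ₗ
        Twisted.postL (ubTwistRel k δ ε) _ (UwbOrd.sumHom (FB.toUwbOrd.map τ)) = φ Y := by
      refine Dec.hom_ext fun t => ?_
      rw [LinearMap.comp_apply, LinearMap.comp_apply, Twisted.postL_cls,
        ← Dec.hom_comp, hφ, hφ, hΨ.natural]
    have h' := LinearMap.congr_fun h (Twisted.cls f)
    rw [LinearMap.comp_apply, LinearMap.comp_apply, Twisted.postL_cls] at h'
    exact h'
  · rw [hφ, hΨ.support Y t hY, LinearMap.zero_apply]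

end Natural

/-! ### Evaluation of the unwalled complex -/

section UbEval

variable {k : Type u} [Field k] {δ ε : ℤˣ} (U : FB) (F : OpMod k (KUwb k ε)) {N : ℕ}

/-- The linear maps given by an element of the degree `N` part of the complex. -/
def ubEval (X : FB) : UbTens ((ubSharp k δ ε).obj U) ((dJ k δ ε).obj F) N →ₗ[k]
    Twisted.Hom (ubTwistRel k δ (-ε)) (FB.toUbOrd.obj U) (FB.toUbOrd.obj X) →ₗ[k]
      WallSum (Twisted.restr F.obj) X :=
  Tens.toHom (homPairing (ubTwistRel k δ (-ε)) FB.toUbOrd (FB.toUbOrd.obj U))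
    (resLeft FB.toUbOrd (Twisted.restr ((dJ k δ ε).obj F).obj)) (FB.fin N) X

variable {U F}

/-- The equivariance of `Tens.toHom` for `σ⁻¹`, rewritten contravariantly: in the left action on the
module a bijection acts through its inverse. -/
theorem ubEval_act {X X' : FB} (σ : X ⟶ X')
    (z : UbTens ((ubSharp k δ ε).obj U) ((dJ k δ ε).obj F) N)
    (f : FB.toUbOrd.obj U ⟶ FB.toUbOrd.obj X) :
    WallSum.map (Twisted.restr F.obj) (FB.toUbOrd.map σ)
      (ubEval U F X' z (Twisted.cls (f ≫ FB.toUbOrd.map σ))) = ubEval U F X z (Twisted.cls f) := by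
  have h := Tens.toHom_act (homPairing (ubTwistRel k δ (-ε)) FB.toUbOrd (FB.toUbOrd.obj U))
    (Q := resLeft FB.toUbOrd (Twisted.restr ((dJ k δ ε).obj F).obj)) (FB.fin N)
    (Groupoid.inv σ) z (Twisted.cls (f ≫ FB.toUbOrd.map σ))
  refine Eq.trans ?_ (h.symm.trans ?_)
  · refine (LinearMap.congr_fun (dJ_map_of_nil (δ := δ) F (FB.toUbOrd.map σ) rfl) _).symm.trans ?_
    change _ = ((Twisted.restr ((dJ k δ ε).obj F).obj).map
      (FB.toUbOrd.map (Groupoid.inv (Groupoid.inv σ))).op).hom _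
    rfl
  · refine congrArg (ubEval U F X z) ?_
    refine (Twisted.compL_cls (f ≫ FB.toUbOrd.map σ) (FB.toUbOrd.map (Groupoid.inv σ))).trans ?_
    rw [Category.assoc, ← CategoryTheory.Functor.map_comp, Groupoid.comp_inv,
      CategoryTheory.Functor.map_id, Category.comp_id]

theorem ubEval_of_card_ne {X : FB} (h : Nat.card X ≠ N)
    (z : UbTens ((ubSharp k δ ε).obj U) ((dJ k δ ε).obj F) N) : ubEval U F X z = 0 :=
  Tens.toHom_of_isEmpty _ ⟨fun σ => h ((Nat.card_congr (FB.equiv σ)).trans (by simp))⟩ z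

theorem ubEval_injective [CharZero k] :
    Function.Injective (ubEval (N := N) (δ := δ) U F (FB.fin N)) := by
  have : FiniteDimensional k ((homFrom (ubTwistRel k δ (-ε)) FB.toUbOrd
      (FB.toUbOrd.obj U)).obj (FB.fin N)) :=
    inferInstanceAs (FiniteDimensional k (Twisted.Hom (ubTwistRel k δ (-ε)) (FB.toUbOrd.obj U)
      (FB.toUbOrd.obj (FB.fin N))))
  exact Tens.toHom_injective _ _

theorem exists_ubEval_eq [CharZero k]
    (φ : ∀ X : FB, Twisted.Hom (ubTwistRel k δ (-ε)) (FB.toUbOrd.obj U) (FB.toUbOrd.obj X) →ₗ[k]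
      WallSum (Twisted.restr F.obj) X)
    (hφ : ∀ {X X' : FB} (σ : X ⟶ X') (f : FB.toUbOrd.obj U ⟶ FB.toUbOrd.obj X),
      WallSum.map (Twisted.restr F.obj) (FB.toUbOrd.map σ)
        (φ X' (Twisted.cls (f ≫ FB.toUbOrd.map σ))) = φ X (Twisted.cls f))
    (h0 : ∀ X : FB, Nat.card X ≠ N → φ X = 0) :
    ∃ z : UbTens ((ubSharp k δ ε).obj U) ((dJ k δ ε).obj F) N, ∀ X, ubEval U F X z = φ X := by
  have : FiniteDimensional k ((homFrom (ubTwistRel k δ (-ε)) FB.toUbOrd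
      (FB.toUbOrd.obj U)).obj (FB.fin N)) :=
    inferInstanceAs (FiniteDimensional k (Twisted.Hom (ubTwistRel k δ (-ε)) (FB.toUbOrd.obj U)
      (FB.toUbOrd.obj (FB.fin N))))
  refine Tens.exists_toHom_eq (homPairing (ubTwistRel k δ (-ε)) FB.toUbOrd (FB.toUbOrd.obj U))
    (Q := resLeft FB.toUbOrd (Twisted.restr ((dJ k δ ε).obj F).obj)) (FB.fin N) φ
    (fun {X X'} σ => ?_) fun X hX => h0 X fun h => hX.false (Finite.equivFinOfCardEq h)
  have h : φ X' ∘ₗ Twisted.postL (ubTwistRel k δ (-ε)) _ (FB.toUbOrd.map σ) =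
      LinearMap.comp (M₂ := WallSum (Twisted.restr F.obj) X)
        (WallSum.map (Twisted.restr F.obj) (FB.toUbOrd.map (Groupoid.inv σ))) (φ X) := by
    refine Twisted.hom_ext fun f => ?_
    refine (congrArg (φ X') (Twisted.postL_cls _ f (FB.toUbOrd.map σ))).trans ?_
    refine (hφ (Groupoid.inv σ) _).symm.trans ?_
    rw [Category.assoc, ← CategoryTheory.Functor.map_comp, Groupoid.comp_inv,
      CategoryTheory.Functor.map_id, Category.comp_id]
    rfl
  intro v
  refine (LinearMap.congr_fun h v).trans ?_
  exact (LinearMap.congr_fun (dJ_map_of_nil (δ := δ) F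
    (FB.toUbOrd.map (Groupoid.inv σ)) rfl) _).symm

/-- The decomposition of a set into the disjoint union of its parts. -/
def Splitting.unsum {X : FB} (c : Splitting X) :
    (FB.toUwbOrd.obj (c.part true, c.part false)).sum.set ⟶ X :=
  Equiv.ofBijective (Sum.elim Subtype.val Subtype.val) (by
    constructor
    · rintro (⟨a, ha⟩ | ⟨a, ha⟩) (⟨b, hb⟩ | ⟨b, hb⟩) (rfl : a = b)
      · rfl
      · exact absurd (ha.symm.trans hb) (by simp)
      · exact absurd (ha.symm.trans hb) (by simp)
      · rfl
    · intro x
      cases h : c x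
      · exact ⟨Sum.inr ⟨x, h⟩, rfl⟩
      · exact ⟨Sum.inl ⟨x, h⟩, rfl⟩)

theorem Splitting.sumMap_equiv_unsum {X X' : FB} (σ : X ⟶ X') (c : Splitting X') :
    FB.sumMap (Splitting.equiv σ c) ≫ c.unsum = (c.pull (FB.equiv σ)).unsum ≫ σ := by
  refine Equiv.ext ?_
  rintro (a | a) <;> rfl

theorem Splitting.sumMap_toParts_unsum (Y : FB × FB)
    (c : Splitting (FB.toUwbOrd.obj Y).sum.set) (hc : UwbOrd.IsLeft c) :
    FB.sumMap (Y := Y) (UwbOrd.toParts c hc) ≫ c.unsum = 𝟙 (FB.toUwbOrd.obj Y).sum.set := by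
  refine Equiv.ext ?_
  rintro (a | a) <;> rfl

instance (X : FB) : Fintype (Splitting X) := Fintype.ofFinite _

instance (Y : UwbOrd) : Fintype (Splitting Y.sum.set) := Fintype.ofFinite _

variable (U F) in
/-- The values of an element of the degree `N` part of the complex at the decompositions of the
morphisms to disjoint unions. -/
def ubDecEval (z : UbTens ((ubSharp k δ ε).obj U) ((dJ k δ ε).obj F) N) (Y : FB × FB)
    (t : Dec U (FB.toUwbOrd.obj Y)) : (Twisted.restr F.obj).obj (op (FB.toUwbOrd.obj Y)) :=
  WallSum.proj (Twisted.restr F.obj) (FB.toUwbOrd.obj Y)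
    (ubEval U F (FB.toUwbOrd.obj Y).sum.set z (Twisted.cls t.hom))

/-- Compatibility is automatic for the values of a linear map at composites; naturality is that of
the projection `WallSum.proj`, and the support is a count of elements. -/
theorem isNatural_ubDecEval (z : UbTens ((ubSharp k δ ε).obj U) ((dJ k δ ε).obj F) N) :
    Dec.IsNatural δ (-ε) N (ubDecEval U F z) where
  compatible Y := Dec.isCompatible_cls (WallSum.proj (Twisted.restr F.obj) (FB.toUwbOrd.obj Y) ∘ₗ
    ubEval U F (FB.toUwbOrd.obj Y).sum.set z)
  natural {Y Z} τ t := by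
    rw [ubDecEval, ← WallSum.proj_map, Dec.hom_comp, ← FB.toUbOrd_sumMap]
    exact congrArg _ (ubEval_act (FB.sumMap τ) z t.hom)
  support Y t h := by
    rw [ubDecEval, ubEval_of_card_ne (by rwa [Nat.card_sum]), LinearMap.zero_apply, map_zero]

/-- Every natural family consists of the values of an element of the complex. -/
theorem exists_ubDecEval_eq [CharZero k]
    {Ψ : ∀ Y : FB × FB, Dec U (FB.toUwbOrd.obj Y) →
      (Twisted.restr F.obj).obj (op (FB.toUwbOrd.obj Y))}
    (hΨ : Dec.IsNatural δ (-ε) N Ψ) :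
    ∃ z : UbTens ((ubSharp k δ ε).obj U) ((dJ k δ ε).obj F) N, ubDecEval U F z = Ψ := by
  obtain ⟨φ, hφ, hnat, hsupp⟩ := hΨ.exists_linearMap
  -- The component at a decomposition `c` of `X` is obtained by identifying `X` with the disjoint
  -- union of its parts and applying the map `φ` given there; summing over all `c` gives `η`, the
  -- sought family.
  let θ (X : FB) (c : Splitting X) : Twisted.Hom (ubTwistRel k δ (-ε)) (FB.toUbOrd.obj U)
      (FB.toUbOrd.obj X) →ₗ[k] (Twisted.restr F.obj).obj (op c.parts) :=
    φ (c.part true, c.part false) ∘ₗ Twisted.postL (ubTwistRel k δ (-ε)) _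
      (FB.toUbOrd.map (Groupoid.inv c.unsum))
  have hθ (X : FB) (c : Splitting X) (f : FB.toUbOrd.obj U ⟶ FB.toUbOrd.obj X) :
      θ X c (Twisted.cls f) = φ (c.part true, c.part false)
        (Twisted.cls (f ≫ FB.toUbOrd.map (Groupoid.inv c.unsum))) :=
    congrArg (φ (c.part true, c.part false)) (Twisted.postL_cls _ _ _)
  have hθ' {X X' : FB} (σ : X ⟶ X') (c : Splitting X')
      (f : FB.toUbOrd.obj U ⟶ FB.toUbOrd.obj X) :
      ((Twisted.restr F.obj).map (FB.toUwbOrd.map (Splitting.equiv σ c)).op).hom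
        (θ X' c (Twisted.cls (f ≫ FB.toUbOrd.map σ))) =
      θ X (c.pull (FB.equiv σ)) (Twisted.cls f) := by
    rw [hθ, hθ]
    refine Eq.trans ?_ (hnat (Splitting.equiv σ c) _)
    refine congrArg (fun f => ((Twisted.restr F.obj).map
      (FB.toUwbOrd.map (Splitting.equiv σ c)).op).hom (φ _ (Twisted.cls f))) ?_
    have h1 : FB.toUbOrd.map σ ≫ FB.toUbOrd.map (Groupoid.inv c.unsum) =
        FB.toUbOrd.map (Groupoid.inv (c.pull (FB.equiv σ)).unsum) ≫
          FB.toUbOrd.map (FB.sumMap (Splitting.equiv σ c)) := by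
      rw [← CategoryTheory.Functor.map_comp, ← CategoryTheory.Functor.map_comp]
      refine congrArg (fun ρ => FB.toUbOrd.map ρ) ?_
      rw [← cancel_mono c.unsum, Category.assoc, Category.assoc, Groupoid.inv_comp,
        Category.comp_id, Splitting.sumMap_equiv_unsum, ← Category.assoc, Groupoid.inv_comp,
        Category.id_comp]
    refine (Category.assoc _ _ _).trans ?_
    exact (congrArg (f ≫ ·) h1).trans (Category.assoc _ _ _).symm
  let η (X : FB) := ∑ c : Splitting X,
    DirectSum.lof k (Splitting X) (fun c => (Twisted.restr F.obj).obj (op c.parts)) c ∘ₗ θ X c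
  have hη (X : FB) (a : Twisted.Hom (ubTwistRel k δ (-ε)) (FB.toUbOrd.obj U) (FB.toUbOrd.obj X)) :
      η X a = ∑ c : Splitting X, DirectSum.lof k (Splitting X)
        (fun c => (Twisted.restr F.obj).obj (op c.parts)) c (θ X c a) :=
    LinearMap.sum_apply _ _ _
  have hη₁ {X X' : FB} (σ : X ⟶ X') (f : FB.toUbOrd.obj U ⟶ FB.toUbOrd.obj X) :
      WallSum.map (Twisted.restr F.obj) (FB.toUbOrd.map σ)
        (η X' (Twisted.cls (f ≫ FB.toUbOrd.map σ))) = η X (Twisted.cls f) := by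
    refine (congrArg (WallSum.map (Twisted.restr F.obj) (FB.toUbOrd.map σ))
      (hη X' _)).trans (Eq.trans ?_ (hη X _).symm)
    refine (map_sum (WallSum.map (Twisted.restr F.obj) (FB.toUbOrd.map σ)) _ _).trans ?_
    refine Fintype.sum_bijective (fun c => c.pull (FB.equiv σ))
      ((FB.equiv σ).arrowCongr (Equiv.refl Bool)).symm.bijective _ _ fun c => ?_
    refine (WallSum.map_lof _ (FB.toUbOrd.map σ) c (fun p hp => absurd hp List.not_mem_nil)
      _).trans ?_
    exact congrArg _ (hθ' σ c f)
  have hη₂ (X : FB) (hX : Nat.card X ≠ N) : η X = 0 := by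
    refine Finset.sum_eq_zero fun c _ => ?_
    have hc : φ (c.part true, c.part false) = 0 := by
      refine hsupp _ fun h => hX (Eq.trans ?_ h)
      rw [← Nat.card_sum]
      exact (Nat.card_congr (FB.equiv c.unsum)).symm
    have hθc : θ X c = 0 := LinearMap.ext fun a => LinearMap.congr_fun hc _
    rw [hθc, LinearMap.comp_zero]
  obtain ⟨z, hz⟩ := exists_ubEval_eq (F := F) (U := U) (δ := δ) (N := N) η hη₁ hη₂
  refine ⟨z, funext fun Y => funext fun t => ?_⟩
  -- The tautological decomposition of a disjoint union is the only one seen by the projection, and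
  -- its parts are identified with `Y` by `UwbOrd.toParts`.
  let c₀ : Splitting (FB.toUwbOrd.obj Y).sum.set := Sum.isLeft
  have hc₀ : UwbOrd.IsLeft c₀ := ⟨fun _ => rfl, fun _ => rfl⟩
  rw [ubDecEval, hz, ← hφ]
  refine (congrArg (WallSum.proj (Twisted.restr F.obj) (FB.toUwbOrd.obj Y))
    (hη (FB.toUwbOrd.obj Y).sum.set (Twisted.cls t.hom))).trans ?_
  rw [map_sum]
  refine (Finset.sum_eq_single c₀ ?_ fun h => absurd (Finset.mem_univ _) h).trans ?_
  · rintro c - hc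
    refine WallSum.proj_lof_of_not _ (FB.toUwbOrd.obj Y) c (fun h => hc (funext ?_)) _
    rintro (a | a)
    · exact h.1 a
    · exact h.2 a
  · refine (WallSum.proj_lof _ (FB.toUwbOrd.obj Y) c₀ hc₀ _).trans ?_
    refine Eq.trans ?_ (hnat (Y := Y) (UwbOrd.toParts c₀ hc₀) t.hom)
    refine congrArg _ ((hθ _ c₀ t.hom).trans ?_)
    refine congrArg (fun ρ => φ _ (Twisted.cls (t.hom ≫ FB.toUbOrd.map ρ))) ?_
    rw [← cancel_mono c₀.unsum, Groupoid.inv_comp]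
    exact (Splitting.sumMap_toParts_unsum Y c₀ hc₀).symm

theorem map_op_map_op {C : Type*} [Category C] (M : Cᵒᵖ ⥤ ModuleCat.{u} k) {X Y Z : C}
    (f : X ⟶ Y) (g : Y ⟶ Z) (h : X ⟶ Z) (e : f ≫ g = h) (y : M.obj (op Z)) :
    (M.map f.op).hom ((M.map g.op).hom y) = (M.map h.op).hom y := by
  rw [← e, op_comp, M.map_comp]
  rfl

/-- Every component becomes the standard one after transport along the bijection of `X` with the
disjoint union of its parts, so standard projections detect all components. -/
theorem WallSum.proj_map_unsum (M : UwbOrdᵒᵖ ⥤ ModuleCat.{u} k) {X : FB} (c : Splitting X)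
    (x : WallSum M X) :
    WallSum.proj M (FB.toUwbOrd.obj (c.part true, c.part false))
      (WallSum.map M (FB.toUbOrd.map c.unsum) x) = x c := by
  suffices h : LinearMap.comp (M₂ := WallSum M c.parts.sum.set) (WallSum.proj M c.parts)
      (WallSum.map M (FB.toUbOrd.map c.unsum)) =
      DirectSum.component k (Splitting X) (fun c => M.obj (op c.parts)) c from
    LinearMap.congr_fun h x
  refine DirectSum.linearMap_ext _ fun c' => LinearMap.ext fun y => ?_
  refine (congrArg (WallSum.proj M c.parts) (WallSum.map_lof M (FB.toUbOrd.map c.unsum) c'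
    (fun p hp => absurd hp List.not_mem_nil) y)).trans ?_
  by_cases hc : c' = c
  · subst hc
    refine Eq.trans ?_ (DirectSum.component.lof_self k
      (M := fun c : Splitting X => M.obj (op c.parts)) c' y).symm
    have hl : UwbOrd.IsLeft (Y := c'.parts) (c'.pull (FB.equiv c'.unsum)) :=
      ⟨fun a => a.2, fun a => a.2⟩
    refine (WallSum.proj_lof M c'.parts _ hl _).trans ?_
    refine (map_op_map_op M (X := c'.parts) (Y := UwbOrd.mk _ _) (Z := c'.parts) _ _ (𝟙 c'.parts)
      (UwbHom.ext rfl rfl rfl) y).trans ?_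
    exact congrArg (fun f => f.hom y) (M.map_id (op c'.parts))
  · refine (WallSum.proj_lof_of_not M c.parts _ (fun h => hc ?_) _).trans ?_
    · funext x
      cases hx : c x
      · exact h.2 ⟨x, hx⟩
      · exact h.1 ⟨x, hx⟩
    · exact (DirectSum.of_eq_of_ne (β := fun c : Splitting X => M.obj (op c.parts)) c' c y
        (Ne.symm hc)).symm

/-- An element is determined by its values at decompositions. -/
theorem ubDecEval_injective [CharZero k] :
    Function.Injective (ubDecEval (N := N) (δ := δ) U F) := by
  intro z z' h
  refine ubEval_injective (Twisted.hom_ext fun f => DFinsupp.ext fun c => ?_)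
  have h1 (z : UbTens ((ubSharp k δ ε).obj U) ((dJ k δ ε).obj F) N) :
      ubEval U F (FB.fin N) z (Twisted.cls f) c =
      WallSum.proj (Twisted.restr F.obj) (FB.toUwbOrd.obj (c.part true, c.part false))
        (ubEval U F (FB.toUwbOrd.obj (c.part true, c.part false)).sum.set z
          (Twisted.cls (f ≫ FB.toUbOrd.map (Groupoid.inv c.unsum)))) := by
    rw [← WallSum.proj_map_unsum]
    refine congrArg _ ((ubEval_act c.unsum z (f ≫ FB.toUbOrd.map (Groupoid.inv c.unsum))).symm.trans
      ?_).symm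
    rw [Category.assoc, ← CategoryTheory.Functor.map_comp, Groupoid.inv_comp,
      CategoryTheory.Functor.map_id, Category.comp_id]
  rw [h1, h1]
  -- Equality is known only at composites of decompositions; these span the morphisms to a disjoint
  -- union, so the linear maps agree.
  have h2 := Dec.hom_ext (φ := WallSum.proj (Twisted.restr F.obj)
      (FB.toUwbOrd.obj (c.part true, c.part false)) ∘ₗ ubEval U F _ z)
    (ψ := WallSum.proj (Twisted.restr F.obj)
      (FB.toUwbOrd.obj (c.part true, c.part false)) ∘ₗ ubEval U F _ z')
    fun t => congrFun (congrFun h (c.part true, c.part false)) t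
  exact LinearMap.congr_fun h2 _

end UbEval


/-! ### Equivariant families at representatives, and functoriality -/

section SumToHom

variable {k : Type u} [Field k] {G : Type*} [Groupoid G] [∀ x y : G, Fintype (x ⟶ y)]
  {P P' : Gᵒᵖ ⥤ ModuleCat.{u} k} {Q Q' V V' : G ⥤ ModuleCat.{u} k} (e : DualPairing P V)
  (e' : DualPairing P' V') {I : Type*} [DecidableEq I] (s : I → G)

/-- In characteristic zero every finite family of equivariant linear maps at the objects `s i`
comes from the sum of the tensor products. -/
theorem Tens.exists_sumToHom_apply_eq [CharZero k] (hs : ∀ i j, Nonempty (s i ⟶ s j) → i = j)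
    [∀ i, FiniteDimensional k (V.obj (s i))] (φ : ∀ i, V.obj (s i) →ₗ[k] Q.obj (s i))
    (hφ : ∀ i (ρ : s i ⟶ s i) (v : V.obj (s i)),
      φ i ((V.map ρ).hom v) = (Q.map ρ).hom (φ i v))
    (J : Finset I) (h0 : ∀ i ∉ J, φ i = 0) :
    ∃ z : ⨁ i, Tens P Q (s i), ∀ i, Tens.sumToHom e s Q (s i) z = φ i := by
  have h1 (i : I) : ∃ z : Tens P Q (s i), Tens.toHom e Q (s i) (s i) z = φ i := by
    obtain ⟨z, hz⟩ := Tens.exists_toHom e (Q := Q) (s i) (φ i)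
    refine ⟨(Fintype.card (s i ⟶ s i) : k)⁻¹ • z, LinearMap.ext fun v => ?_⟩
    rw [map_smul, LinearMap.smul_apply, hz, inv_smul_eq_iff₀ (card_aut_ne_zero (k := k) (s i))]
    have h1 (ρ : s i ⟶ s i) : (Q.map (Groupoid.inv ρ)).hom (φ i ((V.map ρ).hom v)) = φ i v := by
      rw [hφ, ← LinearMap.comp_apply, ← ModuleCat.hom_comp, ← Functor.map_comp,
        Groupoid.comp_inv, CategoryTheory.Functor.map_id]
      rfl
    rw [Finset.sum_congr rfl fun ρ _ => h1 ρ, Finset.sum_const, Finset.card_univ,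
      ← Nat.cast_smul_eq_nsmul k]
  choose z hz using h1
  refine ⟨∑ i ∈ J, DirectSum.lof k I (fun i => Tens P Q (s i)) i (z i), fun j => ?_⟩
  rw [map_sum, Finset.sum_congr rfl fun i _ => Tens.sumToHom_lof e s (s j) i (z i)]
  by_cases h : j ∈ J
  · rw [Finset.sum_eq_single_of_mem j h, hz]
    rintro i - hi
    exact Tens.toHom_of_isEmpty e (not_nonempty_iff.1 fun h' => hi (hs j i h').symm) _
  · rw [h0 j h]
    refine Finset.sum_eq_zero fun i hi => ?_
    refine Tens.toHom_of_isEmpty e (not_nonempty_iff.1 fun h' => h ?_) _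
    rwa [hs j i h']

theorem Tens.sumToHom_lmap (a : P ⟶ P') (b : Q ⟶ Q') {y : G} (θ : V'.obj y →ₗ[k] V.obj y)
    (h : ∀ (p : P.obj (op y)) (v : V'.obj y),
      e'.equiv y ((a.app (op y)).hom p) v = e.equiv y p (θ v)) (z : ⨁ i, Tens P Q (s i))
    (v : V'.obj y) :
    Tens.sumToHom e' s Q' y (DirectSum.lmap (fun i => Tens.map a b (s i)) z) v =
      (b.app y).hom (Tens.sumToHom e s Q y z (θ v)) := by
  suffices Tens.sumToHom e' s Q' y ∘ₗ DirectSum.lmap (fun i => Tens.map a b (s i)) =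
      (LinearMap.lcomp k _ θ ∘ₗ LinearMap.compRight k (b.app y).hom) ∘ₗ
        Tens.sumToHom e s Q y from LinearMap.congr_fun (LinearMap.congr_fun this z) v
  refine DirectSum.linearMap_ext _ fun i => LinearMap.ext fun z => LinearMap.ext fun v => ?_
  change Tens.sumToHom e' s Q' y (DirectSum.lmap (fun i => Tens.map a b (s i))
      (DirectSum.lof k I (fun i => Tens P Q (s i)) i z)) v =
    (b.app y).hom (Tens.sumToHom e s Q y (DirectSum.lof k I (fun i => Tens P Q (s i)) i z) (θ v))
  rw [DirectSum.lmap_lof, Tens.sumToHom_lof, Tens.sumToHom_lof, Tens.toHom_map e e' a b θ h]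

end SumToHom

/-! ### Evaluation of the walled complex -/

section UwbEval

variable {k : Type u} [Field k] {ε : ℤˣ} (A : FB × FB) (F : OpMod k (KUwb k ε)) {N : ℕ}

/-- The linear maps given by an element of the degree `N` part of the walled complex. -/
def uwbEval (Y : FB × FB) : UwbSum ((uwbSharp k ε).obj A) F N →ₗ[k]
    Twisted.Hom (uwbTwistRel k (-ε)) (FB.toUwbOrd.obj A) (FB.toUwbOrd.obj Y) →ₗ[k]
      (Twisted.restr F.obj).obj (op (FB.toUwbOrd.obj Y)) :=
  Tens.sumToHom (homPairing (uwbTwistRel k (-ε)) FB.toUwbOrd (FB.toUwbOrd.obj A))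
    (fun p : {p : ℕ × ℕ // p.1 + p.2 = N} => FB.fin₂ p.1.1 p.1.2)
    (resLeft FB.toUwbOrd (Twisted.restr F.obj)) Y

variable {A F}

theorem uwbEval_act {Y Z : FB × FB} (τ : Y ⟶ Z) (x : UwbSum ((uwbSharp k ε).obj A) F N)
    (h : FB.toUwbOrd.obj A ⟶ FB.toUwbOrd.obj Y) :
    ((Twisted.restr F.obj).map (FB.toUwbOrd.map τ).op).hom
      (uwbEval A F Z x (Twisted.cls (h ≫ FB.toUwbOrd.map τ))) =
        uwbEval A F Y x (Twisted.cls h) := by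
  have h1 := Tens.sumToHom_act
    (homPairing (uwbTwistRel k (-ε)) FB.toUwbOrd (FB.toUwbOrd.obj A))
    (fun p : {p : ℕ × ℕ // p.1 + p.2 = N} => FB.fin₂ p.1.1 p.1.2)
    (Q := resLeft FB.toUwbOrd (Twisted.restr F.obj)) (Groupoid.inv τ) x
    (Twisted.cls (h ≫ FB.toUwbOrd.map τ))
  refine Eq.trans ?_ (h1.symm.trans ?_)
  · change _ = ((Twisted.restr F.obj).map
      (FB.toUwbOrd.map (Groupoid.inv (Groupoid.inv τ))).op).hom _
    rw [Groupoid.inv_eq_inv, Groupoid.inv_eq_inv, IsIso.inv_inv]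
    rfl
  · refine congrArg (uwbEval A F Y x) ?_
    refine (Twisted.compL_cls (h ≫ FB.toUwbOrd.map τ) (FB.toUwbOrd.map (Groupoid.inv τ))).trans ?_
    rw [Category.assoc, ← CategoryTheory.Functor.map_comp, Groupoid.comp_inv,
      CategoryTheory.Functor.map_id, Category.comp_id]

theorem uwbEval_of_card_ne {Y : FB × FB} (h : Nat.card Y.1 + Nat.card Y.2 ≠ N)
    (x : UwbSum ((uwbSharp k ε).obj A) F N) : uwbEval A F Y x = 0 := by
  suffices uwbEval (N := N) A F Y = 0 by rw [this, LinearMap.zero_apply]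
  refine DirectSum.linearMap_ext _ fun p => LinearMap.ext fun z => ?_
  refine (Tens.sumToHom_lof _ _ _ _ _).trans (Tens.toHom_of_isEmpty _ ⟨fun σ => h ?_⟩ z)
  rw [Nat.card_congr (FB.equiv σ.1), Nat.card_congr (FB.equiv σ.2), Nat.card_fin, Nat.card_fin]
  exact p.2

theorem eq_of_fin₂_hom {m n m' n' : ℕ} (σ : FB.fin₂ m n ⟶ FB.fin₂ m' n') : m = m' ∧ n = n' :=
  ⟨by simpa using Nat.card_congr (FB.equiv σ.1), by simpa using Nat.card_congr (FB.equiv σ.2)⟩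

theorem uwbEval_ext [CharZero k] {x x' : UwbSum ((uwbSharp k ε).obj A) F N}
    (h : ∀ (Y : FB × FB) (h : FB.toUwbOrd.obj A ⟶ FB.toUwbOrd.obj Y),
      uwbEval A F Y x (Twisted.cls h) = uwbEval A F Y x' (Twisted.cls h)) : x = x' := by
  have (Y : FB × FB) : FiniteDimensional k ((homFrom (uwbTwistRel k (-ε)) FB.toUwbOrd
      (FB.toUwbOrd.obj A)).obj Y) :=
    inferInstanceAs (FiniteDimensional k (Twisted.Hom (uwbTwistRel k (-ε)) (FB.toUwbOrd.obj A)
      (FB.toUwbOrd.obj Y)))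
  rw [← sub_eq_zero]
  refine Tens.eq_zero_of_sumToHom
    (homPairing (uwbTwistRel k (-ε)) FB.toUwbOrd (FB.toUwbOrd.obj A))
    (fun p : {p : ℕ × ℕ // p.1 + p.2 = N} => FB.fin₂ p.1.1 p.1.2)
    (fun p q ⟨σ⟩ => Subtype.ext (Prod.ext (eq_of_fin₂_hom σ).1 (eq_of_fin₂_hom σ).2)) _ fun p => ?_
  refine (map_sub (uwbEval A F (FB.fin₂ p.1.1 p.1.2)) x x').trans (sub_eq_zero.2 ?_)
  exact Twisted.hom_ext fun f => h _ f

/-- There are finitely many `(m, n)` with `m + n = N`, so the direct sum imposes no further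
finiteness on the family. -/
theorem exists_uwbEval_eq [CharZero k]
    (φ : ∀ Y : FB × FB, Twisted.Hom (uwbTwistRel k (-ε)) (FB.toUwbOrd.obj A)
      (FB.toUwbOrd.obj Y) →ₗ[k] (Twisted.restr F.obj).obj (op (FB.toUwbOrd.obj Y)))
    (hφ : ∀ {Y Z : FB × FB} (τ : Y ⟶ Z) (h : FB.toUwbOrd.obj A ⟶ FB.toUwbOrd.obj Y),
      ((Twisted.restr F.obj).map (FB.toUwbOrd.map τ).op).hom
        (φ Z (Twisted.cls (h ≫ FB.toUwbOrd.map τ))) = φ Y (Twisted.cls h))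
    (h0 : ∀ Y : FB × FB, Nat.card Y.1 + Nat.card Y.2 ≠ N → φ Y = 0) :
    ∃ x : UwbSum ((uwbSharp k ε).obj A) F N, ∀ Y, uwbEval A F Y x = φ Y := by
  have (Y : FB × FB) : FiniteDimensional k ((homFrom (uwbTwistRel k (-ε)) FB.toUwbOrd
      (FB.toUwbOrd.obj A)).obj Y) :=
    inferInstanceAs (FiniteDimensional k (Twisted.Hom (uwbTwistRel k (-ε)) (FB.toUwbOrd.obj A)
      (FB.toUwbOrd.obj Y)))
  have : Finite {p : ℕ × ℕ // p.1 + p.2 = N} :=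
    Set.Finite.to_subtype (((Finset.range (N + 1) ×ˢ Finset.range (N + 1)).finite_toSet).subset
      fun p (hp : p.1 + p.2 = N) => by simp; omega)
  have := Fintype.ofFinite {p : ℕ × ℕ // p.1 + p.2 = N}
  refine Tens.exists_sumToHom_eq
    (homPairing (uwbTwistRel k (-ε)) FB.toUwbOrd (FB.toUwbOrd.obj A))
    (fun p : {p : ℕ × ℕ // p.1 + p.2 = N} => FB.fin₂ p.1.1 p.1.2)
    (Q := resLeft FB.toUwbOrd (Twisted.restr F.obj))
    (fun p q ⟨σ⟩ => Subtype.ext (Prod.ext (eq_of_fin₂_hom σ).1 (eq_of_fin₂_hom σ).2)) φ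
    (fun {Y Z} τ => ?_) Finset.univ fun Y hY => h0 Y fun h => ?_
  · have h : φ Z ∘ₗ Twisted.postL (uwbTwistRel k (-ε)) _ (FB.toUwbOrd.map τ) =
        ((Twisted.restr F.obj).map (FB.toUwbOrd.map (Groupoid.inv τ)).op).hom ∘ₗ φ Y := by
      refine Twisted.hom_ext fun f => ?_
      refine (congrArg (φ Z) (Twisted.postL_cls _ f (FB.toUwbOrd.map τ))).trans ?_
      refine (hφ (Groupoid.inv τ) _).symm.trans ?_
      rw [Category.assoc, ← CategoryTheory.Functor.map_comp, Groupoid.comp_inv,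
        CategoryTheory.Functor.map_id, Category.comp_id]
      rfl
    exact LinearMap.congr_fun h
  · exact (hY ⟨(Nat.card Y.1, Nat.card Y.2), h⟩ (Finset.mem_univ _)).false
      (Finite.equivFin Y.1, Finite.equivFin Y.2)

theorem uwbEval_map {A' : FB × FB} {F' : OpMod k (KUwb k ε)} (σ : A ⟶ A') (θ : F ⟶ F')
    (x : UwbSum ((uwbSharp k ε).obj A) F N) (Y : FB × FB)
    (h : FB.toUwbOrd.obj A' ⟶ FB.toUwbOrd.obj Y) :
    uwbEval A' F' Y (uwbSumMap ((uwbSharp k ε).map σ) θ N x) (Twisted.cls h) =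
      (θ.hom.app (op ⟨FB.toUwbOrd.obj Y⟩)).hom
        (uwbEval A F Y x (Twisted.cls (FB.toUwbOrd.map σ ≫ h))) := by
  have h1 := Tens.sumToHom_lmap
    (homPairing (uwbTwistRel k (-ε)) FB.toUwbOrd (FB.toUwbOrd.obj A))
    (homPairing (uwbTwistRel k (-ε)) FB.toUwbOrd (FB.toUwbOrd.obj A'))
    (fun p : {p : ℕ × ℕ // p.1 + p.2 = N} => FB.fin₂ p.1.1 p.1.2)
    (Functor.whiskerLeft FB.toUwbOrd.op (Functor.whiskerLeft (Twisted.quot _).op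
      ((uwbSharp k ε).map σ).hom))
    (Functor.whiskerLeft (invFunctor (FB × FB) ⋙ FB.toUwbOrd.op)
      (Functor.whiskerLeft (Twisted.quot _).op θ.hom)) (y := Y)
    (Twisted.compL _ _ _ (Twisted.cls (FB.toUwbOrd.map σ))) (fun _ _ => rfl) x (Twisted.cls h)
  refine h1.trans (congrArg _ (congrArg (uwbEval A F Y x) ?_))
  exact Twisted.compL_cls (FB.toUwbOrd.map σ) h

end UwbEval


/-! ### Evaluation of the image of the walled complex -/

section PhiEval

variable {k : Type u} [Field k] {δ ε : ℤˣ} (U : FB) (M : FB × FB ⥤ ModuleCat.{u} k)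

variable (k δ ε) in
/-- The covariant functor `(X, Y) ↦ ⨁_{U = U₁ ⊔ U₂} (k ub)(U₁, X) ⊗ (k ub)(U₂, Y)`. -/
abbrev splitFrom : FB × FB ⥤ ModuleCat.{u} k :=
  (ubTensorTwo k δ ε ⋙ coprodPush k).flip.obj (op U)

variable (k δ ε) in
/-- The kernel is dual to the functor `splitFrom`. -/
def phiPairing : DualPairing ((phiKernel k δ ε).obj U) (splitFrom k δ ε U) where
  equiv _ := LinearEquiv.refl k _
  equiv_map _ _ _ := rfl

variable {U} in
variable (k δ ε) in
/-- The generators of the values of `splitFrom`. -/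
def splitVec (A : FB × FB) (c : Splitting U) :
    Twisted.Hom (ubTwistRel k δ ε) (FB.toUbOrd.obj (c.part true)) (FB.toUbOrd.obj A.1) →ₗ[k]
    Twisted.Hom (ubTwistRel k δ ε) (FB.toUbOrd.obj (c.part false)) (FB.toUbOrd.obj A.2) →ₗ[k]
      (splitFrom k δ ε U).obj A :=
  (TensorProduct.mk k _ _).compr₂ (DirectSum.lof k (Splitting U) (fun c =>
    ((ubTensorTwo k δ ε).obj A).obj (op (c.part true, c.part false))) c)

theorem splitFrom_ext {A : FB × FB} {V : Type*} [AddCommGroup V] [Module k V]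
    {φ ψ : (splitFrom k δ ε U).obj A →ₗ[k] V}
    (h : ∀ (c : Splitting U) (f : FB.toUbOrd.obj (c.part true) ⟶ FB.toUbOrd.obj A.1)
      (g : FB.toUbOrd.obj (c.part false) ⟶ FB.toUbOrd.obj A.2),
      φ (splitVec k δ ε A c (Twisted.cls f) (Twisted.cls g)) =
        ψ (splitVec k δ ε A c (Twisted.cls f) (Twisted.cls g))) : φ = ψ := by
  refine DirectSum.linearMap_ext _ fun c => TensorProduct.ext ?_
  exact Twisted.hom_ext fun f => Twisted.hom_ext fun g => h c f g

/-- The universal property of a direct sum of tensor products of twisted morphism spaces, stated on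
generators; it turns functions of `(c, f₁, f₂)` into linear maps. -/
theorem splitFrom_exists {A : FB × FB} {V : Type*} [AddCommGroup V] [Module k V]
    (φ : ∀ c : Splitting U, (FB.toUbOrd.obj (c.part true) ⟶ FB.toUbOrd.obj A.1) →
      (FB.toUbOrd.obj (c.part false) ⟶ FB.toUbOrd.obj A.2) → V)
    (h₁ : ∀ (c : Splitting U) f f' g a, (ubTwistRel k δ ε).rel f f' a →
      φ c f g = a • φ c f' g)
    (h₂ : ∀ (c : Splitting U) f g g' a, (ubTwistRel k δ ε).rel g g' a →
      φ c f g = a • φ c f g') :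
    ∃ ψ : (splitFrom k δ ε U).obj A →ₗ[k] V, ∀ c f g,
      ψ (splitVec k δ ε A c (Twisted.cls f) (Twisted.cls g)) = φ c f g := by
  let χ (c : Splitting U) :
      Twisted.Hom (ubTwistRel k δ ε) (FB.toUbOrd.obj (c.part true)) (FB.toUbOrd.obj A.1) →ₗ[k]
      Twisted.Hom (ubTwistRel k δ ε) (FB.toUbOrd.obj (c.part false)) (FB.toUbOrd.obj A.2) →ₗ[k] V :=
    Twisted.desc (fun f => Twisted.desc (fun g => φ c f g) (h₂ c f)) fun f f' a h =>
      Twisted.hom_ext fun g => by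
        rw [LinearMap.smul_apply, Twisted.desc_cls, Twisted.desc_cls, h₁ c f f' g a h]
  refine ⟨DirectSum.toModule k (Splitting U) V fun c => TensorProduct.lift (χ c),
    fun c f g => ?_⟩
  refine (DirectSum.toModule_lof _ _ _).trans ?_
  change χ c (Twisted.cls f) (Twisted.cls g) = φ c f g
  exact (LinearMap.congr_fun (Twisted.desc_cls _ _ f) _).trans (Twisted.desc_cls _ _ g)

theorem splitFrom_map {A B : FB × FB} (τ : A ⟶ B) (c : Splitting U)
    (f : FB.toUbOrd.obj (c.part true) ⟶ FB.toUbOrd.obj A.1)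
    (g : FB.toUbOrd.obj (c.part false) ⟶ FB.toUbOrd.obj A.2) :
    ((splitFrom k δ ε U).map τ).hom (splitVec k δ ε A c (Twisted.cls f) (Twisted.cls g)) =
      splitVec k δ ε B c (Twisted.cls (f ≫ FB.toUbOrd.map τ.1))
        (Twisted.cls (g ≫ FB.toUbOrd.map τ.2)) := by
  refine (DirectSum.lmap_lof _ _ _).trans ?_
  refine congrArg (DirectSum.lof k (Splitting U) (fun c =>
    ((ubTensorTwo k δ ε).obj B).obj (op (c.part true, c.part false))) c) ?_
  refine (TensorProduct.map_tmul _ _ _ _).trans ?_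
  exact congrArg₂ _ (Twisted.compL_cls f _) (Twisted.compL_cls g _)

instance (A : FB × FB) : FiniteDimensional k ((splitFrom k δ ε U).obj A) :=
  inferInstanceAs (Module.Finite k (⨁ c : Splitting U,
    Twisted.Hom (ubTwistRel k δ ε) (FB.toUbOrd.obj (c.part true)) (FB.toUbOrd.obj A.1) ⊗[k]
      Twisted.Hom (ubTwistRel k δ ε) (FB.toUbOrd.obj (c.part false)) (FB.toUbOrd.obj A.2)))

variable (δ ε) in
/-- The linear maps given by an element of `Φ(M)`. -/
def phiEval (A : FB × FB) : ((phi k δ ε).obj M).obj U →ₗ[k]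
    (splitFrom k δ ε U).obj A →ₗ[k] M.obj A :=
  Tens.sumToHom (phiPairing k δ ε U) (fun p : ℕ × ℕ => FB.fin₂ p.1 p.2) M A

variable {U M}

theorem phiEval_act {A B : FB × FB} (τ : A ⟶ B) (w : ((phi k δ ε).obj M).obj U)
    (v : (splitFrom k δ ε U).obj A) :
    phiEval δ ε U M B w (((splitFrom k δ ε U).map τ).hom v) =
      (M.map τ).hom (phiEval δ ε U M A w v) :=
  Tens.sumToHom_act _ _ _ _ _

theorem phiEval_map {M' : FB × FB ⥤ ModuleCat.{u} k} (θ : M ⟶ M') (A : FB × FB)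
    (w : ((phi k δ ε).obj M).obj U) (v : (splitFrom k δ ε U).obj A) :
    phiEval δ ε U M' A ((((phi k δ ε).map θ).app U).hom w) v =
      (θ.app A).hom (phiEval δ ε U M A w v) :=
  Tens.sumToHom_lmap (phiPairing k δ ε U) (phiPairing k δ ε U)
    (fun p : ℕ × ℕ => FB.fin₂ p.1 p.2) (𝟙 _) θ LinearMap.id (fun _ _ => rfl) w v

/-- The action of `σ` on the dual kernel is the transpose of pulling back a decomposition and
precomposing with the induced bijections of its parts, as in `Dec.pull`. -/
theorem phiEval_obj_map {U' : FB} (σ : U ⟶ U') (A : FB × FB) (w : ((phi k δ ε).obj M).obj U)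
    (c : Splitting U') (f : FB.toUbOrd.obj (c.part true) ⟶ FB.toUbOrd.obj A.1)
    (g : FB.toUbOrd.obj (c.part false) ⟶ FB.toUbOrd.obj A.2) :
    phiEval δ ε U' M A ((((phi k δ ε).obj M).map σ).hom w)
        (splitVec k δ ε A c (Twisted.cls f) (Twisted.cls g)) =
      phiEval δ ε U M A w (splitVec k δ ε A (c.pull (FB.equiv σ))
        (Twisted.cls (FB.toUbOrd.map (Splitting.equiv σ c).1 ≫ f))
        (Twisted.cls (FB.toUbOrd.map (Splitting.equiv σ c).2 ≫ g))) := by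
  refine (Tens.sumToHom_lmap (phiPairing k δ ε U) (phiPairing k δ ε U')
    (fun p : ℕ × ℕ => FB.fin₂ p.1 p.2) ((phiKernel k δ ε).map σ) (𝟙 M)
    (CoprodSum.map ((ubTensorTwo k δ ε).obj A) σ) (fun _ _ => rfl) w _).trans ?_
  refine congrArg (phiEval δ ε U M A w) ?_
  refine (CoprodSum.map_lof _ _ _ _).trans ?_
  refine congrArg (DirectSum.lof k (Splitting U) (fun c =>
    ((ubTensorTwo k δ ε).obj A).obj (op (c.part true, c.part false))) (c.pull (FB.equiv σ))) ?_
  refine (TensorProduct.map_tmul _ _ _ _).trans ?_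
  exact congrArg₂ _ (Twisted.compL_cls _ f) (Twisted.compL_cls _ g)

theorem phiEval_ext [CharZero k] {w w' : ((phi k δ ε).obj M).obj U}
    (h : ∀ (x y : ℕ) (c : Splitting U) (f : FB.toUbOrd.obj (c.part true) ⟶
      FB.toUbOrd.obj (FB.fin x)) (g : FB.toUbOrd.obj (c.part false) ⟶ FB.toUbOrd.obj (FB.fin y)),
      phiEval δ ε U M (FB.fin₂ x y) w (splitVec k δ ε (FB.fin₂ x y) c (Twisted.cls f)
        (Twisted.cls g)) =
      phiEval δ ε U M (FB.fin₂ x y) w' (splitVec k δ ε (FB.fin₂ x y) c (Twisted.cls f)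
        (Twisted.cls g))) : w = w' := by
  rw [← sub_eq_zero]
  refine Tens.eq_zero_of_sumToHom (phiPairing k δ ε U)
    (fun p : ℕ × ℕ => FB.fin₂ p.1 p.2)
    (fun p q ⟨σ⟩ => Prod.ext (eq_of_fin₂_hom σ).1 (eq_of_fin₂_hom σ).2) _ fun p => ?_
  refine (map_sub (phiEval δ ε U M (FB.fin₂ p.1 p.2)) w w').trans (sub_eq_zero.2 ?_)
  exact splitFrom_ext U (h p.1 p.2)

/-- Here the index set of the direct sum is infinite, and the bound `N` leaves finitely many nonzero
components. Equivariance at the representatives is enough. -/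
theorem exists_phiEval_eq [CharZero k]
    (φ : ∀ x y : ℕ, (splitFrom k δ ε U).obj (FB.fin₂ x y) →ₗ[k] M.obj (FB.fin₂ x y))
    (hφ : ∀ x y (ρ : FB.fin₂ x y ⟶ FB.fin₂ x y) (v : (splitFrom k δ ε U).obj (FB.fin₂ x y)),
      φ x y (((splitFrom k δ ε U).map ρ).hom v) = (M.map ρ).hom (φ x y v))
    (N : ℕ) (h0 : ∀ x y, N < x ∨ N < y → φ x y = 0) :
    ∃ w : ((phi k δ ε).obj M).obj U, ∀ x y, phiEval δ ε U M (FB.fin₂ x y) w = φ x y := by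
  obtain ⟨w, hw⟩ := Tens.exists_sumToHom_apply_eq (phiPairing k δ ε U)
    (fun p : ℕ × ℕ => FB.fin₂ p.1 p.2) (Q := M)
    (fun p q ⟨σ⟩ => Prod.ext (eq_of_fin₂_hom σ).1 (eq_of_fin₂_hom σ).2) (fun p => φ p.1 p.2)
    (fun p => hφ p.1 p.2) (Finset.range (N + 1) ×ˢ Finset.range (N + 1)) fun p hp => h0 _ _ (by
      simp at hp
      omega)
  exact ⟨w, fun x y => hw (x, y)⟩

end PhiEval

/-! ### Elements of `Φ` of the walled complex as natural families -/

section UwbDecEval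

variable {k : Type u} [Field k] {δ ε : ℤˣ} (U : FB) (F : OpMod k (KUwb k ε)) {N : ℕ}

/-- The values of an element of the degree `N` part of the image of the walled complex at
decompositions. -/
def uwbDecEval (w : ((phi k δ (-ε)).obj (uwbDegree F N)).obj U) (Y : FB × FB)
    (t : Dec U (FB.toUwbOrd.obj Y)) : (Twisted.restr F.obj).obj (op (FB.toUwbOrd.obj Y)) :=
  uwbEval (N := N) (FB.fin₂ t.x t.y) F Y (phiEval δ (-ε) U (uwbDegree F N) (FB.fin₂ t.x t.y) w
    (splitVec k δ (-ε) (FB.fin₂ t.x t.y) t.c (Twisted.cls t.f₁) (Twisted.cls t.f₂)))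
    (Twisted.cls t.h)

variable {U F}

/-- The first three compatibilities express linearity in `f₁`, in `f₂` and in `h`. The `middle`
condition combines equivariance of the outer evaluation with the fact that a bijection acts on the
walled complex by precomposition. -/
theorem isNatural_uwbDecEval (w : ((phi k δ (-ε)).obj (uwbDegree F N)).obj U) :
    Dec.IsNatural δ (-ε) N (uwbDecEval U F w) where
  compatible Y :=
    { left := fun {x y c f f'} g h a H => by
        have h1 := congrArg (fun v => phiEval δ (-ε) U (uwbDegree F N) (FB.fin₂ x y) w
          (splitVec k δ (-ε) (FB.fin₂ x y) c v (Twisted.cls g))) (Twisted.cls_rel H)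
        rw [map_smul, LinearMap.smul_apply, map_smul] at h1
        exact (congrArg (fun v => uwbEval (N := N) (FB.fin₂ x y) F Y v (Twisted.cls h)) h1).trans
          (LinearMap.map_smul₂ (uwbEval (N := N) (FB.fin₂ x y) F Y) a _ _)
      right := fun {x y c} f {g g'} h a H => by
        have h1 := congrArg (fun v => phiEval δ (-ε) U (uwbDegree F N) (FB.fin₂ x y) w
          (splitVec k δ (-ε) (FB.fin₂ x y) c (Twisted.cls f) v)) (Twisted.cls_rel H)
        rw [map_smul, map_smul] at h1
        exact (congrArg (fun v => uwbEval (N := N) (FB.fin₂ x y) F Y v (Twisted.cls h)) h1).trans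
          (LinearMap.map_smul₂ (uwbEval (N := N) (FB.fin₂ x y) F Y) a _ _)
      wall := fun {x y c} f g {h h'} a H => by
        refine (congrArg _ (Twisted.cls_rel H)).trans ?_
        exact map_smul _ _ _
      middle := fun {x y x' y' c} f g ρ h => by
        have h1 := phiEval_act ρ w (splitVec k δ (-ε) (FB.fin₂ x y) c (Twisted.cls f)
          (Twisted.cls g))
        rw [splitFrom_map] at h1
        refine Eq.trans ?_ (congrArg (fun v => uwbEval (N := N) (FB.fin₂ x' y') F Y v
          (Twisted.cls h)) h1).symm
        exact (uwbEval_map ρ (𝟙 F) _ Y h).symm }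
  natural τ t := uwbEval_act τ _ t.h
  support Y t h := LinearMap.congr_fun (uwbEval_of_card_ne (N := N) h _) _

theorem uwbDecEval_injective [CharZero k] :
    Function.Injective (uwbDecEval (δ := δ) (N := N) U F) := by
  intro w w' h
  refine phiEval_ext fun x y c f g => ?_
  exact uwbEval_ext fun Y h' => congrFun (congrFun h Y) ⟨x, y, c, f, g, h'⟩

/-- The two evaluations are inverted from the inside out. For fixed `(c, f, g)` the dependence on
`h` is realised by an element `s` of the walled complex; the dependence of `s` on `(c, f, g)` is
then realised by an element of `Φ`. All identities required of `s` are checked on its values, by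
`uwbEval_ext`. -/
theorem exists_uwbDecEval_eq [CharZero k]
    {Ψ : ∀ Y : FB × FB, Dec U (FB.toUwbOrd.obj Y) →
      (Twisted.restr F.obj).obj (op (FB.toUwbOrd.obj Y))}
    (hΨ : Dec.IsNatural δ (-ε) N Ψ) :
    ∃ w : ((phi k δ (-ε)).obj (uwbDegree F N)).obj U, uwbDecEval U F w = Ψ := by
  have h1 (x y : ℕ) (c : Splitting U)
      (f : FB.toUbOrd.obj (c.part true) ⟶ FB.toUbOrd.obj (FB.fin x))
      (g : FB.toUbOrd.obj (c.part false) ⟶ FB.toUbOrd.obj (FB.fin y)) :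
      ∃ s : UwbSum ((uwbSharp k ε).obj (FB.fin₂ x y)) F N, ∀ Y h,
        uwbEval (FB.fin₂ x y) F Y s (Twisted.cls h) = Ψ Y ⟨x, y, c, f, g, h⟩ := by
    obtain ⟨s, hs⟩ := exists_uwbEval_eq (A := FB.fin₂ x y) (F := F) (N := N)
      (fun Y => Twisted.desc (fun h => Ψ Y ⟨x, y, c, f, g, h⟩)
        fun h h' a H => (hΨ.compatible Y).wall f g H)
      (fun {Y Z} τ h => by
        rw [Twisted.desc_cls, Twisted.desc_cls]
        exact hΨ.natural τ ⟨x, y, c, f, g, h⟩)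
      (fun Y hY => Twisted.hom_ext fun h => by
        rw [Twisted.desc_cls, hΨ.support Y _ hY, LinearMap.zero_apply])
    exact ⟨s, fun Y h => by rw [hs, Twisted.desc_cls]⟩
  choose s hs using h1
  have h2 (x y : ℕ) := splitFrom_exists (δ := δ) (ε := -ε) (k := k) U (A := FB.fin₂ x y)
    (fun c f g => s x y c f g)
    (fun c f f' g a H => uwbEval_ext fun Y h => by
      rw [map_smul, LinearMap.smul_apply, hs, hs, (hΨ.compatible Y).left g h H])
    (fun c f g g' a H => uwbEval_ext fun Y h => by
      rw [map_smul, LinearMap.smul_apply, hs, hs, (hΨ.compatible Y).right f h H])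
  choose φ hφ using h2
  have hφ₁ (x y : ℕ) (ρ : FB.fin₂ x y ⟶ FB.fin₂ x y)
      (v : (splitFrom k δ (-ε) U).obj (FB.fin₂ x y)) :
      φ x y (((splitFrom k δ (-ε) U).map ρ).hom v) = ((uwbDegree F N).map ρ).hom (φ x y v) := by
    suffices φ x y ∘ₗ ((splitFrom k δ (-ε) U).map ρ).hom = ((uwbDegree F N).map ρ).hom ∘ₗ φ x y from
      LinearMap.congr_fun this v
    refine splitFrom_ext (V := UwbSum ((uwbSharp k ε).obj (FB.fin₂ x y)) F N) U fun c f g => ?_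
    refine (congrArg (φ x y) (splitFrom_map U ρ c f g)).trans ((hφ x y c _ _).trans ?_)
    refine Eq.trans ?_ (congrArg (fun v => ((uwbDegree F N).map ρ).hom v) (hφ x y c f g)).symm
    refine uwbEval_ext fun Y h => ?_
    refine Eq.trans ?_ (uwbEval_map ρ (𝟙 F) (s x y c f g) Y h).symm
    refine (hs _ _ _ _ _ _ _).trans (Eq.trans ?_ (hs _ _ _ _ _ _ _).symm)
    exact ((hΨ.compatible Y).middle f g ρ h).symm
  -- A walled morphism from `(x, y)` injects both sets into the target, so a target with `N`
  -- elements in total forces `x ≤ N` and `y ≤ N`.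
  have hφ₂ (x y : ℕ) (hxy : N < x ∨ N < y) : φ x y = 0 := by
    refine splitFrom_ext (V := UwbSum ((uwbSharp k ε).obj (FB.fin₂ x y)) F N) (ψ := 0) U
      fun c f g => (hφ x y c f g).trans (uwbEval_ext fun Y h => ?_)
    refine (hs _ _ _ _ _ _ _).trans ((hΨ.support Y _ fun hY => ?_).trans
      (LinearMap.congr_fun (map_zero (uwbEval (N := N) (FB.fin₂ x y) F Y)) _).symm)
    have hx : Nat.card (Fin x) ≤ Nat.card Y.1 :=
      Nat.card_le_card_of_injective _ (UwbHom.inj₁ h)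
    have hy : Nat.card (Fin y) ≤ Nat.card Y.2 :=
      Nat.card_le_card_of_injective _ (UwbHom.inj₂ h)
    rw [Nat.card_fin] at hx hy
    omega
  obtain ⟨w, hw⟩ := exists_phiEval_eq (M := uwbDegree F N) (U := U) (δ := δ) (ε := -ε) φ hφ₁ N hφ₂
  refine ⟨w, funext fun Y => funext fun ⟨x, y, c, f, g, h⟩ => ?_⟩
  refine (congrArg (fun v => uwbEval (N := N) (FB.fin₂ x y) F Y v (Twisted.cls h))
    ((LinearMap.congr_fun (hw x y) _).trans (hφ x y c f g))).trans ?_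
  exact hs x y c f g Y h

end UwbDecEval


/-! ### Morphisms with a single pair -/

section Single

/-- Two injective parametrisations of the same set of morphisms give equal sums, with no explicit
bijection of the index sets. All the reindexing of differentials below has this form. -/
theorem sum_eq_of_range_eq {A B C V : Type*} [Fintype A] [Fintype B] [AddCommMonoid V] {a : A → C}
    {b : B → C} (ha : Function.Injective a) (hb : Function.Injective b)
    (h : Set.range a = Set.range b) (φ : C → V) : ∑ i, φ (a i) = ∑ j, φ (b j) := by
  refine Fintype.sum_equiv ((Equiv.ofInjective a ha).trans ((Equiv.setCongr h).trans
    (Equiv.ofInjective b hb).symm)) _ _ fun i => congrArg φ ?_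
  exact (Equiv.apply_ofInjective_symm hb ((Equiv.setCongr h) (Equiv.ofInjective a ha i))).symm

theorem FB.exists_toUbOrd_comp_eq {A B : FB} {Y : UbOrd} (f : FB.toUbOrd.obj A ⟶ Y)
    (g : FB.toUbOrd.obj B ⟶ Y) (h : UbHom.pairs f = UbHom.pairs g) :
    ∃ σ : A ⟶ B, FB.toUbOrd.map σ ≫ g = f := by
  obtain ⟨σ, hσ⟩ := Dec.exists_equiv_comp' (UbHom.inj f) (UbHom.inj g) (by
    ext b
    rw [UbHom.compl, UbHom.compl, h])
  exact ⟨σ, UbHom.ext hσ h.symm⟩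

theorem FB.exists_toUwbOrd_comp_eq {A B : FB × FB} {Y : UwbOrd} (f : FB.toUwbOrd.obj A ⟶ Y)
    (g : FB.toUwbOrd.obj B ⟶ Y) (h : UwbHom.pairs f = UwbHom.pairs g) :
    ∃ σ : A ⟶ B, FB.toUwbOrd.map σ ≫ g = f := by
  obtain ⟨σ₁, hσ₁⟩ := Dec.exists_equiv_comp' (UwbHom.inj₁ f) (UwbHom.inj₁ g) (by
    ext b
    rw [UwbHom.compl₁, UwbHom.compl₁, h])
  obtain ⟨σ₂, hσ₂⟩ := Dec.exists_equiv_comp' (UwbHom.inj₂ f) (UwbHom.inj₂ g) (by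
    ext b
    rw [UwbHom.compl₂, UwbHom.compl₂, h])
  exact ⟨(σ₁, σ₂), UwbHom.ext hσ₁ hσ₂ h.symm⟩

theorem FB.toUbOrd_comp_injective {A B : FB} {Y : UbOrd} (g : FB.toUbOrd.obj B ⟶ Y) {σ τ : A ⟶ B}
    (h : FB.toUbOrd.map σ ≫ g = FB.toUbOrd.map τ ≫ g) : σ = τ :=
  Equiv.ext fun a => UbHom.inj g (congrFun (congrArg UbHom.map h) a)

theorem FB.toUwbOrd_comp_injective {A B : FB × FB} {Y : UwbOrd} (g : FB.toUwbOrd.obj B ⟶ Y)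
    {σ τ : A ⟶ B} (h : FB.toUwbOrd.map σ ≫ g = FB.toUwbOrd.map τ ≫ g) : σ = τ :=
  Prod.ext (Equiv.ext fun a => UwbHom.inj₁ g (congrFun (congrArg UwbHom.map₁ h) a))
    (Equiv.ext fun a => UwbHom.inj₂ g (congrFun (congrArg UwbHom.map₂ h) a))

theorem bijective_sumElim_of_compl {A B E : Type} {f : A → B} {l : List B} {e : E → B}
    (hf : Function.Injective f) (he : Function.Injective e) (hl : ∀ b, b ∈ Set.range f ↔ b ∉ l)
    (hle : ∀ b, b ∈ l ↔ b ∈ Set.range e) : Function.Bijective (Sum.elim f e) := by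
  constructor
  · refine hf.sumElim he fun a b h => ?_
    exact (hl _).1 ⟨a, rfl⟩ ((hle _).2 ⟨b, h.symm⟩)
  · intro b
    by_cases hb : b ∈ l
    · obtain ⟨x, rfl⟩ := (hle b).1 hb
      exact ⟨Sum.inr x, rfl⟩
    · obtain ⟨x, rfl⟩ := (hl b).2 hb
      exact ⟨Sum.inl x, rfl⟩

theorem exists_equiv_of_sumElim {A B C E : Type} {f : A → B} {e : E → B} {f' : A → C} {e' : E → C}
    (h : Function.Bijective (Sum.elim f e)) (h' : Function.Bijective (Sum.elim f' e')) :
    ∃ σ : B ≃ C, (∀ a, σ (f a) = f' a) ∧ ∀ x, σ (e x) = e' x := by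
  refine ⟨(Equiv.ofBijective _ h).symm.trans (Equiv.ofBijective _ h'), fun a => ?_, fun a => ?_⟩
  · rw [Equiv.trans_apply, show f a = Equiv.ofBijective _ h (Sum.inl a) from rfl,
      Equiv.symm_apply_apply]
    rfl
  · rw [Equiv.trans_apply, show e a = Equiv.ofBijective _ h (Sum.inr a) from rfl,
      Equiv.symm_apply_apply]
    rfl

theorem UbHom.bijective_sumElim {A B : FB} (f : UbHom A B) (p : B × B) (h : f.pairs = [p]) :
    Function.Bijective (Sum.elim f.map (fun b : Bool => cond b p.1 p.2)) := by
  refine bijective_sumElim_of_compl f.inj ?_ f.compl fun b => ?_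
  · have := f.nodup
    rw [h] at this
    have hp : p.1 ≠ p.2 := by simpa [points] using this
    rintro (_ | _) (_ | _) hab
    · rfl
    · exact absurd hab.symm hp
    · exact absurd hab hp
    · rfl
  · simp [h, points, or_comm]

theorem UwbHom.bijective_sumElim₁ {X Y : UwbOrd} (f : UwbHom X Y) (p : Y.fst × Y.snd)
    (h : f.pairs = [p]) : Function.Bijective (Sum.elim f.map₁ (fun _ : Unit => p.1)) :=
  bijective_sumElim_of_compl f.inj₁ (fun _ _ _ => rfl) f.compl₁ fun b => by
    simp [h]

theorem UwbHom.bijective_sumElim₂ {X Y : UwbOrd} (f : UwbHom X Y) (p : Y.fst × Y.snd)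
    (h : f.pairs = [p]) : Function.Bijective (Sum.elim f.map₂ (fun _ : Unit => p.2)) :=
  bijective_sumElim_of_compl f.inj₂ (fun _ _ _ => rfl) f.compl₂ fun b => by
    simp [h]

/-- The target of a morphism with one pair is its source plus the two ordered points of the pair.
Two such morphisms from the same source therefore differ by exactly one bijection of the targets;
the walled version argues on each side separately. -/
theorem UbHom.range_comp_of_singleton {A : UbOrd} {B X : FB} (b : A ⟶ FB.toUbOrd.obj B)
    (q : B × B) (hb : UbHom.pairs b = [q]) :
    Function.Injective (fun σ : B ⟶ X => b ≫ FB.toUbOrd.map σ) ∧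
      Set.range (fun σ : B ⟶ X => b ≫ FB.toUbOrd.map σ) =
        {g | ∃ p : X × X, UbHom.pairs g = [p]} := by
  have hbij := UbHom.bijective_sumElim b q hb
  have hpairs (σ : B ⟶ X) : UbHom.pairs (b ≫ FB.toUbOrd.map σ) =
      [Prod.map (FB.equiv σ) (FB.equiv σ) q] := by
    change (UbHom.pairs b).map _ ++ [] = _
    rw [hb]
    rfl
  constructor
  · intro σ τ h
    refine Equiv.ext fun x => ?_
    have h2 := (hpairs σ).symm.trans ((congrArg UbHom.pairs h).trans (hpairs τ))
    obtain ⟨h3, h4⟩ := Prod.ext_iff.1 (List.singleton_injective h2)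
    obtain ⟨a | (_ | _), rfl⟩ := hbij.2 x
    · exact congrFun (congrArg UbHom.map h) a
    · exact h4
    · exact h3
  · ext g
    constructor
    · rintro ⟨σ, rfl⟩
      exact ⟨_, hpairs σ⟩
    · rintro ⟨p, hp⟩
      obtain ⟨σ, h1, h2⟩ := exists_equiv_of_sumElim hbij (UbHom.bijective_sumElim g p hp)
      refine ⟨σ, UbHom.ext (funext h1) ((hpairs σ).trans (Eq.trans ?_ hp.symm))⟩
      exact congrArg (fun p => [p]) (Prod.ext (h2 true) (h2 false))

theorem UwbHom.range_comp_of_singleton {A : UwbOrd} {B X : FB × FB} (b : A ⟶ FB.toUwbOrd.obj B)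
    (q : B.1 × B.2) (hb : UwbHom.pairs b = [q]) :
    Function.Injective (fun σ : B ⟶ X => b ≫ FB.toUwbOrd.map σ) ∧
      Set.range (fun σ : B ⟶ X => b ≫ FB.toUwbOrd.map σ) =
        {g | ∃ p : X.1 × X.2, UwbHom.pairs g = [p]} := by
  have hbij₁ := UwbHom.bijective_sumElim₁ b q hb
  have hbij₂ := UwbHom.bijective_sumElim₂ b q hb
  have hpairs (σ : B ⟶ X) : UwbHom.pairs (b ≫ FB.toUwbOrd.map σ) =
      [Prod.map (FB.equiv σ.1) (FB.equiv σ.2) q] := by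
    change (UwbHom.pairs b).map _ ++ [] = _
    rw [hb]
    rfl
  constructor
  · intro σ τ h
    have h2 := (hpairs σ).symm.trans ((congrArg UwbHom.pairs h).trans (hpairs τ))
    obtain ⟨h3, h4⟩ := Prod.ext_iff.1 (List.singleton_injective h2)
    refine Prod.ext (Equiv.ext fun x => ?_) (Equiv.ext fun x => ?_)
    · obtain ⟨a | _, rfl⟩ := hbij₁.2 x
      · exact congrFun (congrArg UwbHom.map₁ h) a
      · exact h3
    · obtain ⟨a | _, rfl⟩ := hbij₂.2 x
      · exact congrFun (congrArg UwbHom.map₂ h) a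
      · exact h4
  · ext g
    constructor
    · rintro ⟨σ, rfl⟩
      exact ⟨_, hpairs σ⟩
    · rintro ⟨p, hp⟩
      obtain ⟨σ₁, h1, h2⟩ := exists_equiv_of_sumElim hbij₁ (UwbHom.bijective_sumElim₁ g p hp)
      obtain ⟨σ₂, h3, h4⟩ := exists_equiv_of_sumElim hbij₂ (UwbHom.bijective_sumElim₂ g p hp)
      let σ : B ⟶ X := (σ₁, σ₂)
      refine ⟨σ, UwbHom.ext (funext h1) (funext h3) ((hpairs σ).trans (Eq.trans ?_ hp.symm))⟩
      exact congrArg (fun p => [p]) (Prod.ext (h2 ()) (h4 ()))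

theorem range_comp_alpha (S : FB) (N : ℕ) :
    Function.Injective (fun i : {e : Fin (N + 2) × Fin (N + 2) // e.1 < e.2} × (S ⟶ FB.fin N) =>
        FB.toUbOrd.map i.2 ≫ alpha N i.1) ∧
      Set.range (fun i : {e : Fin (N + 2) × Fin (N + 2) // e.1 < e.2} × (S ⟶ FB.fin N) =>
        FB.toUbOrd.map i.2 ≫ alpha N i.1) =
        {g | ∃ p : Fin (N + 2) × Fin (N + 2), p.1 < p.2 ∧ UbHom.pairs g = [p]} := by
  constructor
  · rintro ⟨e, σ⟩ ⟨e', σ'⟩ h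
    obtain rfl : e = e' :=
      Subtype.ext (List.singleton_injective (congrArg UbHom.pairs h))
    exact Prod.ext rfl (FB.toUbOrd_comp_injective _ h)
  · ext g
    constructor
    · rintro ⟨⟨e, σ⟩, rfl⟩
      exact ⟨e.1, e.2, rfl⟩
    · rintro ⟨p, hp, hg⟩
      obtain ⟨σ, hσ⟩ := FB.exists_toUbOrd_comp_eq g (alpha N ⟨p, hp⟩) hg
      exact ⟨(⟨p, hp⟩, σ), hσ⟩

theorem range_comp_beta (Y : FB × FB) (m n : ℕ) :
    Function.Injective (fun i : (Fin (m + 1) × Fin (n + 1)) × (Y ⟶ FB.fin₂ m n) =>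
        FB.toUwbOrd.map i.2 ≫ beta m n i.1) ∧
      Set.range (fun i : (Fin (m + 1) × Fin (n + 1)) × (Y ⟶ FB.fin₂ m n) =>
        FB.toUwbOrd.map i.2 ≫ beta m n i.1) =
        {g | ∃ p : Fin (m + 1) × Fin (n + 1), UwbHom.pairs g = [p]} := by
  constructor
  · rintro ⟨e, σ⟩ ⟨e', σ'⟩ h
    obtain rfl : e = e' := List.singleton_injective (congrArg UwbHom.pairs h)
    exact Prod.ext rfl (FB.toUwbOrd_comp_injective _ h)
  · ext g
    constructor
    · rintro ⟨⟨e, σ⟩, rfl⟩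
      exact ⟨e, rfl⟩
    · rintro ⟨p, hg⟩
      obtain ⟨σ, hσ⟩ := FB.exists_toUwbOrd_comp_eq g (beta m n p) hg
      exact ⟨(p, σ), hσ⟩

/-- The morphism with the reversed pairs. -/
def UbHom.reverse {A B : FB} (f : UbHom A B) : UbHom A B :=
  f.rearrange (f.pairs.map Prod.swap) (by
    induction f.pairs with
    | nil => rfl
    | cons p l ih => exact (List.Perm.swap p.1 p.2 _).trans ((ih.cons p.2).cons p.1))

theorem UbHom.reverse_reverse {A B : FB} (f : UbHom A B) : f.reverse.reverse = f :=
  UbHom.ext rfl (by simp [UbHom.reverse, UbHom.rearrange])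

theorem UbHom.reverse_injective {A B : FB} :
    Function.Injective (UbHom.reverse : UbHom A B → UbHom A B) :=
  fun f g h => by rw [← f.reverse_reverse, h, g.reverse_reverse]

/-- The morphisms `alpha` supply the increasing pairs and their reversals the decreasing ones. The
two families are disjoint, and every pair is one or the other because its points are distinct. -/
theorem range_comp_alpha_reverse (S : FB) (N : ℕ) :
    let a (i : {e : Fin (N + 2) × Fin (N + 2) // e.1 < e.2} × (S ⟶ FB.fin N)) :
      FB.toUbOrd.obj S ⟶ FB.toUbOrd.obj (FB.fin (N + 2)) := FB.toUbOrd.map i.2 ≫ alpha N i.1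
    Function.Injective (Sum.elim a fun i => UbHom.reverse (a i)) ∧
      Set.range (Sum.elim a fun i => UbHom.reverse (a i)) =
        {g | ∃ p : Fin (N + 2) × Fin (N + 2), UbHom.pairs g = [p]} := by
  intro a
  obtain ⟨hinj, hrange⟩ := range_comp_alpha S N
  have ha (i) : UbHom.pairs (a i) = [i.1.1] := rfl
  constructor
  · refine hinj.sumElim (UbHom.reverse_injective.comp hinj) fun i j h => ?_
    have h1 : [i.1.1] = [j.1.1.swap] := congrArg UbHom.pairs h
    have h2 := List.singleton_injective h1
    have h3 := i.1.2
    rw [h2] at h3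
    exact lt_asymm h3 j.1.2
  · rw [Set.Sum.elim_range]
    ext g
    constructor
    · rintro (⟨i, rfl⟩ | ⟨i, rfl⟩)
      · exact ⟨_, ha i⟩
      · exact ⟨i.1.1.swap, rfl⟩
    · rintro ⟨p, hp⟩
      have hne : p.1 ≠ p.2 := by
        have := UbHom.nodup g
        rw [hp] at this
        have h' : [p.1, p.2].Nodup := this
        simpa using h'
      rcases lt_or_gt_of_ne hne with h | h
      · exact Or.inl (hrange.symm.subset ⟨p, h, hp⟩)
      · refine Or.inr ?_
        have hr : UbHom.pairs (UbHom.reverse g) = [p.swap] := congrArg (List.map Prod.swap) hp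
        obtain ⟨i, hi⟩ := hrange.symm.subset ⟨p.swap, h, hr⟩
        exact ⟨i, (congrArg UbHom.reverse hi).trans (UbHom.reverse_reverse g)⟩

/-- Adding a point to both sets. -/
def FB.addPair (Y : FB × FB) : FB × FB := (⟨Option Y.1⟩, ⟨Option Y.2⟩)

/-- The inclusion with the added points as pair. -/
def FB.addPairHom (Y : FB × FB) : FB.toUwbOrd.obj Y ⟶ FB.toUwbOrd.obj (FB.addPair Y) :=
  show UwbHom ⟨Y.1, Y.2⟩ ⟨⟨Option Y.1⟩, ⟨Option Y.2⟩⟩ from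
  { map₁ := some
    map₂ := some
    pairs := [(none, none)]
    inj₁ := Option.some_injective _
    inj₂ := Option.some_injective _
    nodup₁ := by simp
    nodup₂ := by simp
    compl₁ := fun y => by cases y <;> simp
    compl₂ := fun y => by cases y <;> simp }

end Single


/-! ### Evaluation of the differentials -/

section KoszulEval

variable {k : Type u} [Field k] {G : Type*} [Groupoid G] {C : Type w} [Category.{0} C]
  {ι : G ⥤ C} {P Q : Cᵒᵖ ⥤ ModuleCat.{u} k}

theorem resLeft_map_inv {x y : G} (ρ : x ⟶ y) :
    (resLeft ι Q).map (Groupoid.inv ρ) = Q.map (ι.map ρ).op :=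
  congrArg (fun ρ => Q.map (ι.map ρ).op) (show Groupoid.inv (Groupoid.inv ρ) = ρ by simp)

variable [∀ x y : G, Fintype (x ⟶ y)]

/-- The sum in the differential and the sum in the norm merge into one sum over the composites of a
bijection with a member of the family `φ`. -/
theorem toHom_koszulMap {V : G ⥤ ModuleCat.{u} k} (e : DualPairing (resRight ι P) V) {E : Type}
    [Fintype E] {x y : G} (φ : E → (ι.obj x ⟶ ι.obj y))
    (h : ∀ σ : y ⟶ y, ∑ e, innerMul ι P Q (φ e ≫ ι.map σ) = ∑ e, innerMul ι P Q (φ e))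
    (z : G) (v : V.obj z) (p : P.obj (op (ι.obj y))) (q : Q.obj (op (ι.obj y))) :
    Tens.toHom e (resLeft ι Q) x z
        (koszulMap φ h (Tens.mk (resRight ι P) (resLeft ι Q) y (p ⊗ₜ q))) v =
      ∑ i : E × (z ⟶ x), e.equiv x ((P.map (φ i.1).op).hom p) ((V.map i.2).hom v) •
        (Q.map (ι.map i.2 ≫ φ i.1).op).hom q := by
  rw [koszulMap_mk, map_sum, LinearMap.sum_apply, Fintype.sum_prod_type]
  refine Finset.sum_congr rfl fun i _ => ?_
  rw [innerMul_tmul, Tens.toHom_mk]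
  refine Finset.sum_congr rfl fun ρ _ => congrArg _ ?_
  refine Eq.trans ?_ (map_op_map_op Q (ι.map ρ) (φ i) _ rfl q)
  exact congrArg (fun ψ => ψ.hom ((Q.map (φ i).op).hom q)) (resLeft_map_inv ρ)

variable {T : TwistRel k C} {A : C}

/-- The values of the image of an element under a Koszul differential, as a sum over morphisms. -/
theorem toHom_koszulMap_cls {E : Type} [Fintype E] {x y : G} (φ : E → (ι.obj x ⟶ ι.obj y))
    (h : ∀ σ : y ⟶ y,
      ∑ e, innerMul ι (Twisted.restr ((homSharp k (Twisted T)).obj ⟨A⟩).obj) Q (φ e ≫ ι.map σ) =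
        ∑ e, innerMul ι (Twisted.restr ((homSharp k (Twisted T)).obj ⟨A⟩).obj) Q (φ e))
    (z : G) (f : A ⟶ ι.obj z)
    (p : (Twisted.restr ((homSharp k (Twisted T)).obj ⟨A⟩).obj).obj (op (ι.obj y)))
    (q : Q.obj (op (ι.obj y))) :
    Tens.toHom (homPairing T ι A) (resLeft ι Q) x z
        (koszulMap φ h (Tens.mk (resRight ι _) (resLeft ι Q) y (p ⊗ₜ q))) (Twisted.cls f) =
      ∑ i : E × (z ⟶ x), (homPairing T ι A).equiv y p (Twisted.cls (f ≫ ι.map i.2 ≫ φ i.1)) •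
        (Q.map (ι.map i.2 ≫ φ i.1).op).hom q := by
  refine (toHom_koszulMap (homPairing T ι A) φ h z (Twisted.cls f) p q).trans ?_
  refine Finset.sum_congr rfl fun i _ => congrArg (· • _) ?_
  refine congrArg ((homPairing T ι A).equiv y p) ?_
  refine (congrArg (Twisted.compL A (ι.obj x) (ι.obj y) · (Twisted.cls (φ i.1)))
    (Twisted.compL_cls f (ι.map i.2))).trans ?_
  exact (Twisted.compL_cls (f ≫ ι.map i.2) (φ i.1)).trans
    (congrArg Twisted.cls (Category.assoc f (ι.map i.2) (φ i.1)))

theorem toHom_mk_cls (y z : G) (f : A ⟶ ι.obj z)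
    (p : (Twisted.restr ((homSharp k (Twisted T)).obj ⟨A⟩).obj).obj (op (ι.obj y)))
    (q : Q.obj (op (ι.obj y))) :
    Tens.toHom (homPairing T ι A) (resLeft ι Q) y z
        (Tens.mk (resRight ι _) (resLeft ι Q) y (p ⊗ₜ q)) (Twisted.cls f) =
      ∑ σ : z ⟶ y, (homPairing T ι A).equiv y p (Twisted.cls (f ≫ ι.map σ)) •
        (Q.map (ι.map σ).op).hom q := by
  refine (Tens.toHom_mk (Q := resLeft ι Q) (homPairing T ι A) y z p q (Twisted.cls f)).trans ?_
  refine Finset.sum_congr rfl fun ρ _ => ?_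
  refine congrArg₂ (fun (a : k) (m : Q.obj (op (ι.obj z))) => a • m) ?_ ?_
  · exact congrArg ((homPairing T ι A).equiv y p) (Twisted.compL_cls f (ι.map ρ))
  · exact congrArg (fun ψ => ψ.hom q) (resLeft_map_inv ρ)

/-- If the composites `ρ ≫ φ e` and `b ≫ σ` run over the same morphisms, the merged sum is the norm
sum at `z'` with `b` inserted, so `b` can be taken out. It serves the walled case; the unwalled one
needs the transfer as well. -/
theorem toHom_koszulMap_eq {E : Type} [Fintype E] {x y z z' : G} (φ : E → (ι.obj x ⟶ ι.obj y))
    (h : ∀ σ : y ⟶ y,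
      ∑ e, innerMul ι (Twisted.restr ((homSharp k (Twisted T)).obj ⟨A⟩).obj) Q (φ e ≫ ι.map σ) =
        ∑ e, innerMul ι (Twisted.restr ((homSharp k (Twisted T)).obj ⟨A⟩).obj) Q (φ e))
    (b : ι.obj z ⟶ ι.obj z')
    (h₁ : Function.Injective fun i : E × (z ⟶ x) => ι.map i.2 ≫ φ i.1)
    (h₂ : Function.Injective fun σ : z' ⟶ y => b ≫ ι.map σ)
    (h₃ : Set.range (fun i : E × (z ⟶ x) => ι.map i.2 ≫ φ i.1) =
      Set.range fun σ : z' ⟶ y => b ≫ ι.map σ) (f : A ⟶ ι.obj z)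
    (w : Tens (resRight ι (Twisted.restr ((homSharp k (Twisted T)).obj ⟨A⟩).obj)) (resLeft ι Q) y) :
    Tens.toHom (homPairing T ι A) (resLeft ι Q) x z (koszulMap φ h w) (Twisted.cls f) =
      (Q.map b.op).hom
        (Tens.toHom (homPairing T ι A) (resLeft ι Q) y z' w (Twisted.cls (f ≫ b))) := by
  suffices (Tens.toHom (homPairing T ι A) (resLeft ι Q) x z).flip (Twisted.cls f) ∘ₗ
        koszulMap φ h = (Q.map b.op).hom ∘ₗ
      (Tens.toHom (homPairing T ι A) (resLeft ι Q) y z').flip (Twisted.cls (f ≫ b)) from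
    LinearMap.congr_fun this w
  refine Tens.ext fun p q => ?_
  refine (toHom_koszulMap_cls φ h z f p q).trans ?_
  refine Eq.trans ?_ (congrArg (Q.map b.op).hom (toHom_mk_cls y z' (f ≫ b) p q)).symm
  rw [map_sum]
  refine (sum_eq_of_range_eq h₁ h₂ h₃ fun g : ι.obj z ⟶ ι.obj y =>
    (homPairing T ι A).equiv y p (Twisted.cls (f ≫ g)) • (Q.map g.op).hom q).trans
      (Finset.sum_congr rfl fun σ _ => ?_)
  rw [map_smul]
  refine congrArg₂ (· • ·) ?_ (map_op_map_op Q b (ι.map σ) _ rfl q).symm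
  exact congrArg (fun g => (homPairing T ι A).equiv y p (Twisted.cls g))
    (Category.assoc f b (ι.map σ)).symm

end KoszulEval

/-! ### The walled differential as restriction along one pair -/

section UwbDiffEval

variable {k : Type u} [Field k] {ε : ℤˣ} {A : FB × FB} {F : OpMod k (KUwb k ε)} {N : ℕ}

theorem uwbEval_incl {m n : ℕ} (hmn : m + n = N) (Y : FB × FB)
    (z : UwbTens ((uwbSharp k ε).obj A) F m n) :
    uwbEval A F Y (uwbIncl ((uwbSharp k ε).obj A) F hmn z) =
      Tens.toHom (homPairing (uwbTwistRel k (-ε)) FB.toUwbOrd (FB.toUwbOrd.obj A))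
        (resLeft FB.toUwbOrd (Twisted.restr F.obj)) (FB.fin₂ m n) Y z :=
  Tens.sumToHom_lof _ (fun p : {p : ℕ × ℕ // p.1 + p.2 = N} => FB.fin₂ p.1.1 p.1.2) Y
    ⟨(m, n), hmn⟩ z

/-- The values of the differential of the walled complex. -/
theorem uwbEval_uwbDiff {Y Y' : FB × FB} (b : FB.toUwbOrd.obj Y ⟶ FB.toUwbOrd.obj Y')
    (q : Y'.1 × Y'.2) (hb : UwbHom.pairs b = [q])
    (h : FB.toUwbOrd.obj A ⟶ FB.toUwbOrd.obj Y) (x : UwbSum ((uwbSharp k ε).obj A) F (N + 2)) :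
    uwbEval A F Y (uwbDiff ((uwbSharp k ε).obj A) F N x) (Twisted.cls h) =
      ((Twisted.restr F.obj).map b.op).hom (uwbEval A F Y' x (Twisted.cls (h ≫ b))) := by
  suffices (uwbEval A F Y).flip (Twisted.cls h) ∘ₗ uwbDiff ((uwbSharp k ε).obj A) F N =
      ((Twisted.restr F.obj).map b.op).hom ∘ₗ (uwbEval A F Y').flip (Twisted.cls (h ≫ b)) from
    LinearMap.congr_fun this x
  refine uwbSum_ext _ _ fun m n hmn => LinearMap.ext fun z => ?_
  have h1 := LinearMap.congr_fun (uwbDiff_comp_incl ((uwbSharp k ε).obj A) F hmn) z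
  refine (congrArg (fun x => uwbEval A F Y x (Twisted.cls h)) h1).trans ?_
  refine Eq.trans ?_ (congrArg (fun φ => ((Twisted.restr F.obj).map b.op).hom
    (φ (Twisted.cls (h ≫ b)))) (uwbEval_incl hmn Y' z)).symm
  match m, n, hmn, z with
  | m + 1, n + 1, hmn, z =>
    refine (congrArg (fun φ => φ (Twisted.cls h)) (uwbEval_incl (F := F) (A := A)
      (by omega : m + n = N) Y (uwbKoszul ((uwbSharp k ε).obj A) F m n z))).trans ?_
    have h1 := range_comp_beta Y m n
    have h2 := UwbHom.range_comp_of_singleton (X := FB.fin₂ (m + 1) (n + 1)) b q hb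
    exact toHom_koszulMap_eq (beta m n) (sum_beta_comp ((uwbSharp k ε).obj A) F m n) b h1.1 h2.1
      (h1.2.trans h2.2.symm) h z
  | 0, n, hmn, z =>
    -- On the summand `(0, n)` the differential is zero; the right-hand side vanishes too, because
    -- the first set of `Y'` contains `q.1` and cannot be matched with the empty set. The summands
    -- `(m + 1, 0)` are symmetric.
    have : IsEmpty (Y' ⟶ FB.fin₂ 0 n) := ⟨fun σ => (FB.equiv σ.1 q.1).elim0⟩
    refine (LinearMap.congr_fun (map_zero (uwbEval (N := N) A F Y)) _).trans ?_
    refine Eq.trans (map_zero _).symm (congrArg ((Twisted.restr F.obj).map b.op).hom ?_)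
    exact (LinearMap.congr_fun (Tens.toHom_of_isEmpty (homPairing (uwbTwistRel k (-ε)) FB.toUwbOrd
      (FB.toUwbOrd.obj A)) this z) _).symm
  | m + 1, 0, hmn, z =>
    have : IsEmpty (Y' ⟶ FB.fin₂ (m + 1) 0) := ⟨fun σ => (FB.equiv σ.2 q.2).elim0⟩
    refine (LinearMap.congr_fun (map_zero (uwbEval (N := N) A F Y)) _).trans ?_
    refine Eq.trans (map_zero _).symm (congrArg ((Twisted.restr F.obj).map b.op).hom ?_)
    exact (LinearMap.congr_fun (Tens.toHom_of_isEmpty (homPairing (uwbTwistRel k (-ε)) FB.toUwbOrd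
      (FB.toUwbOrd.obj A)) this z) _).symm

end UwbDiffEval


/-! ### The unwalled differential as restriction along one walled pair -/

section UbDiffEval

variable {k : Type u} [Field k] {δ ε : ℤˣ} {U : FB} {F : OpMod k (KUwb k ε)} {N : ℕ}

theorem WallSum.map_map (M : UwbOrdᵒᵖ ⥤ ModuleCat.{u} k) {X Y Z : UbOrd} (f : X ⟶ Y) (g : Y ⟶ Z)
    (q : WallSum M Z.set) :
    WallSum.map M f (WallSum.map M g q) = WallSum.map M (f ≫ g) q :=
  (congrArg (fun φ => φ.hom q) ((WallSum.functor M).map_comp g.op f.op)).symm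

theorem cls_comp_reverse {A B X : UbOrd} (f : X ⟶ A) (g : A ⟶ B) (p : B.set × B.set)
    (hg : UbHom.pairs g = [p]) :
    (Twisted.cls (f ≫ g) : Twisted.Hom (ubTwistRel k δ ε) X B) =
      sgn k δ • Twisted.cls (f ≫ (UbHom.reverse g : UbHom A.set B.set)) :=
  Twisted.cls_rel ((ubTwistRel k δ ε).precomp f
    (UbTwist.flip [] [] p rfl hg (congrArg (List.map Prod.swap) hg)))

/-- The contribution of a morphism to the values of an element of the complex. -/
def ubEvalTerm (S : FB) (f : FB.toUbOrd.obj U ⟶ FB.toUbOrd.obj S) (X : FB)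
    (p : (Twisted.restr ((ubSharp k δ ε).obj U).obj).obj (op (FB.toUbOrd.obj X)))
    (q : WallSum (Twisted.restr F.obj) X) (g : FB.toUbOrd.obj S ⟶ FB.toUbOrd.obj X) :
    WallSum (Twisted.restr F.obj) S :=
  (homPairing (ubTwistRel k δ (-ε)) FB.toUbOrd (FB.toUbOrd.obj U)).equiv X p
    (Twisted.cls (f ≫ g)) • WallSum.map (Twisted.restr F.obj) g q

/-- The transfer gives the reversed morphism the coefficient `δ`, and reversing the pair in the dual
of `kub` gives another `δ`. Their product is one, so both directions of the pair contribute terms of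
the same shape. -/
theorem ubEvalTerm_add_reverse (S : FB) (f : FB.toUbOrd.obj U ⟶ FB.toUbOrd.obj S) (X : FB)
    (p : (Twisted.restr ((ubSharp k δ ε).obj U).obj).obj (op (FB.toUbOrd.obj X)))
    (q : WallSum (Twisted.restr F.obj) X) (g : FB.toUbOrd.obj S ⟶ FB.toUbOrd.obj X) (r : X × X)
    (hg : UbHom.pairs g = [r]) :
    (homPairing (ubTwistRel k δ (-ε)) FB.toUbOrd (FB.toUbOrd.obj U)).equiv X p
        (Twisted.cls (f ≫ g)) •
      ((Twisted.restr ((dJ k δ ε).obj F).obj).map g.op).hom q =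
    ubEvalTerm S f X p q g + ubEvalTerm S f X p q (UbHom.reverse g) := by
  have h1 := LinearMap.congr_fun (dJ_map_of_singleton (δ := δ) F g (UbHom.reverse g) r hg
    (congrArg (List.map Prod.swap) hg) rfl) q
  refine (congrArg (fun x : WallSum (Twisted.restr F.obj) S => (homPairing (ubTwistRel k δ (-ε))
    FB.toUbOrd (FB.toUbOrd.obj U)).equiv X p (Twisted.cls (f ≫ g)) • x) h1).trans ?_
  refine (smul_add _ _ _).trans (congrArg (ubEvalTerm S f X p q g + ·) ?_)
  have h2 := congrArg ((homPairing (ubTwistRel k δ (-ε)) FB.toUbOrd (FB.toUbOrd.obj U)).equiv X p)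
    (cls_comp_reverse (δ := δ) (ε := -ε) f g r hg)
  refine (congrArg (fun a : k => a • (sgn k δ • WallSum.map (Twisted.restr F.obj)
    (UbHom.reverse g) q : WallSum (Twisted.restr F.obj) S)) (h2.trans (map_smul _ _ _))).trans ?_
  rw [smul_smul, smul_eq_mul, mul_right_comm, sgn_mul_self, one_mul]
  rfl

/-- The components of the values of the differential of the unwalled complex. -/
theorem proj_ubEval_ubKoszul [CharZero k] {Y Y' : FB × FB} (b : FB.toUwbOrd.obj Y ⟶ FB.toUwbOrd.obj Y')
    (r : Y'.1 × Y'.2) (hb : UwbHom.pairs b = [r])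
    (f : FB.toUbOrd.obj U ⟶ (FB.toUwbOrd.obj Y).sum)
    (z : UbTens ((ubSharp k δ ε).obj U) ((dJ k δ ε).obj F) (N + 2)) :
    WallSum.proj (Twisted.restr F.obj) (FB.toUwbOrd.obj Y)
        (ubEval U F (FB.toUwbOrd.obj Y).sum.set
          (ubKoszul ((ubSharp k δ ε).obj U) ((dJ k δ ε).obj F) N z) (Twisted.cls f)) =
      ((Twisted.restr F.obj).map b.op).hom
        (WallSum.proj (Twisted.restr F.obj) (FB.toUwbOrd.obj Y')
          (ubEval U F (FB.toUwbOrd.obj Y').sum.set z (Twisted.cls (f ≫ UwbOrd.sumHom b)))) := by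
  let S := (FB.toUwbOrd.obj Y).sum.set
  let S' := (FB.toUwbOrd.obj Y').sum.set
  suffices WallSum.proj (Twisted.restr F.obj) (FB.toUwbOrd.obj Y) ∘ₗ
        (ubEval (δ := δ) U F S).flip (Twisted.cls f) ∘ₗ
          ubKoszul ((ubSharp k δ ε).obj U) ((dJ k δ ε).obj F) N =
      ((Twisted.restr F.obj).map b.op).hom ∘ₗ
        WallSum.proj (Twisted.restr F.obj) (FB.toUwbOrd.obj Y') ∘ₗ
          (ubEval (δ := δ) U F S').flip (Twisted.cls (f ≫ UwbOrd.sumHom b)) from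
    LinearMap.congr_fun this z
  refine Tens.ext fun p q => ?_
  let X := FB.fin (N + 2)
  let a (i : {e : Fin (N + 2) × Fin (N + 2) // e.1 < e.2} × (S ⟶ FB.fin N)) :
    FB.toUbOrd.obj S ⟶ FB.toUbOrd.obj X := FB.toUbOrd.map i.2 ≫ alpha N i.1
  have h1 := toHom_koszulMap_cls (alpha N)
    (sum_alpha_comp ((ubSharp k δ ε).obj U) ((dJ k δ ε).obj F) N) S f p q
  have h2 : ∀ i, _ := fun i => ubEvalTerm_add_reverse S f X p q (a i) i.1.1 rfl
  -- The sum over increasing pairs and their reversals is a sum over all morphisms `S ⟶ X` with one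
  -- pair, and these are `UwbOrd.sumHom b` followed by the bijections `σ`.
  have h3 : ubEval U F S (ubKoszul ((ubSharp k δ ε).obj U) ((dJ k δ ε).obj F) N
      (Tens.mk (resRight FB.toUbOrd _) (resLeft FB.toUbOrd _) X (p ⊗ₜ q))) (Twisted.cls f) =
      ∑ σ : S' ⟶ X, ubEvalTerm S f X p q
        ((UwbOrd.sumHom b : FB.toUbOrd.obj S ⟶ FB.toUbOrd.obj S') ≫ FB.toUbOrd.map σ) := by
    refine h1.trans ((Finset.sum_congr rfl fun i _ => h2 i).trans ?_)
    refine Finset.sum_add_distrib.trans ?_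
    refine (Fintype.sum_sum_type (fun i => ubEvalTerm S f X p q
      (Sum.elim a (fun i => UbHom.reverse (a i)) i))).symm.trans ?_
    have h4 := range_comp_alpha_reverse S N
    have h5 := UbHom.range_comp_of_singleton (A := FB.toUbOrd.obj S) (B := S') (X := X)
      (UwbOrd.sumHom b) (Sum.inl r.1, Sum.inr r.2) (by
        change joinPairs [] [] (UwbHom.pairs b) = _
        rw [hb]
        rfl)
    exact sum_eq_of_range_eq h4.1 h5.1 (h4.2.trans h5.2.symm) (ubEvalTerm S f X p q)
  refine (congrArg (WallSum.proj (Twisted.restr F.obj) (FB.toUwbOrd.obj Y)) h3).trans ?_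
  have h6 := toHom_mk_cls (Q := Twisted.restr ((dJ k δ ε).obj F).obj) X S' (f ≫ UwbOrd.sumHom b) p q
  refine Eq.trans ?_ (congrArg (fun x => ((Twisted.restr F.obj).map b.op).hom
        (WallSum.proj (Twisted.restr F.obj) (FB.toUwbOrd.obj Y') x)) h6).symm
  refine (map_sum _ _ _).trans (Eq.trans ?_ ((congrArg _ (map_sum _ _ _)).trans
    (map_sum _ _ _)).symm)
  refine Finset.sum_congr rfl fun σ _ => ?_
  -- With the scalar isolated, each summand is the naturality of the projection for the walled
  -- morphism `b`; no condition on the direction of the pair relative to `X` remains.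
  let c : k := (homPairing (ubTwistRel k δ (-ε)) FB.toUbOrd (FB.toUbOrd.obj U)).equiv X p
    (Twisted.cls (f ≫ (UwbOrd.sumHom b : FB.toUbOrd.obj S ⟶ FB.toUbOrd.obj S') ≫
      FB.toUbOrd.map σ))
  have h7 : c • WallSum.proj (Twisted.restr F.obj) (FB.toUwbOrd.obj Y)
      (WallSum.map (Twisted.restr F.obj) (UwbOrd.sumHom b)
        (WallSum.map (Twisted.restr F.obj) (FB.toUbOrd.map σ) q)) =
      ((Twisted.restr F.obj).map b.op).hom (WallSum.proj (Twisted.restr F.obj) (FB.toUwbOrd.obj Y')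
        (c • WallSum.map (Twisted.restr F.obj) (FB.toUbOrd.map σ) q)) :=
    (congrArg (c • ·) (WallSum.proj_map _ b _)).trans
      ((congrArg _ (map_smul _ c _)).trans (map_smul _ c _)).symm
  refine (map_smul _ c _).trans (Eq.trans ?_ (h7.trans ?_))
  · exact congrArg (fun x => c • WallSum.proj (Twisted.restr F.obj) (FB.toUwbOrd.obj Y) x)
      (WallSum.map_map (Twisted.restr F.obj) (UwbOrd.sumHom b) (FB.toUbOrd.map σ) q).symm
  · refine congrArg (fun x => ((Twisted.restr F.obj).map b.op).hom
      (WallSum.proj (Twisted.restr F.obj) (FB.toUwbOrd.obj Y') x)) ?_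
    refine congrArg₂ (fun (a : k) (x : WallSum (Twisted.restr F.obj) S') => a • x) ?_
      (LinearMap.congr_fun (dJ_map_of_nil (δ := δ) F (FB.toUbOrd.map σ) rfl) q).symm
    exact congrArg (fun g => (homPairing (ubTwistRel k δ (-ε)) FB.toUbOrd
      (FB.toUbOrd.obj U)).equiv X p (Twisted.cls g)) (Category.assoc _ _ _).symm

end UbDiffEval


/-! ### The isomorphism of complexes -/

section Naturality

variable {k : Type u} [Field k] {δ ε : ℤˣ} {U U' : FB} {F F' : OpMod k (KUwb k ε)} {N : ℕ}

theorem ubEval_map (σ : U ⟶ U') (θ : F ⟶ F')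
    (z : UbTens ((ubSharp k δ ε).obj U) ((dJ k δ ε).obj F) N) (X : FB)
    (f : FB.toUbOrd.obj U' ⟶ FB.toUbOrd.obj X) :
    ubEval U' F' X (ubMap ((ubSharp k δ ε).map σ) ((dJ k δ ε).map θ) N z) (Twisted.cls f) =
      DirectSum.lmap (fun c : Splitting X => (θ.hom.app (op ⟨c.parts⟩)).hom)
        (ubEval U F X z (Twisted.cls (FB.toUbOrd.map σ ≫ f))) := by
  have h1 := Tens.toHom_map
    (homPairing (ubTwistRel k δ (-ε)) FB.toUbOrd (FB.toUbOrd.obj U))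
    (homPairing (ubTwistRel k δ (-ε)) FB.toUbOrd (FB.toUbOrd.obj U'))
    (Functor.whiskerLeft FB.toUbOrd.op (Functor.whiskerLeft (Twisted.quot _).op
      ((ubSharp k δ ε).map σ).hom))
    (Functor.whiskerLeft (invFunctor FB ⋙ FB.toUbOrd.op)
      (Functor.whiskerLeft (Twisted.quot _).op ((dJ k δ ε).map θ).hom)) (x := FB.fin N) (y := X)
    (Twisted.compL _ _ _ (Twisted.cls (FB.toUbOrd.map σ))) (fun _ _ => rfl) z (Twisted.cls f)
  refine h1.trans (congrArg _ (congrArg (ubEval U F X z) ?_))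
  exact Twisted.compL_cls (FB.toUbOrd.map σ) f

theorem ubDecEval_map (σ : U ⟶ U') (θ : F ⟶ F')
    (z : UbTens ((ubSharp k δ ε).obj U) ((dJ k δ ε).obj F) N) (Y : FB × FB)
    (t : Dec U' (FB.toUwbOrd.obj Y)) :
    ubDecEval U' F' (ubMap ((ubSharp k δ ε).map σ) ((dJ k δ ε).map θ) N z) Y t =
      (θ.hom.app (op ⟨FB.toUwbOrd.obj Y⟩)).hom (ubDecEval U F z Y (t.pull σ)) := by
  refine (congrArg (WallSum.proj (Twisted.restr F'.obj) (FB.toUwbOrd.obj Y))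
    (ubEval_map σ θ z (FB.toUwbOrd.obj Y).sum.set t.hom)).trans ?_
  refine (WallSum.proj_lmap (Functor.whiskerLeft (Twisted.quot _).op θ.hom)
    (FB.toUwbOrd.obj Y) _).trans ?_
  exact congrArg (fun f => (θ.hom.app (op ⟨FB.toUwbOrd.obj Y⟩)).hom
    (WallSum.proj (Twisted.restr F.obj) (FB.toUwbOrd.obj Y)
      (ubEval U F (FB.toUwbOrd.obj Y).sum.set z (Twisted.cls f)))) (Dec.hom_pull σ t).symm

/-- The right-hand side has the same form as in `uwbDecEval_uwbDiff`. As corresponding elements have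
equal values, this agreement is the compatibility of the isomorphism with the differentials. -/
theorem ubDecEval_ubKoszul [CharZero k]
    (z : UbTens ((ubSharp k δ ε).obj U) ((dJ k δ ε).obj F) (N + 2)) (Y : FB × FB)
    (t : Dec U (FB.toUwbOrd.obj Y)) :
    ubDecEval U F (ubKoszul ((ubSharp k δ ε).obj U) ((dJ k δ ε).obj F) N z) Y t =
      ((Twisted.restr F.obj).map (FB.addPairHom Y).op).hom
        (ubDecEval U F z (FB.addPair Y) (t.comp (FB.addPairHom Y))) := by
  refine (proj_ubEval_ubKoszul (FB.addPairHom Y) (none, none) rfl t.hom z).trans ?_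
  exact congrArg (fun f => ((Twisted.restr F.obj).map (FB.addPairHom Y).op).hom
    (WallSum.proj (Twisted.restr F.obj) (FB.toUwbOrd.obj (FB.addPair Y))
      (ubEval U F (FB.toUwbOrd.obj (FB.addPair Y)).sum.set z (Twisted.cls f))))
    (Dec.hom_comp t (FB.addPairHom Y)).symm

theorem uwbDecEval_obj_map (σ : U ⟶ U')
    (w : ((phi k δ (-ε)).obj (uwbDegree F N)).obj U) (Y : FB × FB)
    (t : Dec U' (FB.toUwbOrd.obj Y)) :
    uwbDecEval U' F ((((phi k δ (-ε)).obj (uwbDegree F N)).map σ).hom w) Y t =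
      uwbDecEval U F w Y (t.pull σ) :=
  congrArg (fun v => uwbEval (N := N) (FB.fin₂ t.x t.y) F Y v (Twisted.cls t.h))
    (phiEval_obj_map σ (FB.fin₂ t.x t.y) w t.c t.f₁ t.f₂)

/-- The transformation enters only through its components, so that the result applies to the degree
`N` part of a chain map as it stands. -/
theorem uwbDecEval_map (θ : F ⟶ F') (η : uwbDegree F N ⟶ uwbDegree F' N)
    (hη : ∀ A, (η.app A).hom = uwbSumMap (𝟙 ((uwbSharp k ε).obj A)) θ N)
    (w : ((phi k δ (-ε)).obj (uwbDegree F N)).obj U) (Y : FB × FB)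
    (t : Dec U (FB.toUwbOrd.obj Y)) :
    uwbDecEval U F' ((((phi k δ (-ε)).map η).app U).hom w) Y t =
      (θ.hom.app (op ⟨FB.toUwbOrd.obj Y⟩)).hom (uwbDecEval U F w Y t) := by
  let A := FB.fin₂ t.x t.y
  let v := phiEval δ (-ε) U (uwbDegree F N) A w
    (splitVec k δ (-ε) A t.c (Twisted.cls t.f₁) (Twisted.cls t.f₂))
  refine (congrArg (fun v => uwbEval (N := N) A F' Y v (Twisted.cls t.h))
    ((phiEval_map η A w _).trans (LinearMap.congr_fun (hη A) v))).trans ?_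
  have h1 := uwbEval_map (𝟙 A) θ v Y t.h
  rw [CategoryTheory.Functor.map_id] at h1
  refine h1.trans ?_
  refine congrArg (fun h => (θ.hom.app (op ⟨FB.toUwbOrd.obj Y⟩)).hom
    (uwbEval (N := N) A F Y v (Twisted.cls h))) ?_
  rw [CategoryTheory.Functor.map_id]
  exact Category.id_comp _

theorem uwbDecEval_uwbDiff (η : uwbDegree F (N + 2) ⟶ uwbDegree F N)
    (hη : ∀ A, (η.app A).hom = uwbDiff ((uwbSharp k ε).obj A) F N)
    (w : ((phi k δ (-ε)).obj (uwbDegree F (N + 2))).obj U) (Y : FB × FB)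
    (t : Dec U (FB.toUwbOrd.obj Y)) :
    uwbDecEval U F ((((phi k δ (-ε)).map η).app U).hom w) Y t =
      ((Twisted.restr F.obj).map (FB.addPairHom Y).op).hom
        (uwbDecEval U F w (FB.addPair Y) (t.comp (FB.addPairHom Y))) := by
  let A := FB.fin₂ t.x t.y
  let v := phiEval δ (-ε) U (uwbDegree F (N + 2)) A w
    (splitVec k δ (-ε) A t.c (Twisted.cls t.f₁) (Twisted.cls t.f₂))
  refine (congrArg (fun v => uwbEval (N := N) A F Y v (Twisted.cls t.h))
    ((phiEval_map η A w _).trans (LinearMap.congr_fun (hη A) v))).trans ?_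
  exact uwbEval_uwbDiff (FB.addPairHom Y) (none, none) rfl t.h v

end Naturality

/-! ### Assembling the isomorphism of complexes -/

section Iso

variable {k : Type u} [Field k] [CharZero k] (δ : ℤˣ) {ε : ℤˣ} (U : FB) (F : OpMod k (KUwb k ε))
  (N : ℕ)

/-- The evaluation at decompositions as a linear map. -/
def ubDecEvalₗ : UbTens ((ubSharp k δ ε).obj U) ((dJ k δ ε).obj F) N →ₗ[k]
    ∀ Y : FB × FB, Dec U (FB.toUwbOrd.obj Y) →
      (Twisted.restr F.obj).obj (op (FB.toUwbOrd.obj Y)) :=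
  LinearMap.pi fun Y => LinearMap.pi fun t =>
    WallSum.proj (Twisted.restr F.obj) (FB.toUwbOrd.obj Y) ∘ₗ
      (ubEval U F (FB.toUwbOrd.obj Y).sum.set).flip (Twisted.cls t.hom)

/-- The evaluation of elements of the image of the walled complex as a linear map. -/
def uwbDecEvalₗ : ((phi k δ (-ε)).obj (uwbDegree F N)).obj U →ₗ[k]
    ∀ Y : FB × FB, Dec U (FB.toUwbOrd.obj Y) →
      (Twisted.restr F.obj).obj (op (FB.toUwbOrd.obj Y)) :=
  LinearMap.pi fun Y => LinearMap.pi fun t =>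
    LinearMap.comp (M₂ := UwbSum ((uwbSharp k ε).obj (FB.fin₂ t.x t.y)) F N)
      ((uwbEval (FB.fin₂ t.x t.y) F Y).flip (Twisted.cls t.h))
      ((phiEval δ (-ε) U (uwbDegree F N) (FB.fin₂ t.x t.y)).flip
        (splitVec k δ (-ε) (FB.fin₂ t.x t.y) t.c (Twisted.cls t.f₁) (Twisted.cls t.f₂)))

/-- Both images are the families satisfying `Dec.IsNatural`: on each side all values are natural,
and every natural family is attained. -/
theorem range_ubDecEvalₗ :
    LinearMap.range (ubDecEvalₗ δ U F N) = LinearMap.range (uwbDecEvalₗ δ U F N) := by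
  ext Ψ
  constructor
  · rintro ⟨z, rfl⟩
    exact exists_uwbDecEval_eq (isNatural_ubDecEval z)
  · rintro ⟨w, rfl⟩
    exact exists_ubDecEval_eq (isNatural_uwbDecEval w)

/-- The isomorphism between the degree `N` parts of the complexes: corresponding elements have the
same values at decompositions. -/
def koszulEquiv : UbTens ((ubSharp k δ ε).obj U) ((dJ k δ ε).obj F) N ≃ₗ[k]
    ((phi k δ (-ε)).obj (uwbDegree F N)).obj U :=
  LinearEquiv.ofInjective (ubDecEvalₗ δ U F N) ubDecEval_injective ≪≫ₗ
    LinearEquiv.ofEq _ _ (range_ubDecEvalₗ δ U F N) ≪≫ₗ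
      (LinearEquiv.ofInjective (uwbDecEvalₗ δ U F N) uwbDecEval_injective).symm

/-- The characterising property of the isomorphism. Since evaluation is injective, every commutation
below is verified on values alone. -/
theorem uwbDecEval_koszulEquiv
    (z : UbTens ((ubSharp k δ ε).obj U) ((dJ k δ ε).obj F) N) :
    uwbDecEval U F (koszulEquiv δ U F N z) = ubDecEval U F z :=
  congrArg Subtype.val (LinearEquiv.apply_symm_apply
    (LinearEquiv.ofInjective (uwbDecEvalₗ δ U F N) uwbDecEval_injective)
    (LinearEquiv.ofEq _ _ (range_ubDecEvalₗ δ U F N)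
      (LinearEquiv.ofInjective (ubDecEvalₗ δ U F N) ubDecEval_injective z)))

/-- The isomorphism between the degree `N` parts of the complexes. -/
def koszulDegreeIso :
    ubDegree ((dJ k δ ε).obj F) N ≅ (phi k δ (-ε)).obj (uwbDegree F N) :=
  NatIso.ofComponents (fun U => (koszulEquiv δ U F N).toModuleIso) fun {U U'} σ => by
    refine ModuleCat.hom_ext (LinearMap.ext fun z => uwbDecEval_injective ?_)
    refine funext fun Y => funext fun t => ?_
    refine (congrFun (congrFun (uwbDecEval_koszulEquiv δ U' F N _) Y) t).trans ?_
    refine Eq.trans ?_ (uwbDecEval_obj_map σ (koszulEquiv δ U F N z) Y t).symm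
    refine Eq.trans ?_ (congrFun (congrFun (uwbDecEval_koszulEquiv δ U F N z) Y) (t.pull σ)).symm
    have h1 := ubDecEval_map σ (𝟙 F) z Y t
    rw [CategoryTheory.Functor.map_id] at h1
    exact h1

theorem mkComplex_d {V : Type*} [Category V] [Limits.HasZeroMorphisms V] (X : ℕ → V)
    (d : ∀ n, X (n + 2) ⟶ X n) (h : ∀ n, d (n + 2) ≫ d n = 0) (n : ℕ) :
    (mkComplex X d h).d (n + 2) n = d n := by
  simp [mkComplex]

theorem ubComplex_d_app (M : OpMod k (KUb k δ ε)) :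
    (((ubComplex M).d (N + 2) N).app U).hom = ubKoszul ((ubSharp k δ ε).obj U) M N := by
  unfold ubComplex
  rw [mkComplex_d]
  rfl

theorem uwbComplex_d_app (A : FB × FB) :
    (((uwbComplex F).d (N + 2) N).app A).hom = uwbDiff ((uwbSharp k ε).obj A) F N := by
  unfold uwbComplex
  rw [mkComplex_d]
  rfl

theorem koszulDegreeIso_comm
    (η' : ubDegree ((dJ k δ ε).obj F) (N + 2) ⟶ ubDegree ((dJ k δ ε).obj F) N)
    (hη' : ∀ U, (η'.app U).hom = ubKoszul ((ubSharp k δ ε).obj U) ((dJ k δ ε).obj F) N)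
    (η : uwbDegree F (N + 2) ⟶ uwbDegree F N)
    (hη : ∀ A, (η.app A).hom = uwbDiff ((uwbSharp k ε).obj A) F N) :
    (koszulDegreeIso δ F (N + 2)).hom ≫ (phi k δ (-ε)).map η =
      η' ≫ (koszulDegreeIso δ F N).hom := by
  refine NatTrans.ext (funext fun U => ModuleCat.hom_ext (LinearMap.ext fun z =>
    uwbDecEval_injective (funext fun Y => funext fun t => ?_)))
  refine (uwbDecEval_uwbDiff η hη (koszulEquiv δ U F (N + 2) z) Y t).trans ?_
  refine Eq.trans ?_ (congrFun (congrFun (uwbDecEval_koszulEquiv δ U F N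
    ((η'.app U).hom z)) Y) t).symm
  refine (congrArg (fun Ψ => ((Twisted.restr F.obj).map (FB.addPairHom Y).op).hom
    (Ψ (FB.addPair Y) (t.comp (FB.addPairHom Y)))) (uwbDecEval_koszulEquiv δ U F (N + 2) z)).trans ?_
  refine (ubDecEval_ubKoszul z Y t).symm.trans ?_
  exact congrArg (fun z => ubDecEval (N := N) U F z Y t) (LinearMap.congr_fun (hη' U) z).symm

theorem koszulDegreeIso_naturality {F F' : OpMod k (KUwb k ε)} (θ : F ⟶ F')
    (η' : ubDegree ((dJ k δ ε).obj F) N ⟶ ubDegree ((dJ k δ ε).obj F') N)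
    (hη' : ∀ U, (η'.app U).hom = ubMap (𝟙 ((ubSharp k δ ε).obj U)) ((dJ k δ ε).map θ) N)
    (η : uwbDegree F N ⟶ uwbDegree F' N)
    (hη : ∀ A, (η.app A).hom = uwbSumMap (𝟙 ((uwbSharp k ε).obj A)) θ N) :
    η' ≫ (koszulDegreeIso δ F' N).hom = (koszulDegreeIso δ F N).hom ≫ (phi k δ (-ε)).map η := by
  refine NatTrans.ext (funext fun U => ModuleCat.hom_ext (LinearMap.ext fun z =>
    uwbDecEval_injective (funext fun Y => funext fun t => ?_)))
  refine (congrFun (congrFun (uwbDecEval_koszulEquiv δ U F' N ((η'.app U).hom z)) Y) t).trans ?_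
  refine Eq.trans ?_ (uwbDecEval_map θ η hη (koszulEquiv δ U F N z) Y t).symm
  refine Eq.trans ?_ (congrArg (fun Ψ => (θ.hom.app (op ⟨FB.toUwbOrd.obj Y⟩)).hom (Ψ Y t))
    (uwbDecEval_koszulEquiv δ U F N z)).symm
  have h1 := ubDecEval_map (δ := δ) (𝟙 U) θ z Y t
  rw [CategoryTheory.Functor.map_id] at h1
  exact (congrArg (fun z => ubDecEval (N := N) U F' z Y t)
    (LinearMap.congr_fun (hη' U) z)).trans h1

/-- The isomorphism between the complexes. -/
def koszulComplexIso : (secondKoszulUb k δ ε).obj ((dJ k δ ε).obj F) ≅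
    ((phi k δ (-ε)).mapHomologicalComplex (ComplexShape.down' (2 : ℕ))).obj
      ((secondKoszulUwb k ε).obj F) :=
  HomologicalComplex.Hom.isoOfComponents (fun N => koszulDegreeIso δ F N) fun i j hij => by
    obtain rfl : j + 2 = i := hij
    exact koszulDegreeIso_comm δ F j ((ubComplex ((dJ k δ ε).obj F)).d (j + 2) j)
      (fun U => ubComplex_d_app δ U j _) ((uwbComplex F).d (j + 2) j) (uwbComplex_d_app F j)

variable (k ε) in
/-- The natural isomorphism between the complexes. -/
def koszulIso : dJ k δ ε ⋙ secondKoszulUb k δ ε ≅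
    secondKoszulUwb k ε ⋙
      (phi k δ (-ε)).mapHomologicalComplex (ComplexShape.down' (2 : ℕ)) :=
  NatIso.ofComponents (fun F => koszulComplexIso δ F) fun θ =>
    HomologicalComplex.hom_ext _ _ fun N =>
      koszulDegreeIso_naturality δ N θ (((secondKoszulUb k δ ε).map ((dJ k δ ε).map θ)).f N)
        (fun _ => rfl) (((secondKoszulUwb k ε).map θ).f N) (fun _ => rfl)

end Iso

/-! ### The isomorphism on homology -/

section Homology

variable (k : Type u) [Field k] [CharZero k] (δ ε : ℤˣ)

/-- An exact functor commutes with homology, naturally in the complex; this is combined with the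
homology of the isomorphism of complexes. -/
theorem nonempty_homology_iso (N : ℕ) : Nonempty
    (dJ k δ ε ⋙ secondKoszulUb k δ ε ⋙
        HomologicalComplex.homologyFunctor (FB ⥤ ModuleCat.{u} k) (ComplexShape.down' (2 : ℕ)) N ≅
      secondKoszulUwb k ε ⋙
        HomologicalComplex.homologyFunctor (FB × FB ⥤ ModuleCat.{u} k)
          (ComplexShape.down' (2 : ℕ)) N ⋙ phi k δ (-ε)) := by
  obtain ⟨_, _⟩ := phi_exact (k := k) δ (-ε)
  let c := ComplexShape.down' (2 : ℕ)
  let e : (phi k δ (-ε)).mapHomologicalComplex c ⋙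
      HomologicalComplex.homologyFunctor (FB ⥤ ModuleCat.{u} k) c N ≅
        HomologicalComplex.homologyFunctor (FB × FB ⥤ ModuleCat.{u} k) c N ⋙ phi k δ (-ε) :=
    NatIso.ofComponents (fun K => (K.sc N).mapHomologyIso (phi k δ (-ε))) fun f =>
      ShortComplex.mapHomologyIso_hom_naturality
        ((HomologicalComplex.shortComplexFunctor _ c N).map f) (phi k δ (-ε))
  exact ⟨(Functor.associator _ _ _).symm ≪≫ Functor.isoWhiskerRight (koszulIso k δ ε) _ ≪≫
    Functor.associator _ _ _ ≪≫ Functor.isoWhiskerLeft _ e⟩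

end Homology

end
end BrauerKoszul

theorem mainTheorem6 (k : Type u) [Field k] [CharZero k] (δ ε : ℤˣ) :
    Nonempty (BrauerKoszul.dJ k δ ε ⋙ BrauerKoszul.secondKoszulUb k δ ε ≅
        BrauerKoszul.secondKoszulUwb k ε ⋙
          (BrauerKoszul.phi k δ (-ε)).mapHomologicalComplex (ComplexShape.down' (2 : ℕ))) ∧
      (Limits.PreservesFiniteLimits (BrauerKoszul.phi k δ (-ε)) ∧
        Limits.PreservesFiniteColimits (BrauerKoszul.phi k δ (-ε))) ∧
      ∀ N : ℕ, Nonempty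
        (BrauerKoszul.dJ k δ ε ⋙ BrauerKoszul.secondKoszulUb k δ ε ⋙
            HomologicalComplex.homologyFunctor (BrauerKoszul.FB ⥤ ModuleCat.{u} k)
              (ComplexShape.down' (2 : ℕ)) N ≅
          BrauerKoszul.secondKoszulUwb k ε ⋙
            HomologicalComplex.homologyFunctor
              (BrauerKoszul.FB × BrauerKoszul.FB ⥤ ModuleCat.{u} k)
              (ComplexShape.down' (2 : ℕ)) N ⋙
            BrauerKoszul.phi k δ (-ε)) := by
  exact ⟨⟨BrauerKoszul.koszulIso k δ ε⟩, BrauerKoszul.phi_exact δ (-ε),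
    BrauerKoszul.nonempty_homology_iso k δ ε⟩
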